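/- Let $f_\oplus$ be a probability density on $\mathbb R$ with finite second moment whose support $D_\oplus$ is an interval; let $F_\oplus$ be its cdf and $\mu_\oplus$ the measure $f_\oplus(u)\,du$. The tangent space $\mathcal T_{f_\oplus}$ is the closure in $L^2(\mathbb R,\mu_\oplus)$ of $\{\lambda(T-\mathrm{id}):\lambda>0,\ T$ an optimal transport map from $\mu_\oplus$ to a probability measure with finite second moment$\}$. Let $p\in\mathbb N$, $\boldsymbol\beta=(\beta_1,\dots,\beta_p)^\top\in\mathbb R^p$, and suppose: (A1') $\phi(z)=1-\beta_1z-\dots-\beta_pz^p$ has no root in $\{z\in\mathbb C:|z|\le1\}$; write $1/\phi(z)=\sum_{i\ge0}\psi_iz^i$. (A2) $\{\epsilon_t\}_{t\in\mathbb Z}$ are stochastic processes (jointly measurable in $(\omega,u)$) which almost surely lie in $\mathcal T_{f_\oplus}$, are iid as random elements of it, and have mean zero; with $C_\epsilon(u,v)=\mathrm{Cov}(\epsilon_t(u),\epsilon_t(v))$ one has $0<\int_{\mathbb R} C_\epsilon(u,u)f_\oplus(u)\,du<\infty$. (A3) $\{V_t\}_{t\in\mathbb Z}$ is a stationary solution in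 $\mathcal T_{f_\oplus}$ of $V_t=\sum_{j=1}^p\beta_jV_{t-j}+\epsilon_t$, $t\in\mathbb Z$ (stationary: $E\|V_t\|^2<\infty$, $E V_t$ is constant in $t$, and the autocovariance operators $x\mapsto E[\langle V_t-EV_0,x\rangle(V_{t+h}-EV_0)]$ do not depend on $t$), and for each $t$, almost surely, (a version of) $V_t$ is differentiable with $V_t'(u)>-1$ at every interior point $u$ of $D_\oplus$. (A4) $\int_{\mathbb R}E[\epsilon_t^4(u)]f_\oplus(u)\,du<\infty$. Let $Q_t$ be the quantile function of the random distribution $\mathrm{Exp}_{f_\oplus}(V_t)=(V_t+\mathrm{id})_\#\mu_\oplus$. From $Q_1,\dots,Q_n$ form the estimated Wasserstein mean, with cdf $\widehat F_\oplus=\bigl(\frac1n\sum_{t=1}^nQ_t\bigr)^{-1}$ (generalized inverse) and density $\hat f_\oplus=\widehat F_\oplus'$, and put $\widehat T_t=Q_t\circ\widehat F_\oplus$, $$\hat\eta_h(u)=\frac1n\sum_{t=1}^{n-h}\{\widehat T_t(u)-u\}\{\widehat T_{t+h}(u)-u\},$$ $$\widehat{\boldsymbol\beta}=\Bigl(\int_{\mathbb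 R}\bigl[\hat\eta_{|j-k|}(u)\bigr]_{j,k=1}^p\hat f_\oplus(u)\,du\Bigr)^{-1}\int_{\mathbb R}(\hat\eta_1(u),\dots,\hat\eta_p(u))^\top\hat f_\oplus(u)\,du .$$ Then $\sum_i|\psi_i|<\infty$, the matrix $R=\bigl(\sum_{k\ge0}\psi_k\psi_{k+|i-j|}\bigr)_{i,j=1}^p$ is positive definite, $\int_{\mathbb R^2}C_\epsilon^2(u,v)f_\oplus(u)f_\oplus(v)\,du\,dv<\infty$, and, as $n\to\infty$, $$n^{1/2}(\widehat{\boldsymbol\beta}-\boldsymbol\beta)\xrightarrow{D}\mathbf N(0,\boldsymbol\Sigma),\qquad \boldsymbol\Sigma=\sigma_\epsilon^2R^{-1},\qquad \sigma_\epsilon^2=\frac{\int_{\mathbb R^2}C_\epsilon^2(u,v)f_\oplus(u)f_\oplus(v)\,du\,dv}{\bigl[\int_{\mathbb R}C_\epsilon(u,u)f_\oplus(u)\,du\bigr]^2}.$$ -/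

import Mathlib

open MeasureTheory ProbabilityTheory Filter

namespace WAR

noncomputable section

/-! ### The space of densities, transport maps and the tangent space -/

/-- `μ` is a probability measure on `ℝ` with finite second moment. -/
def IsW2 (μ : Measure ℝ) : Prop :=
  IsProbabilityMeasure μ ∧ MemLp (fun u : ℝ => u) 2 μ

/-- `μ` is a probability measure on `ℝ` with finite second moment that has a density with respect
to Lebesgue measure. The density is not named: `∫ g(u) f(u) du` is `∫ u, g u ∂μ`. -/
def IsDensity (μ : Measure ℝ) : Prop :=
  IsW2 μ ∧ μ ≪ (volume : Measure ℝ)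

/-- `T` is an optimal transport map from `μ` to some `ν` with finite second moment: it pushes `μ`
to `ν`, and its quadratic cost is least among all maps pushing `μ` to `ν`. -/
def IsOptimalTransportMap (μ : Measure ℝ) (T : ℝ → ℝ) : Prop :=
  Measurable T ∧ IsW2 (μ.map T) ∧
    ∀ K : ℝ → ℝ, Measurable K → μ.map K = μ.map T →
      ∫⁻ u, ENNReal.ofReal ((T u - u) ^ 2) ∂μ ≤ ∫⁻ u, ENNReal.ofReal ((K u - u) ^ 2) ∂μ

/-- The tangent space at `μ`: the closure in `L²(ℝ, μ)` of the set of all `c (T - id)`, `c > 0`,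
`T` an optimal transport map from `μ`. -/
def tangentSpace (μ : Measure ℝ) : Set (Lp ℝ 2 μ) :=
  closure {v : Lp ℝ 2 μ | ∃ c : ℝ, 0 < c ∧ ∃ T : ℝ → ℝ, IsOptimalTransportMap μ T ∧
    (v : ℝ → ℝ) =ᵐ[μ] fun u => c * (T u - u)}

open Classical in
/-- The class in `L²(ℝ, μ)` of a square integrable function (`0` for any other function). -/
def toL2 (μ : Measure ℝ) (g : ℝ → ℝ) : Lp ℝ 2 μ :=
  if h : MemLp g 2 μ then h.toLp g else 0

/-- The exponential map at `μ`: the image of `μ` under `V + id`. -/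
def expMap (μ : Measure ℝ) (V : Lp ℝ 2 μ) : Measure ℝ :=
  μ.map fun u => V u + u

/-- The quantile function of a probability measure on `ℝ` (used at levels `0 < s < 1`). -/
def quantile (ν : Measure ℝ) (s : ℝ) : ℝ :=
  sInf {x : ℝ | s ≤ cdf ν x}

/-! ### The autoregressive polynomial and its causal expansion -/

/-- `φ(z) = 1 - β₁ z - ⋯ - β_p z ^ p`; the coefficient `β_{j+1}` is `β j`. -/
def arPoly {p : ℕ} (β : EuclideanSpace ℝ (Fin p)) : Polynomial ℝ :=
  1 - ∑ j : Fin p, Polynomial.C (β j) * Polynomial.X ^ ((j : ℕ) + 1)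

/-- `φ` has no root in the closed complex unit disk. -/
def NoRootInUnitDisk {p : ℕ} (β : EuclideanSpace ℝ (Fin p)) : Prop :=
  ∀ z : ℂ, ‖z‖ ≤ 1 → Polynomial.aeval z (arPoly β) ≠ 0

/-- The coefficients of `1 / φ(z) = ∑ i, ψ_i z ^ i`. -/
def psi {p : ℕ} (β : EuclideanSpace ℝ (Fin p)) (i : ℕ) : ℝ :=
  PowerSeries.coeff i ((arPoly β : PowerSeries ℝ)⁻¹)

/-- The matrix with entries `∑ k, ψ_k ψ_{k + |i - j|}`. -/
def psiMatrix {p : ℕ} (β : EuclideanSpace ℝ (Fin p)) : Matrix (Fin p) (Fin p) ℝ :=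
  Matrix.of fun i j => ∑' k : ℕ, psi β k * psi β (k + ((i : ℤ) - (j : ℤ)).natAbs)

section Model

variable {Ω : Type*} [MeasurableSpace Ω]

/-! ### Innovations -/

/-- The covariance kernel `C(u, v) = Cov(e(u), e(v))` of a stochastic process `e`. -/
def covKernel (P : Measure Ω) (e : Ω → ℝ → ℝ) (u v : ℝ) : ℝ :=
  cov[fun ω => e ω u, fun ω => e ω v; P]

/-- The innovations are (jointly measurable) stochastic processes that lie in the tangent space at
`μ` almost surely, are independent and identically distributed as random elements of it, have mean
zero, and `∫ C(u, u) dμ(u) < ∞`. -/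
structure IsInnovation (μ : Measure ℝ) (P : Measure Ω) (ε : ℤ → Ω → ℝ → ℝ) : Prop where
  measurable : ∀ t, Measurable (Function.uncurry (ε t))
  mem_tangentSpace : ∀ t, ∀ᵐ ω ∂P, MemLp (ε t ω) 2 μ ∧ toL2 μ (ε t ω) ∈ tangentSpace μ
  indep : iIndepFun (m := fun _ : ℤ => borel (Lp ℝ 2 μ)) (fun t ω => toL2 μ (ε t ω)) P
  identDistrib : ∀ t, @IdentDistrib Ω Ω (Lp ℝ 2 μ) _ _ (borel (Lp ℝ 2 μ))
    (fun ω => toL2 μ (ε t ω)) (fun ω => toL2 μ (ε 0 ω)) P P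
  memLp_two : ∀ t, ∀ᵐ u ∂μ, MemLp (fun ω => ε t ω u) 2 P
  mean_zero : ∀ t, ∀ᵐ u ∂μ, ∫ ω, ε t ω u ∂P = 0
  integrable_covKernel : ∀ t, Integrable (fun u => covKernel P (ε t) u u) μ

/-- Finite integrated fourth moments: `∫ E[ε_t(u) ^ 4] dμ(u) < ∞`. -/
def HasFourthMoment (μ : Measure ℝ) (P : Measure Ω) (ε : ℤ → Ω → ℝ → ℝ) : Prop :=
  ∀ t, ∫⁻ u, ∫⁻ ω, ENNReal.ofReal (ε t ω u ^ 4) ∂P ∂μ < ⊤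

/-- `σ_ε² = ∫∫ C(u, v)² dμ(u) dμ(v) / (∫ C(u, u) dμ(u))²`. -/
def sigmaSq (μ : Measure ℝ) (P : Measure Ω) (ε : ℤ → Ω → ℝ → ℝ) : ℝ :=
  (∫ z : ℝ × ℝ, covKernel P (ε 0) z.1 z.2 ^ 2 ∂(μ.prod μ)) /
    (∫ u, covKernel P (ε 0) u u ∂μ) ^ 2

/-- The asymptotic covariance matrix: `σ_ε²` times the inverse of the matrix
`(∑ k, ψ_k ψ_{k + |i - j|})_{i j}`. -/
def asympCov (μ : Measure ℝ) (P : Measure Ω) (ε : ℤ → Ω → ℝ → ℝ) {p : ℕ}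
    (β : EuclideanSpace ℝ (Fin p)) : Matrix (Fin p) (Fin p) ℝ :=
  sigmaSq μ P ε • (psiMatrix β)⁻¹

/-! ### The autoregressive model in the tangent space -/

/-- (Second-order) stationarity of a sequence of random elements of a Hilbert space: finite second
moments, constant mean, and autocovariance operators that depend on the lag only. -/
structure IsStationary {H : Type*} [NormedAddCommGroup H] [InnerProductSpace ℝ H]
    (P : Measure Ω) (V : ℤ → Ω → H) : Prop where
  memLp_two : ∀ t, MemLp (V t) 2 P
  mean_eq : ∀ t, ∫ ω, V t ω ∂P = ∫ ω, V 0 ω ∂P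
  autocov_eq : ∀ (t h : ℤ) (x : H),
    ∫ ω, inner ℝ (V t ω - ∫ ω', V 0 ω' ∂P) x • (V (t + h) ω - ∫ ω', V 0 ω' ∂P) ∂P =
      ∫ ω, inner ℝ (V 0 ω - ∫ ω', V 0 ω' ∂P) x • (V h ω - ∫ ω', V 0 ω' ∂P) ∂P

/-- `V` is a stationary solution, in the tangent space at `μ`, of
`V_t = β₁ V_{t-1} + ⋯ + β_p V_{t-p} + ε_t`, `t ∈ ℤ`. -/
structure IsStationarySolution (μ : Measure ℝ) (P : Measure Ω) {p : ℕ}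
    (β : EuclideanSpace ℝ (Fin p)) (ε : ℤ → Ω → ℝ → ℝ) (V : ℤ → Ω → Lp ℝ 2 μ) : Prop where
  mem_tangentSpace : ∀ t, ∀ᵐ ω ∂P, V t ω ∈ tangentSpace μ
  stationary : IsStationary P V
  equation : ∀ t, ∀ᵐ ω ∂P,
    V t ω = ∑ j : Fin p, β j • V (t - ((j : ℤ) + 1)) ω + toL2 μ (ε t ω)

/-- Almost surely, `V_t` is differentiable with `V_t' > -1` on the support of `μ`. As `V_t` is
determined up to `μ`-null sets only, this is asked of some version of it, and nothing is asked at
the endpoints of the support. -/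
def HasDerivGtNegOne (μ : Measure ℝ) (P : Measure Ω) (V : ℤ → Ω → Lp ℝ 2 μ) : Prop :=
  ∀ t, ∀ᵐ ω ∂P, ∃ g : ℝ → ℝ, g =ᵐ[μ] V t ω ∧
    ∀ u ∈ interior μ.support, DifferentiableAt ℝ g u ∧ -1 < deriv g u

/-- The quantile function `Q_t` of the observed random distribution `Exp_μ(V_t)`. -/
def quantileSeries (μ : Measure ℝ) (V : ℤ → Ω → Lp ℝ 2 μ) (ω : Ω) (t : ℤ) : ℝ → ℝ :=
  quantile (expMap μ (V t ω))

end Model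

/-! ### The estimator

Throughout, `Q t` is the quantile function of the `t`-th distribution, and the sample is
`Q 1, …, Q n`. -/

section Estimator

variable (Q : ℤ → ℝ → ℝ) (n : ℕ)

/-- Quantile function of the estimated Wasserstein mean: the average of the quantile functions. -/
def meanQuantile (s : ℝ) : ℝ :=
  (n : ℝ)⁻¹ * ∑ t ∈ Finset.Icc 1 n, Q t s

/-- Cdf of the estimated Wasserstein mean: the (generalized) inverse of `meanQuantile`. -/
def meanCdf (u : ℝ) : ℝ :=
  sSup {s : ℝ | 0 < s ∧ s < 1 ∧ meanQuantile Q n s ≤ u}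

/-- Density of the estimated Wasserstein mean. -/
def meanDensity (u : ℝ) : ℝ :=
  deriv (meanCdf Q n) u

/-- The estimated optimal transport map from the estimated Wasserstein mean. -/
def transportEst (t : ℤ) (u : ℝ) : ℝ :=
  Q t (meanCdf Q n u)

/-- The estimated lag-`h` autocovariance at `u`. -/
def etaEst (h : ℕ) (u : ℝ) : ℝ :=
  (n : ℝ)⁻¹ * ∑ t ∈ Finset.Icc 1 (n - h),
    (transportEst Q n t u - u) * (transportEst Q n ((t : ℤ) + (h : ℤ)) u - u)

/-- The integral of `etaEst` against the estimated Wasserstein mean density. -/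
def etaInt (h : ℕ) : ℝ :=
  ∫ u : ℝ, etaEst Q n h u * meanDensity Q n u

/-- The Yule-Walker type estimator of `(β₁, …, β_p)`. -/
def betaEst (p : ℕ) : EuclideanSpace ℝ (Fin p) :=
  WithLp.toLp 2 (Matrix.mulVec
    (Matrix.of fun j k : Fin p => etaInt Q n ((j : ℤ) - (k : ℤ)).natAbs)⁻¹
    (fun j : Fin p => etaInt Q n ((j : ℕ) + 1)))

end Estimator

end

end WAR

/-!
The quantile functions and the estimated mean disappear at once. On the interior `I` of the support
of `μ`, the maps `T_t = V_t + id` are continuous and strictly increasing, so the quantile function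
of `(T_t)_# μ` is `T_t ∘ F⁻¹` (`quantile_map_cdf`), the average of the quantile functions is
`T̄ ∘ F⁻¹` with `T̄ = n⁻¹ ∑ T_t`, and its generalized inverse is the cdf of `T̄_# μ`
(`sSup_quantile_le_eq_cdf_map`). As `T̄' > 0`, this image is absolutely continuous
(`map_absolutelyContinuous`), and the estimated density is its density. Since the estimated maps
satisfy `Q_t ∘ F̂ ∘ T̄ = T_t` on `I`, substituting `T̄` in the integrated autocovariance estimators
turns them into the ordinary sample autocovariances of `V_1, …, V_n` in the Hilbert space `L²(μ)`
(`etaInt_quantile_expMap`). The theorem is therefore one about the Yule-Walker estimator for an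
autoregression with real coefficients in a separable Hilbert space
(`tendstoInDistribution_yuleWalker_hilbert`).

For this, the sequence `V_t` is regarded as a bounded sequence in `L²(P; L²(μ))`, with the bilinear
map `⟨·, ·⟩ : L² × L² → L¹` (`innerL1`); most steps are then statements on sequences in normed
spaces. Iterating the equation gives `V_t = ∑ ψ_i ε_{t-i}`, uniformly in `t`
(`isLinearProcess_psi`), because the `ψ_i` are absolutely summable: `1 / φ` is a product of
geometric series (`summable_abs_psi`). Hence the sample autocovariances converge in `L¹` to `τ R`,
where `τ = E‖ε_0‖²` (`tendsto_sampleCov`). The Yule-Walker residuals `γ_{j+1} - ∑ β_k γ_{|j-k|}`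
equal `n⁻¹ ∑ ⟨V_{t-1-j}, ε_t⟩` up to `O(1 / n)` in `L¹` (`exists_norm_residual_sub_le`); here the
centring at the sample mean is harmless as `φ(1) ≠ 0` makes the sums of the `V_t` of order `√n`
(`exists_norm_sum_le`).

The products `⟨ε_{t-1-l}, ε_t⟩` form an orthogonal family in `L²(P)` with common variance
`κ = E⟨ε_0, ε_1⟩²` (`IsWhiteNoise.integral_lagProd_mul`); independence and second moments of the
`ε_t` suffice for this, so that second moments carry the whole argument. Finite combinations of
such products satisfy a central limit theorem, by long independent blocks
(`IsWhiteNoise.tendsto_integral_cexp_lagSum`), and an approximation in `L²` extends it to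
`∑ j, a_j ⟨V_{t-1-j}, ε_t⟩` (`IsWhiteNoise.tendsto_integral_cexp_innerL1`), with limiting variance
`κ aᵀRa`: the matrix `R` is the Gram matrix of the delayed sequences `ψ`
(`dotProduct_psiMatrix_mulVec`), which also shows that it is positive definite
(`posDef_psiMatrix`). Slutsky's theorem (`tendstoInDistribution_yuleWalker`) then gives the
covariance `(τR)⁻¹ (κR) (τR)⁻¹ = (κ / τ²) R⁻¹`, and by Fubini's theorem `τ = ∫ C(u, u) dμ` and
`κ = ∫∫ C(u, v)² dμ dμ` (`IsInnovation.exists_isWhiteNoise`).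
-/

open scoped Topology

set_option linter.unusedSectionVars false


namespace WAR

/-! ### The autoregressive polynomial -/

section Polynomial

variable {p : ℕ}

lemma constantCoeff_arPoly (β : EuclideanSpace ℝ (Fin p)) :
    PowerSeries.constantCoeff (arPoly β : PowerSeries ℝ) = 1 := by
  simp [arPoly, Polynomial.coeff_zero_eq_eval_zero, Polynomial.eval_finsetSum]

lemma arPoly_mul_inv (β : EuclideanSpace ℝ (Fin p)) :
    (arPoly β : PowerSeries ℝ) * (arPoly β : PowerSeries ℝ)⁻¹ = 1 :=
  PowerSeries.mul_inv_cancel _ (by rw [constantCoeff_arPoly]; exact one_ne_zero)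

/-- The coefficients of `z ^ j / φ(z)`, that is, `ψ` delayed by `j`. -/
noncomputable def psiShift (β : EuclideanSpace ℝ (Fin p)) (j l : ℕ) : ℝ :=
  if j ≤ l then psi β (l - j) else 0

lemma coe_arPoly (β : EuclideanSpace ℝ (Fin p)) :
    (arPoly β : PowerSeries ℝ) =
      1 - ∑ j : Fin p, PowerSeries.C (β j) * PowerSeries.X ^ ((j : ℕ) + 1) := by
  rw [arPoly, ← Polynomial.coeToPowerSeries.ringHom_apply, map_sub, map_sum, map_one]
  simp [Polynomial.coeToPowerSeries.ringHom_apply]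

/-- The recursion `φ(z) ∑ ψ_i z ^ i = 1`, coefficient by coefficient. -/
lemma psi_eq (β : EuclideanSpace ℝ (Fin p)) (m : ℕ) :
    psi β m = (if m = 0 then 1 else 0) + ∑ j : Fin p, β j * psiShift β (j + 1) m := by
  have h := congrArg (PowerSeries.coeff m) (arPoly_mul_inv β)
  rw [coe_arPoly, sub_mul, one_mul, Finset.sum_mul, map_sub, map_sum, PowerSeries.coeff_one,
    ← coe_arPoly] at h
  have h2 : ∀ j : Fin p, PowerSeries.coeff m (PowerSeries.C (β j) * PowerSeries.X ^ ((j : ℕ) + 1) *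
      (arPoly β : PowerSeries ℝ)⁻¹) = β j * psiShift β (j + 1) m := by
    intro j
    rw [mul_assoc, PowerSeries.coeff_C_mul, PowerSeries.coeff_X_pow_mul']
    rfl
  simp only [h2] at h
  rw [← h, psi]
  ring

lemma psi_zero (β : EuclideanSpace ℝ (Fin p)) : psi β 0 = 1 := by
  rw [psi_eq]; simp [psiShift]

/-- The geometric series. -/
lemma inv_X_sub_C (r : ℂ) (hr : r ≠ 0) :
    ((PowerSeries.X - PowerSeries.C r : PowerSeries ℂ))⁻¹ =
      PowerSeries.mk fun n => -(r⁻¹) ^ (n + 1) := by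
  rw [PowerSeries.inv_eq_iff_mul_eq_one (by simpa using hr)]
  ext n
  rw [mul_sub, map_sub, PowerSeries.coeff_mul_C, PowerSeries.coeff_one]
  cases n with
  | zero => simp [hr]
  | succ n =>
    rw [PowerSeries.coeff_succ_mul_X]
    simp only [PowerSeries.coeff_mk, Nat.add_eq_zero_iff, one_ne_zero, and_false, ↓reduceIte]
    rw [pow_succ _ (n + 1), neg_mul, mul_assoc, inv_mul_cancel₀ hr]
    ring

/-- The reciprocal of a product of linear factors whose roots lie outside the closed unit disk has
absolutely summable coefficients, by Cauchy products of geometric series. -/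
lemma summable_norm_coeff_inv_prod (s : Multiset ℂ) (hs : ∀ r ∈ s, 1 < ‖r‖) :
    Summable fun n => ‖PowerSeries.coeff n
      ((s.map fun r => (PowerSeries.X - PowerSeries.C r : PowerSeries ℂ)).prod)⁻¹‖ := by
  induction s using Multiset.induction_on with
  | empty =>
    refine summable_of_ne_finset_zero (s := {0}) fun n hn => ?_
    simp only [Multiset.map_zero, Multiset.prod_zero, inv_one, PowerSeries.coeff_one]
    simp_all
  | cons r s ih =>
    have hr := hs r (Multiset.mem_cons_self r s)
    have hr0 : r ≠ 0 := by rintro rfl; simp at hr; linarith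
    rw [Multiset.map_cons, Multiset.prod_cons, PowerSeries.mul_inv_rev, inv_X_sub_C r hr0]
    simp only [PowerSeries.coeff_mul]
    refine summable_norm_sum_mul_antidiagonal_of_summable_norm (R := ℂ)
      (f := fun n => PowerSeries.coeff n
        ((s.map fun r => (PowerSeries.X - PowerSeries.C r : PowerSeries ℂ)).prod)⁻¹)
      (g := fun n => PowerSeries.coeff n (PowerSeries.mk fun n => -(r⁻¹) ^ (n + 1)))
      (ih fun r' hr' => hs r' (Multiset.mem_cons_of_mem hr')) ?_
    simp only [PowerSeries.coeff_mk, norm_neg, norm_pow, norm_inv]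
    exact (summable_nat_add_iff 1).2 (summable_geometric_of_lt_one (by positivity)
      (inv_lt_one_of_one_lt₀ hr))

lemma ofReal_psi (β : EuclideanSpace ℝ (Fin p)) (i : ℕ) :
    ((psi β i : ℝ) : ℂ) = PowerSeries.coeff i
      (((arPoly β).map (algebraMap ℝ ℂ) : Polynomial ℂ) : PowerSeries ℂ)⁻¹ := by
  have h : (((arPoly β).map (algebraMap ℝ ℂ) : Polynomial ℂ) : PowerSeries ℂ)⁻¹ =
      PowerSeries.map (algebraMap ℝ ℂ) ((arPoly β : PowerSeries ℝ)⁻¹) := by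
    have h0 : (((arPoly β).map (algebraMap ℝ ℂ) : Polynomial ℂ) : PowerSeries ℂ) =
        PowerSeries.map (algebraMap ℝ ℂ) (arPoly β : PowerSeries ℝ) := by
      simp
    rw [h0, PowerSeries.inv_eq_iff_mul_eq_one, mul_comm, ← map_mul, arPoly_mul_inv, map_one]
    have := constantCoeff_arPoly β
    rw [← PowerSeries.coeff_zero_eq_constantCoeff_apply] at this ⊢
    rw [PowerSeries.coeff_map, this]
    simp
  rw [h, PowerSeries.coeff_map]
  rfl

/-- As `φ` has its roots outside the closed unit disk, the coefficients of `1 / φ` are absolutely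
summable. -/
lemma summable_abs_psi (β : EuclideanSpace ℝ (Fin p)) (hβ : NoRootInUnitDisk β) :
    Summable fun i => |psi β i| := by
  set q : Polynomial ℂ := (arPoly β).map (algebraMap ℝ ℂ) with hq
  have hq1 : q.coeff 0 = 1 := by
    have := constantCoeff_arPoly β
    rw [Polynomial.constantCoeff_coe] at this
    rw [hq, Polynomial.coeff_map, this, map_one]
  have hq0 : q ≠ 0 := by rintro h; simp [h] at hq1
  have hroots : ∀ r ∈ q.roots, 1 < ‖r‖ := by
    intro r hr
    by_contra! h
    refine hβ r h ?_
    have := (Polynomial.mem_roots hq0).1 hr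
    rwa [Polynomial.IsRoot, hq, Polynomial.eval_map_algebraMap] at this
  have hfac := (IsAlgClosed.splits q).eq_prod_roots
  have hcoe : (q : PowerSeries ℂ) = PowerSeries.C q.leadingCoeff *
      (q.roots.map fun r => (PowerSeries.X - PowerSeries.C r : PowerSeries ℂ)).prod := by
    conv_lhs => rw [hfac]
    rw [← Polynomial.coeToPowerSeries.ringHom_apply, map_mul, map_multiset_prod, Multiset.map_map]
    simp [Polynomial.coeToPowerSeries.ringHom_apply, Function.comp_def]
  have key : ∀ i, |psi β i| = ‖(q.leadingCoeff)⁻¹‖ * ‖PowerSeries.coeff i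
      ((q.roots.map fun r => (PowerSeries.X - PowerSeries.C r : PowerSeries ℂ)).prod)⁻¹‖ := by
    intro i
    rw [← Real.norm_eq_abs, ← Complex.norm_real, ofReal_psi, ← hq, hcoe, PowerSeries.mul_inv_rev,
      PowerSeries.C_inv, PowerSeries.coeff_mul_C, norm_mul, mul_comm]
  simp only [key]
  exact (summable_norm_coeff_inv_prod _ hroots).mul_left _

end Polynomial

/-! ### The limiting autocorrelation matrix -/

section PsiMatrix

variable {p : ℕ}

lemma psiShift_self (β : EuclideanSpace ℝ (Fin p)) (j : ℕ) : psiShift β j j = 1 := by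
  simp [psiShift, psi_zero]

lemma psiShift_add (β : EuclideanSpace ℝ (Fin p)) (j k : ℕ) : psiShift β j (k + j) = psi β k := by
  simp [psiShift]

lemma summable_abs_psiShift (β : EuclideanSpace ℝ (Fin p)) (hβ : NoRootInUnitDisk β) (j : ℕ) :
    Summable fun l => |psiShift β j l| := by
  rw [← summable_nat_add_iff j]
  simpa only [psiShift_add] using summable_abs_psi β hβ

lemma summable_mul_of_summable_abs {f g : ℕ → ℝ} (hf : Summable fun l => |f l|)
    (hg : Summable fun l => |g l|) : Summable fun l => f l * g l := by
  refine Summable.of_norm_bounded_eventually_nat hf ?_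
  have h0 := hg.tendsto_atTop_zero
  filter_upwards [h0.eventually (gt_mem_nhds one_pos)] with l hl
  rw [norm_mul, Real.norm_eq_abs, Real.norm_eq_abs]
  exact mul_le_of_le_one_right (abs_nonneg _) hl.le

lemma tsum_psiShift_mul_of_le (β : EuclideanSpace ℝ (Fin p)) (hβ : NoRootInUnitDisk β) {j k : ℕ}
    (hjk : j ≤ k) :
    ∑' l, psiShift β j l * psiShift β k l = ∑' m, psi β m * psi β (m + (k - j)) := by
  have hs := summable_mul_of_summable_abs (summable_abs_psiShift β hβ j)
    (summable_abs_psiShift β hβ k)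
  rw [← hs.sum_add_tsum_nat_add k, Finset.sum_eq_zero, zero_add]
  · refine tsum_congr fun m => ?_
    rw [psiShift_add, mul_comm, psiShift, if_pos (by omega), Nat.add_sub_assoc hjk]
  · intro l hl
    have : ¬ k ≤ l := by simpa using hl
    simp [psiShift, this]

/-- The matrix `R` is the Gram matrix of the delayed coefficient sequences in `ℓ²`. -/
lemma psiMatrix_apply (β : EuclideanSpace ℝ (Fin p)) (hβ : NoRootInUnitDisk β) (j k : Fin p) :
    psiMatrix β j k = ∑' l, psiShift β j l * psiShift β k l := by
  rcases le_total (j : ℕ) k with h | h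
  · rw [tsum_psiShift_mul_of_le β hβ h, psiMatrix, Matrix.of_apply]
    have : ((j : ℤ) - (k : ℤ)).natAbs = k - j := by omega
    rw [this]
  · simp_rw [mul_comm (psiShift β j _)]
    rw [tsum_psiShift_mul_of_le β hβ h, psiMatrix, Matrix.of_apply]
    have : ((j : ℤ) - (k : ℤ)).natAbs = j - k := by omega
    rw [this]

/-- The coefficients of `(a₀ + a₁ z + ⋯) / φ(z)`: those of the process `∑ j, a_j V_{t-j}` in terms
of the innovations. -/
noncomputable def filterCoeff (β : EuclideanSpace ℝ (Fin p)) (a : Fin p → ℝ) (l : ℕ) : ℝ :=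
  ∑ j : Fin p, a j * psiShift β j l

lemma summable_abs_filterCoeff (β : EuclideanSpace ℝ (Fin p)) (hβ : NoRootInUnitDisk β)
    (a : Fin p → ℝ) : Summable fun l => |filterCoeff β a l| := by
  refine Summable.of_nonneg_of_le (fun _ => abs_nonneg _)
    (fun l => Finset.abs_sum_le_sum_abs _ _) ?_
  refine summable_sum fun j _ => ?_
  simp_rw [abs_mul]
  exact (summable_abs_psiShift β hβ j).mul_left _

/-- The filter determines `a`: the system `∑ j, a_j ψ_{l-j} = 0` for `l < p` is triangular with
unit diagonal. -/
lemma eq_zero_of_filterCoeff_eq_zero (β : EuclideanSpace ℝ (Fin p)) (a : Fin p → ℝ)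
    (h : ∀ l, filterCoeff β a l = 0) : a = 0 := by
  have key : ∀ l (hl : l < p), a ⟨l, hl⟩ = 0 := by
    intro l
    induction l using Nat.strong_induction_on with
    | _ l ih =>
      intro hl
      have h1 := h l
      rw [filterCoeff, Finset.sum_eq_single ⟨l, hl⟩] at h1
      · simpa [psiShift_self] using h1
      · intro j _ hj
        rcases lt_trichotomy (j : ℕ) l with h2 | h2 | h2
        · rw [ih j h2 j.2, zero_mul]
        · exact absurd (Fin.ext h2) hj
        · rw [psiShift, if_neg (by omega), mul_zero]
      · simp
  funext j
  exact key j j.2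

/-- The quadratic form of the matrix `R` is the squared `ℓ²`-norm of the filter coefficients. -/
lemma dotProduct_psiMatrix_mulVec (β : EuclideanSpace ℝ (Fin p)) (hβ : NoRootInUnitDisk β)
    (a : Fin p → ℝ) :
    dotProduct a (Matrix.mulVec (psiMatrix β) a) = ∑' l, filterCoeff β a l ^ 2 := by
  have hs : ∀ j k : Fin p, Summable fun l => (a j * psiShift β j l) * (a k * psiShift β k l) := by
    intro j k
    refine summable_mul_of_summable_abs ?_ ?_ <;> simp_rw [abs_mul] <;>
      exact (summable_abs_psiShift β hβ _).mul_left _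
  have h1 : ∀ l, filterCoeff β a l ^ 2 =
      ∑ j, ∑ k, (a j * psiShift β j l) * (a k * psiShift β k l) := by
    intro l
    rw [sq, filterCoeff, Finset.sum_mul_sum]
  simp_rw [h1]
  rw [Summable.tsum_finsetSum fun j _ => summable_sum fun k _ => hs j k]
  simp only [dotProduct, Matrix.mulVec, Finset.mul_sum]
  refine Finset.sum_congr rfl fun j _ => ?_
  rw [Summable.tsum_finsetSum fun k _ => hs j k]
  refine Finset.sum_congr rfl fun k _ => ?_
  rw [psiMatrix_apply β hβ, ← tsum_mul_right, ← tsum_mul_left]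
  exact tsum_congr fun l => by ring

lemma posDef_psiMatrix (β : EuclideanSpace ℝ (Fin p)) (hβ : NoRootInUnitDisk β) :
    (psiMatrix β).PosDef := by
  rw [Matrix.posDef_iff_dotProduct_mulVec]
  refine ⟨?_, fun a ha => ?_⟩
  · ext j k
    rw [Matrix.conjTranspose_apply, psiMatrix_apply β hβ, psiMatrix_apply β hβ]
    simp [mul_comm]
  · rw [star_trivial, dotProduct_psiMatrix_mulVec β hβ]
    have hsum : Summable fun l => filterCoeff β a l ^ 2 := by
      simp_rw [sq]
      exact summable_mul_of_summable_abs (summable_abs_filterCoeff β hβ a)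
        (summable_abs_filterCoeff β hβ a)
    obtain ⟨l, hl⟩ : ∃ l, filterCoeff β a l ≠ 0 := by
      by_contra! h
      exact ha (eq_zero_of_filterCoeff_eq_zero β a h)
    exact hsum.tsum_pos (fun _ => sq_nonneg _) l (by positivity)

end PsiMatrix

/-! ### Causal linear processes in a normed space -/

section LinearProcess

variable {E : Type*} [NormedAddCommGroup E] [NormedSpace ℝ E] {p : ℕ}

lemma sum_Ico_sub_succ {M : Type*} [AddCommGroup M] (f : ℕ → M) (N j : ℕ) :
    ∑ i ∈ Finset.Ico (N + 1 - (j + 1)) (N + 1), f i =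
      ∑ i ∈ Finset.Ico (N - (j + 1)) N, f i + f N -
        (if j + 1 ≤ N then f (N - (j + 1)) else 0) := by
  rw [Finset.sum_Ico_succ_top (by omega)]
  split_ifs with h
  · rw [Finset.sum_eq_sum_Ico_succ_bot (a := N - (j + 1)) (by omega)]
    have : N + 1 - (j + 1) = N - (j + 1) + 1 := by omega
    rw [this]
    abel
  · have h1 : N + 1 - (j + 1) = 0 := by omega
    have h2 : N - (j + 1) = 0 := by omega
    rw [h1, h2, sub_zero]

/-- Truncation of the causal expansion: the remainder after `N` innovations involves only the
coefficients `ψ_i` with `N - p ≤ i < N`. -/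
lemma sub_sum_psi_smul (β : EuclideanSpace ℝ (Fin p)) (x e : ℤ → E)
    (h : ∀ t, x t = ∑ j : Fin p, β j • x (t - ((j : ℤ) + 1)) + e t) (t : ℤ) (N : ℕ) :
    x t - ∑ i ∈ Finset.range (N + 1), psi β i • e (t - i) =
      ∑ j : Fin p, ∑ i ∈ Finset.Ico (N + 1 - ((j : ℕ) + 1)) (N + 1),
        (β j * psi β i) • x (t - i - ((j : ℤ) + 1)) := by
  induction N with
  | zero => simp [psi_zero, h t]
  | succ N ih =>
    rw [Finset.sum_range_succ, ← sub_sub, ih]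
    simp_rw [sum_Ico_sub_succ _ (N + 1)]
    rw [Finset.sum_sub_distrib, Finset.sum_add_distrib, add_sub_assoc, sub_eq_add_neg]
    congr 1
    have h1 : ∑ j : Fin p, (if (j : ℕ) + 1 ≤ N + 1 then
        (β j * psi β (N + 1 - ((j : ℕ) + 1))) •
          x (t - ((N + 1 - ((j : ℕ) + 1) : ℕ) : ℤ) - ((j : ℤ) + 1)) else 0) =
        psi β (N + 1) • x (t - ((N + 1 : ℕ) : ℤ)) := by
      rw [psi_eq β (N + 1), if_neg (by omega), zero_add, Finset.sum_smul]
      refine Finset.sum_congr rfl fun j _ => ?_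
      rw [psiShift]
      split_ifs with hj
      · congr 2
        omega
      · simp
    rw [h1, h (t - ((N + 1 : ℕ) : ℤ)), smul_add, Finset.smul_sum]
    simp only [smul_smul, mul_comm (psi β (N + 1))]
    abel

/-- `z` is the causal linear process `∑ l, c_l e_{t-l}`, the series converging uniformly in `t`. -/
def IsLinearProcess (c : ℕ → ℝ) (e z : ℤ → E) : Prop :=
  ∃ δ : ℕ → ℝ, Tendsto δ atTop (𝓝 0) ∧
    ∀ N t, ‖z t - ∑ l ∈ Finset.range N, c l • e (t - l)‖ ≤ δ N

/-- A bounded solution of the autoregressive equation is the causal linear process with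
coefficients `ψ`. -/
lemma isLinearProcess_psi (β : EuclideanSpace ℝ (Fin p)) (hβ : NoRootInUnitDisk β) (x e : ℤ → E)
    (h : ∀ t, x t = ∑ j : Fin p, β j • x (t - ((j : ℤ) + 1)) + e t) (K : ℝ)
    (hK : ∀ t, ‖x t‖ ≤ K) : IsLinearProcess (psi β) e x := by
  have hψ := (summable_abs_psi β hβ)
  set ρ : ℕ → ℝ := fun N => ∑ j : Fin p, ∑ i ∈ Finset.Ico (N - ((j : ℕ) + 1)) N,
    (|β j| * |psi β i|) * K with hρ
  -- the remainder formula for `N = M + 1` terms; at `N = 0` the remainder is `x_t` itself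
  refine ⟨fun N => if N = 0 then K else ρ N, ?_, fun N t => ?_⟩
  · have h1 : Tendsto ρ atTop (𝓝 (∑ j : Fin p, 0)) := by
      refine tendsto_finsetSum _ fun j _ => ?_
      have h2 : ∀ N, ∑ i ∈ Finset.Ico (N - ((j : ℕ) + 1)) N, (|β j| * |psi β i|) * K =
          (|β j| * K) * (∑ i ∈ Finset.range N, |psi β i| -
            ∑ i ∈ Finset.range (N - ((j : ℕ) + 1)), |psi β i|) := by
        intro N
        rw [← Finset.sum_Ico_eq_sub _ (Nat.sub_le _ _), Finset.mul_sum]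
        exact Finset.sum_congr rfl fun i _ => by ring
      simp_rw [h2]
      have h3 := hψ.hasSum.tendsto_sum_nat
      have h4 := (h3.sub (h3.comp (tendsto_sub_atTop_nat ((j : ℕ) + 1)))).const_mul (|β j| * K)
      simpa using h4
    rw [Finset.sum_const_zero] at h1
    refine h1.congr' ?_
    filter_upwards [eventually_gt_atTop 0] with N hN
    rw [if_neg hN.ne']
  · rcases N with _ | N
    · simpa using hK t
    · change _ ≤ if N + 1 = 0 then K else ρ (N + 1)
      rw [if_neg (by omega), sub_sum_psi_smul β x e h]
      refine (norm_sum_le _ _).trans (Finset.sum_le_sum fun j _ => (norm_sum_le _ _).trans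
        (Finset.sum_le_sum fun i _ => ?_))
      rw [norm_smul, norm_mul, Real.norm_eq_abs, Real.norm_eq_abs]
      exact mul_le_mul_of_nonneg_left (hK _) (by positivity)

lemma IsLinearProcess.shift {β : EuclideanSpace ℝ (Fin p)} {e z : ℤ → E}
    (h : IsLinearProcess (psi β) e z) (j : ℕ) :
    IsLinearProcess (psiShift β j) e (fun t => z (t - j)) := by
  obtain ⟨δ, hδ, hz⟩ := h
  refine ⟨fun N => δ (N - j), hδ.comp (tendsto_sub_atTop_nat j), fun N t => ?_⟩
  convert! hz (N - j) (t - j) using 3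
  rcases le_total j N with hj | hj
  · obtain ⟨M, rfl⟩ := Nat.exists_eq_add_of_le hj
    rw [Finset.sum_range_add, Finset.sum_eq_zero, zero_add, Nat.add_sub_cancel_left]
    · refine Finset.sum_congr rfl fun i _ => ?_
      rw [add_comm j i, psiShift_add]
      congr 2
      push_cast
      ring
    · intro l hl
      have : ¬ j ≤ l := by simpa using hl
      simp [psiShift, this]
  · rw [Nat.sub_eq_zero_of_le hj, Finset.sum_range_zero]
    refine Finset.sum_eq_zero fun l hl => ?_
    have : ¬ j ≤ l := by have := Finset.mem_range.1 hl; omega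
    simp [psiShift, this]

lemma IsLinearProcess.filter {β : EuclideanSpace ℝ (Fin p)} {e z : ℤ → E}
    (h : IsLinearProcess (psi β) e z) (a : Fin p → ℝ) :
    IsLinearProcess (filterCoeff β a) e (fun t => ∑ j : Fin p, a j • z (t - (j : ℕ))) := by
  choose δ hδ hz using fun j : Fin p => h.shift j
  refine ⟨fun N => ∑ j : Fin p, |a j| * δ j N, ?_, fun N t => ?_⟩
  · have : Tendsto (fun N => ∑ j : Fin p, |a j| * δ j N) atTop (𝓝 (∑ j : Fin p, |a j| * 0)) :=
      tendsto_finsetSum _ fun j _ => (hδ j).const_mul _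
    simpa using this
  · have h1 : ∑ l ∈ Finset.range N, filterCoeff β a l • e (t - l) =
        ∑ j : Fin p, a j • ∑ l ∈ Finset.range N, psiShift β j l • e (t - l) := by
      simp_rw [filterCoeff, Finset.sum_smul, Finset.smul_sum, smul_smul]
      exact Finset.sum_comm
    rw [h1, ← Finset.sum_sub_distrib]
    refine (norm_sum_le _ _).trans (Finset.sum_le_sum fun j _ => ?_)
    rw [← smul_sub, norm_smul, Real.norm_eq_abs]
    exact mul_le_mul_of_nonneg_left (hz j N t) (abs_nonneg _)

end LinearProcess

/-! ### Sample averages of bilinear functions of an autoregressive sequence -/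

section Average

/-- Interchange of limits: if `w k n` approximates `z n` up to `δ k → 0` for large `n`, then the
limits in `n` of `w k` determine that of `z`. -/
lemma tendsto_of_approx {X : Type*} [PseudoMetricSpace X] {z : ℕ → X} {w : ℕ → ℕ → X} {W : ℕ → X}
    {L : X} {δ : ℕ → ℝ} (hδ : Tendsto δ atTop (𝓝 0))
    (hw : ∀ k, Tendsto (w k) atTop (𝓝 (W k))) (hW : Tendsto W atTop (𝓝 L))
    (hz : ∀ k, ∀ᶠ n in atTop, dist (z n) (w k n) ≤ δ k) : Tendsto z atTop (𝓝 L) := by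
  rw [Metric.tendsto_nhds]
  intro r hr
  have h3 : 0 < r / 3 := by positivity
  obtain ⟨k, hk1, hk2⟩ := ((hδ.eventually (gt_mem_nhds h3)).and
    ((Metric.tendsto_nhds.1 hW) _ h3)).exists
  filter_upwards [hz k, (Metric.tendsto_nhds.1 (hw k)) _ h3] with n hn1 hn2
  calc dist (z n) L ≤ dist (z n) (w k n) + dist (w k n) (W k) + dist (W k) L :=
        dist_triangle4 _ _ _ _
    _ < r := by linarith

variable {E F : Type*} [NormedAddCommGroup E] [NormedSpace ℝ E] [NormedAddCommGroup F]
  [NormedSpace ℝ F] {p : ℕ}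

lemma IsLinearProcess.exists_bound {c : ℕ → ℝ} {e z : ℤ → E} (h : IsLinearProcess c e z) :
    ∃ K, ∀ t, ‖z t‖ ≤ K := by
  obtain ⟨δ, -, hz⟩ := h
  exact ⟨δ 0, fun t => by simpa using hz 0 t⟩

lemma norm_bilin_le (B : E →L[ℝ] E →L[ℝ] F) (x y : E) {K L : ℝ} (hx : ‖x‖ ≤ K) (hy : ‖y‖ ≤ L) :
    ‖B x y‖ ≤ ‖B‖ * K * L := by
  have hK : 0 ≤ K := (norm_nonneg x).trans hx
  exact (B.le_opNorm₂ x y).trans (by gcongr)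

/-- Law of large numbers for lagged products of linear processes, given the one for the
innovations. -/
lemma IsLinearProcess.tendsto_average (B : E →L[ℝ] E →L[ℝ] F) {c c' : ℕ → ℝ} {e z z' : ℤ → E}
    (hz : IsLinearProcess c e z) (hz' : IsLinearProcess c' e z') (g : F)
    (hcc : Summable fun l => c l * c' l)
    (he : ∀ l l' : ℕ, Tendsto
      (fun n : ℕ => (n : ℝ)⁻¹ • ∑ t ∈ Finset.Icc 1 n, B (e (t - l)) (e (t - l'))) atTop
      (𝓝 (if l = l' then g else 0))) :
    Tendsto (fun n : ℕ => (n : ℝ)⁻¹ • ∑ t ∈ Finset.Icc 1 n, B (z t) (z' t)) atTop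
      (𝓝 ((∑' l, c l * c' l) • g)) := by
  obtain ⟨K, hK⟩ := hz.exists_bound
  obtain ⟨δ, hδ, hzδ⟩ := hz
  obtain ⟨δ', hδ', hzδ'⟩ := hz'
  set y : ℕ → ℤ → E := fun N t => ∑ l ∈ Finset.range N, c l • e (t - l) with hy
  set y' : ℕ → ℤ → E := fun N t => ∑ l ∈ Finset.range N, c' l • e (t - l) with hy'
  have hz'0 : ∀ t, ‖z' t‖ ≤ δ' 0 := fun t => by simpa using hzδ' 0 t
  refine tendsto_of_approx (w := fun N n => (n : ℝ)⁻¹ • ∑ t ∈ Finset.Icc 1 n, B (y N t) (y' N t))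
    (W := fun N => (∑ l ∈ Finset.range N, c l * c' l) • g)
    (δ := fun N => ‖B‖ * δ N * (δ' 0) + ‖B‖ * (K + δ N) * δ' N) ?_ (fun N => ?_) ?_ (fun N => ?_)
  · have := ((hδ.const_mul ‖B‖).mul_const (δ' 0)).add
      (((hδ.const_add K).const_mul ‖B‖).mul hδ')
    simpa using this
  · have h1 : ∀ n : ℕ, (n : ℝ)⁻¹ • ∑ t ∈ Finset.Icc 1 n, B (y N t) (y' N t) =
        ∑ l ∈ Finset.range N, ∑ l' ∈ Finset.range N, (c l * c' l') •
          ((n : ℝ)⁻¹ • ∑ t ∈ Finset.Icc 1 n, B (e (t - l)) (e (t - l'))) := by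
      intro n
      simp only [hy, hy', map_sum, map_smul, sum_apply,
        smul_apply, Finset.smul_sum]
      rw [Finset.sum_comm, Finset.sum_comm]
      rw [Finset.sum_comm]
      conv_lhs => enter [2, l]; rw [Finset.sum_comm]
      rw [Finset.sum_comm]
      refine Finset.sum_congr rfl fun l _ => Finset.sum_congr rfl fun l' _ =>
        Finset.sum_congr rfl fun t _ => ?_
      simp only [smul_smul]
      congr 1
      ring
    simp only [h1]
    have h2 : (∑ l ∈ Finset.range N, c l * c' l) • g = ∑ l ∈ Finset.range N,
        ∑ l' ∈ Finset.range N, (c l * c' l') • (if l = l' then g else 0) := by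
      rw [Finset.sum_smul]
      refine Finset.sum_congr rfl fun l hl => ?_
      simp only [smul_ite, smul_zero, Finset.sum_ite_eq, hl, if_true]
    rw [h2]
    exact tendsto_finsetSum _ fun l _ => tendsto_finsetSum _ fun l' _ => (he l l').const_smul _
  · exact hcc.hasSum.tendsto_sum_nat.smul_const g
  · filter_upwards [eventually_gt_atTop 0] with n hn
    rw [dist_eq_norm, ← smul_sub, ← Finset.sum_sub_distrib, norm_smul, norm_inv,
      Real.norm_natCast, inv_mul_le_iff₀ (by positivity)]
    have h3 : ∀ t ∈ Finset.Icc 1 n, ‖B (z t) (z' t) - B (y N t) (y' N t)‖ ≤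
        ‖B‖ * δ N * (δ' 0) + ‖B‖ * (K + δ N) * δ' N := by
      intro t _
      have h4 : B (z t) (z' t) - B (y N t) (y' N t) =
          B (z t - y N t) (z' t) + B (y N t) (z' t - y' N t) := by
        simp only [map_sub, sub_apply]; abel
      rw [h4]
      refine (norm_add_le _ _).trans (add_le_add (norm_bilin_le B _ _ (hzδ N t) (hz'0 t))
        (norm_bilin_le B _ _ ?_ (hzδ' N t)))
      calc ‖y N t‖ = ‖z t - (z t - y N t)‖ := by rw [sub_sub_cancel]
        _ ≤ ‖z t‖ + ‖z t - y N t‖ := norm_sub_le _ _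
        _ ≤ K + δ N := add_le_add (hK t) (hzδ N t)
    refine (norm_sum_le_of_le _ h3).trans (le_of_eq ?_)
    simp [mul_add]

lemma norm_sum_shift_sub_le (f : ℤ → F) {K : ℝ} (hf : ∀ t, ‖f t‖ ≤ K) (m n : ℕ) :
    ‖∑ t ∈ Finset.Icc 1 n, f ((t : ℤ) - m) - ∑ t ∈ Finset.Icc 1 n, f t‖ ≤ 2 * m * K := by
  induction m with
  | zero => simp
  | succ m ih =>
    have h1 : ∀ n : ℕ, ∑ t ∈ Finset.Icc 1 n, f ((t : ℤ) - (m + 1 : ℕ)) =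
        ∑ t ∈ Finset.Icc 1 n, f ((t : ℤ) - m) + f (-m) - f (n - m) := by
      intro n
      induction n with
      | zero => simp
      | succ n ih =>
        rw [Finset.sum_Icc_succ_top (by omega), Finset.sum_Icc_succ_top (by omega), ih]
        have : (((n + 1 : ℕ) : ℤ) - ((m + 1 : ℕ) : ℤ)) = n - m := by push_cast; ring
        rw [this]
        abel
    rw [h1]
    have h2 : ∑ t ∈ Finset.Icc 1 n, f ((t : ℤ) - m) + f (-m) - f (n - m) -
        ∑ t ∈ Finset.Icc 1 n, f t = (∑ t ∈ Finset.Icc 1 n, f ((t : ℤ) - m) -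
        ∑ t ∈ Finset.Icc 1 n, f t) + f (-m) - f (n - m) := by abel
    rw [h2]
    refine (norm_sub_le _ _).trans ?_
    refine (add_le_add (norm_add_le _ _) (hf _)).trans ?_
    have := hf (-m)
    push_cast
    linarith

lemma norm_sum_Icc_sub_sub_le (f : ℤ → F) {K : ℝ} (hf : ∀ t, ‖f t‖ ≤ K) (h n : ℕ) :
    ‖∑ t ∈ Finset.Icc 1 (n - h), f t - ∑ t ∈ Finset.Icc 1 n, f t‖ ≤ h * K := by
  have hK : 0 ≤ K := (norm_nonneg _).trans (hf 0)
  have hsub : Finset.Icc 1 (n - h) ⊆ Finset.Icc 1 n :=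
    Finset.Icc_subset_Icc_right (Nat.sub_le _ _)
  rw [← Finset.sum_sdiff hsub, sub_add_cancel_right, norm_neg]
  refine (norm_sum_le_of_le (f := fun t : ℕ => f t) _ fun t _ => hf t).trans ?_
  rw [Finset.sum_const, nsmul_eq_mul, Finset.card_sdiff_of_subset hsub]
  simp only [Nat.card_Icc, add_tsub_cancel_right]
  gcongr
  omega

/-- `φ(1) ≠ 0`. -/
lemma one_sub_sum_ne_zero (β : EuclideanSpace ℝ (Fin p)) (hβ : NoRootInUnitDisk β) :
    1 - ∑ j, β j ≠ 0 := by
  have h := hβ 1 (by simp)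
  intro h0
  apply h
  have h1 : Polynomial.aeval (1 : ℂ) (arPoly β) = ((1 - ∑ j, β j : ℝ) : ℂ) := by
    simp [arPoly]
  rw [h1, h0, Complex.ofReal_zero]

/-- As `φ(1) ≠ 0`, partial sums of an autoregressive sequence are controlled by those of the
innovations. -/
lemma exists_norm_sum_le (β : EuclideanSpace ℝ (Fin p)) (hβ : NoRootInUnitDisk β) (x e : ℤ → E)
    (h : ∀ t, x t = ∑ j : Fin p, β j • x (t - ((j : ℤ) + 1)) + e t) {K D : ℝ}
    (hK : ∀ t, ‖x t‖ ≤ K) (hD : ∀ n : ℕ, ‖∑ t ∈ Finset.Icc 1 n, e t‖ ≤ D * √(n : ℝ)) :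
    ∃ C, 0 ≤ C ∧ ∀ n : ℕ, 0 < n → ‖∑ t ∈ Finset.Icc 1 n, x t‖ ≤ C * √(n : ℝ) := by
  have hφ := one_sub_sum_ne_zero β hβ
  have hK0 : 0 ≤ K := (norm_nonneg _).trans (hK 0)
  have hD0 : 0 ≤ D := by simpa using (norm_nonneg _).trans (hD 1)
  set M : ℝ := ∑ j : Fin p, |β j| * (2 * ((j : ℕ) + 1 : ℕ) * K) with hM
  have hM0 : 0 ≤ M := Finset.sum_nonneg fun j _ => by positivity
  refine ⟨|1 - ∑ j, β j|⁻¹ * (D + M), by positivity, fun n hn => ?_⟩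
  have hn1 : 1 ≤ √(n : ℝ) := by rw [Real.one_le_sqrt]; exact_mod_cast hn
  have h1 : (1 - ∑ j, β j) • ∑ t ∈ Finset.Icc 1 n, x t = ∑ t ∈ Finset.Icc 1 n, e t +
      ∑ j : Fin p, β j • (∑ t ∈ Finset.Icc 1 n, x ((t : ℤ) - ((j : ℕ) + 1 : ℕ)) -
        ∑ t ∈ Finset.Icc 1 n, x t) := by
    simp only [smul_sub, Finset.sum_sub_distrib, ← Finset.sum_smul]
    have h2 : ∑ t ∈ Finset.Icc 1 n, e t = ∑ t ∈ Finset.Icc 1 n, x t -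
        ∑ j : Fin p, β j • ∑ t ∈ Finset.Icc 1 n, x ((t : ℤ) - ((j : ℕ) + 1 : ℕ)) := by
      simp_rw [Finset.smul_sum]
      rw [Finset.sum_comm, ← Finset.sum_sub_distrib]
      refine Finset.sum_congr rfl fun t _ => ?_
      rw [eq_sub_iff_add_eq, add_comm]
      simpa using (h t).symm
    rw [h2, sub_smul, one_smul]
    abel
  have h3 : |1 - ∑ j, β j| * ‖∑ t ∈ Finset.Icc 1 n, x t‖ ≤ D * √(n : ℝ) + M := by
    rw [← Real.norm_eq_abs, ← norm_smul, h1]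
    refine (norm_add_le _ _).trans (add_le_add (hD n) ((norm_sum_le _ _).trans
      (Finset.sum_le_sum fun j _ => ?_)))
    rw [norm_smul, Real.norm_eq_abs]
    exact mul_le_mul_of_nonneg_left (norm_sum_shift_sub_le x hK _ n) (abs_nonneg _)
  rw [mul_assoc, le_inv_mul_iff₀ (abs_pos.2 hφ)]
  nlinarith

/-- The centred sample autocovariance `n⁻¹ ∑_{t ≤ n-h} B(x_t - x̄, x_{t+h} - x̄)`. -/
noncomputable def sampleCov (B : E →L[ℝ] E →L[ℝ] F) (x : ℤ → E) (n h : ℕ) : F :=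
  (n : ℝ)⁻¹ • ∑ t ∈ Finset.Icc 1 (n - h),
    B (x t - (n : ℝ)⁻¹ • ∑ s ∈ Finset.Icc 1 n, x s)
      (x ((t : ℤ) + (h : ℤ)) - (n : ℝ)⁻¹ • ∑ s ∈ Finset.Icc 1 n, x s)

/-- Centring at the sample mean and the missing terms at the end of the sample change the sum of
lagged products by a bounded amount. -/
lemma exists_norm_smul_sampleCov_sub_le (B : E →L[ℝ] E →L[ℝ] F) (x : ℤ → E) {K C : ℝ}
    (hK : ∀ t, ‖x t‖ ≤ K) (hC : ∀ n : ℕ, 0 < n → ‖∑ t ∈ Finset.Icc 1 n, x t‖ ≤ C * √(n : ℝ))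
    (h : ℕ) : ∃ M, ∀ n : ℕ, ‖(n : ℝ) • sampleCov B x n h -
      ∑ t ∈ Finset.Icc 1 n, B (x t) (x ((t : ℤ) + h))‖ ≤ M := by
  have hK0 : 0 ≤ K := (norm_nonneg _).trans (hK 0)
  have hC0 : 0 ≤ C := by simpa using (norm_nonneg _).trans (hC 1 one_pos)
  refine ⟨h * (‖B‖ * K * K) + ‖B‖ * ((C + h * K) * C) + ‖B‖ * (C * (C + 3 * h * K)) +
    ‖B‖ * (C * C), fun n => ?_⟩
  rcases Nat.eq_zero_or_pos n with rfl | hn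
  · simp; positivity
  have hn1 : 1 ≤ √(n : ℝ) := by rw [Real.one_le_sqrt]; exact_mod_cast hn
  have hnC : ∀ D : ℝ, (n : ℝ) * (D / √(n : ℝ)) = D * √(n : ℝ) := by
    intro D
    rw [mul_div_left_comm, Real.div_sqrt]
  set m : E := (n : ℝ)⁻¹ • ∑ s ∈ Finset.Icc 1 n, x s with hm
  have hmn : ‖m‖ ≤ C / √(n : ℝ) := by
    rw [hm, norm_smul, norm_inv, Real.norm_natCast, inv_mul_le_iff₀ (by positivity)]
    calc _ ≤ C * √(n : ℝ) := hC n hn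
      _ = n * (C / √(n : ℝ)) := (hnC C).symm
  set S₁ : E := ∑ t ∈ Finset.Icc 1 (n - h), x t with hS₁
  set S₂ : E := ∑ t ∈ Finset.Icc 1 (n - h), x ((t : ℤ) + h) with hS₂
  have hS₁n : ‖S₁‖ ≤ (C + h * K) * √(n : ℝ) := by
    have h1 := norm_sum_Icc_sub_sub_le x hK h n
    have h2 := norm_add_le (S₁ - ∑ t ∈ Finset.Icc 1 n, x t) (∑ t ∈ Finset.Icc 1 n, x t)
    rw [sub_add_cancel] at h2
    have h3 := hC n hn
    have h4 : (h : ℝ) * K ≤ h * K * √(n : ℝ) := le_mul_of_one_le_right (by positivity) hn1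
    linarith
  have hS₂n : ‖S₂‖ ≤ (C + 3 * h * K) * √(n : ℝ) := by
    have h1 := norm_sum_Icc_sub_sub_le (fun t => x (t + h)) (fun t => hK _) h n
    have h2 := norm_sum_shift_sub_le (fun t => x (t + h)) (fun t => hK _) h n
    simp only [sub_add_cancel] at h2
    have h3 := hC n hn
    have h5 := norm_add₃_le (a := S₂ - ∑ t ∈ Finset.Icc 1 n, x ((t : ℤ) + h))
      (b := -(∑ t ∈ Finset.Icc 1 n, x t - ∑ t ∈ Finset.Icc 1 n, x ((t : ℤ) + h)))
      (c := ∑ t ∈ Finset.Icc 1 n, x t)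
    rw [norm_neg] at h5
    have h6 : S₂ - ∑ t ∈ Finset.Icc 1 n, x ((t : ℤ) + h) +
      -(∑ t ∈ Finset.Icc 1 n, x t - ∑ t ∈ Finset.Icc 1 n, x ((t : ℤ) + h)) +
      ∑ t ∈ Finset.Icc 1 n, x t = S₂ := by abel
    rw [h6] at h5
    have h4 : (h : ℝ) * K ≤ h * K * √(n : ℝ) := le_mul_of_one_le_right (by positivity) hn1
    linarith
  have hdecomp : (n : ℝ) • sampleCov B x n h - ∑ t ∈ Finset.Icc 1 n, B (x t) (x ((t : ℤ) + h)) =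
      (∑ t ∈ Finset.Icc 1 (n - h), B (x t) (x ((t : ℤ) + h)) -
        ∑ t ∈ Finset.Icc 1 n, B (x t) (x ((t : ℤ) + h))) - B S₁ m - B m S₂ +
        ((n - h : ℕ) : ℝ) • B m m := by
    rw [sampleCov, smul_inv_smul₀ (by positivity), ← hm]
    simp only [map_sub, sub_apply, Finset.sum_sub_distrib, hS₁, hS₂, map_sum,
      sum_apply, Finset.sum_const, Nat.card_Icc, add_tsub_cancel_right,
      Nat.cast_smul_eq_nsmul]
    abel
  have hsn : 0 < √(n : ℝ) := by linarith
  rw [hdecomp]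
  refine (norm_add_le _ _).trans (add_le_add ((norm_sub_le _ _).trans (add_le_add
    ((norm_sub_le _ _).trans (add_le_add ?_ ?_)) ?_)) ?_)
  · exact norm_sum_Icc_sub_sub_le (fun t => B (x t) (x (t + h)))
      (fun t => norm_bilin_le B _ _ (hK _) (hK _)) h n
  · refine (norm_bilin_le B _ _ hS₁n hmn).trans (le_of_eq ?_)
    field_simp
  · refine (norm_bilin_le B _ _ hmn hS₂n).trans (le_of_eq ?_)
    field_simp
  · rw [norm_smul, Real.norm_natCast]
    calc ((n - h : ℕ) : ℝ) * ‖B m m‖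
        ≤ n * (‖B‖ * (C / √(n : ℝ)) * (C / √(n : ℝ))) := by
          gcongr
          · omega
          · exact norm_bilin_le B _ _ hmn hmn
      _ = ‖B‖ * (C * C) := by
          rw [mul_left_comm, hnC]; field_simp

/-- The sample autocovariance at lag `|a - b|` compared with the sum of `B(x_{t-a}, x_{t-b})`. -/
lemma exists_norm_smul_sampleCov_sub_lag_le (B : E →L[ℝ] E →L[ℝ] F) (hB : ∀ x y, B x y = B y x)
    (x : ℤ → E) {K C : ℝ} (hK : ∀ t, ‖x t‖ ≤ K)
    (hC : ∀ n : ℕ, 0 < n → ‖∑ t ∈ Finset.Icc 1 n, x t‖ ≤ C * √(n : ℝ)) (a b : ℕ) :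
    ∃ M, ∀ n : ℕ, ‖(n : ℝ) • sampleCov B x n ((a : ℤ) - (b : ℤ)).natAbs -
      ∑ t ∈ Finset.Icc 1 n, B (x ((t : ℤ) - a)) (x ((t : ℤ) - b))‖ ≤ M := by
  wlog hab : b ≤ a generalizing a b with H
  · obtain ⟨M, hM⟩ := H b a (by omega)
    refine ⟨M, fun n => ?_⟩
    have h1 : ((a : ℤ) - (b : ℤ)).natAbs = ((b : ℤ) - (a : ℤ)).natAbs := by omega
    simp_rw [h1, hB (x _) (x (_ - b))]
    exact hM n
  · obtain ⟨M, hM⟩ := exists_norm_smul_sampleCov_sub_le B x hK hC (a - b)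
    have h1 : ((a : ℤ) - (b : ℤ)).natAbs = a - b := by omega
    refine ⟨M + 2 * a * (‖B‖ * K * K), fun n => ?_⟩
    have h2 := norm_sum_shift_sub_le (fun t => B (x t) (x (t + (a - b : ℕ))))
      (fun t => norm_bilin_le B _ _ (hK _) (hK _)) a n
    have h3 : ∀ t : ℕ, (t : ℤ) - a + (a - b : ℕ) = t - b := fun t => by omega
    simp only [h3] at h2
    have h4 := norm_sub_le _ _ |>.trans (add_le_add (hM n) h2)
    rw [h1]
    refine le_trans (le_of_eq ?_) h4
    congr 1
    abel

/-- The Yule-Walker residual `γ_{j+1} - ∑ k, β_k γ_{|j-k|}` equals the average of the products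
`B(x_{t-1-j}, e_t)`, up to a term of order `1 / n`. -/
lemma exists_norm_residual_sub_le (β : EuclideanSpace ℝ (Fin p)) (B : E →L[ℝ] E →L[ℝ] F)
    (hB : ∀ x y, B x y = B y x) (x e : ℤ → E)
    (h : ∀ t, x t = ∑ j : Fin p, β j • x (t - ((j : ℤ) + 1)) + e t) {K C : ℝ}
    (hK : ∀ t, ‖x t‖ ≤ K) (hC : ∀ n : ℕ, 0 < n → ‖∑ t ∈ Finset.Icc 1 n, x t‖ ≤ C * √(n : ℝ))
    (j : Fin p) :
    ∃ M, ∀ n : ℕ, ‖(n : ℝ) • (sampleCov B x n ((j : ℕ) + 1) -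
        ∑ k : Fin p, β k • sampleCov B x n ((j : ℤ) - (k : ℤ)).natAbs) -
      ∑ t ∈ Finset.Icc 1 n, B (x ((t : ℤ) - 1 - (j : ℕ))) (e t)‖ ≤ M := by
  obtain ⟨M, hM⟩ := exists_norm_smul_sampleCov_sub_lag_le B hB x hK hC ((j : ℕ) + 1) 0
  choose M' hM' using fun k : Fin p =>
    exists_norm_smul_sampleCov_sub_lag_le B hB x hK hC ((j : ℕ) + 1) ((k : ℕ) + 1)
  refine ⟨M + ∑ k, |β k| * M' k, fun n => ?_⟩
  have h1 := hM n
  have h2 : (((((j : ℕ) + 1 : ℕ) : ℤ)) - ((0 : ℕ) : ℤ)).natAbs = (j : ℕ) + 1 := by omega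
  have h3 : ∀ k : Fin p, (((((j : ℕ) + 1 : ℕ) : ℤ)) - (((k : ℕ) + 1 : ℕ) : ℤ)).natAbs =
      ((j : ℤ) - (k : ℤ)).natAbs := fun k => by omega
  rw [h2] at h1
  simp only [h3] at hM'
  have h4 : ∀ t : ℕ, B (x ((t : ℤ) - 1 - (j : ℕ))) (e t) =
      B (x ((t : ℤ) - ((j : ℕ) + 1 : ℕ))) (x ((t : ℤ) - (0 : ℕ))) -
        ∑ k : Fin p,
          β k • B (x ((t : ℤ) - ((j : ℕ) + 1 : ℕ))) (x ((t : ℤ) - ((k : ℕ) + 1 : ℕ))) := by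
    intro t
    have h5 : e t = x t - ∑ k : Fin p, β k • x ((t : ℤ) - ((k : ℕ) + 1 : ℕ)) := by
      rw [h t]; push_cast; abel
    have h6 : (t : ℤ) - 1 - (j : ℕ) = (t : ℤ) - ((j : ℕ) + 1 : ℕ) := by push_cast; ring
    rw [h5, h6, map_sub, map_sum]
    simp
  have h7 : (n : ℝ) • (sampleCov B x n ((j : ℕ) + 1) -
        ∑ k : Fin p, β k • sampleCov B x n ((j : ℤ) - (k : ℤ)).natAbs) -
      ∑ t ∈ Finset.Icc 1 n, B (x ((t : ℤ) - 1 - (j : ℕ))) (e t) =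
      ((n : ℝ) • sampleCov B x n ((j : ℕ) + 1) -
        ∑ t ∈ Finset.Icc 1 n, B (x ((t : ℤ) - ((j : ℕ) + 1 : ℕ))) (x ((t : ℤ) - (0 : ℕ)))) -
      ∑ k : Fin p, β k • ((n : ℝ) • sampleCov B x n ((j : ℤ) - (k : ℤ)).natAbs -
        ∑ t ∈ Finset.Icc 1 n,
          B (x ((t : ℤ) - ((j : ℕ) + 1 : ℕ))) (x ((t : ℤ) - ((k : ℕ) + 1 : ℕ)))) := by
    simp only [h4, Finset.sum_sub_distrib, smul_sub, Finset.smul_sum]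
    rw [Finset.sum_comm]
    simp only [smul_smul, mul_comm (n : ℝ)]
    abel
  rw [h7]
  refine (norm_sub_le _ _).trans (add_le_add h1 ((norm_sum_le _ _).trans
    (Finset.sum_le_sum fun k _ => ?_)))
  rw [norm_smul, Real.norm_eq_abs]
  exact mul_le_mul_of_nonneg_left (hM' k n) (abs_nonneg _)

/-- Consistency of the sample autocovariances. -/
lemma tendsto_sampleCov (β : EuclideanSpace ℝ (Fin p)) (hβ : NoRootInUnitDisk β)
    (B : E →L[ℝ] E →L[ℝ] F) (hB : ∀ x y, B x y = B y x) {x e : ℤ → E}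
    (hx : IsLinearProcess (psi β) e x) {K C : ℝ} (hK : ∀ t, ‖x t‖ ≤ K)
    (hC : ∀ n : ℕ, 0 < n → ‖∑ t ∈ Finset.Icc 1 n, x t‖ ≤ C * √(n : ℝ)) (g : F)
    (he : ∀ l l' : ℕ, Tendsto
      (fun n : ℕ => (n : ℝ)⁻¹ • ∑ t ∈ Finset.Icc 1 n, B (e (t - l)) (e (t - l'))) atTop
      (𝓝 (if l = l' then g else 0))) (j k : Fin p) :
    Tendsto (fun n : ℕ => sampleCov B x n ((j : ℤ) - (k : ℤ)).natAbs) atTop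
      (𝓝 (psiMatrix β j k • g)) := by
  have h1 := (hx.shift j).tendsto_average B (hx.shift k) g
    (summable_mul_of_summable_abs (summable_abs_psiShift β hβ j) (summable_abs_psiShift β hβ k)) he
  rw [← psiMatrix_apply β hβ] at h1
  obtain ⟨M, hM⟩ := exists_norm_smul_sampleCov_sub_lag_le B hB x hK hC (j : ℕ) (k : ℕ)
  refine tendsto_of_tendsto_of_dist h1 ?_
  have h2 : Tendsto (fun n : ℕ => (n : ℝ)⁻¹ * M) atTop (𝓝 0) := by
    simpa using (tendsto_inv_atTop_nhds_zero_nat (𝕜 := ℝ)).mul_const M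
  refine squeeze_zero' (Eventually.of_forall fun _ => dist_nonneg) ?_ h2
  filter_upwards [eventually_gt_atTop 0] with n hn
  have hn0 : (n : ℝ) ≠ 0 := by positivity
  rw [dist_comm, dist_eq_norm, ← inv_smul_smul₀ hn0 (sampleCov B x n _), ← smul_sub, norm_smul,
    norm_inv, Real.norm_natCast]
  gcongr
  exact hM n

end Average

/-! ### Products of independent centred variables in a Hilbert space -/

section Noise

variable {Ω : Type*} [MeasurableSpace Ω] {P : Measure Ω} [IsProbabilityMeasure P]
  {H : Type*} [NormedAddCommGroup H] [InnerProductSpace ℝ H] [CompleteSpace H]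
  [SecondCountableTopology H] [MeasurableSpace H] [BorelSpace H]

/-- `e` is a family of independent, identically distributed, centred and square integrable random
variables in a Hilbert space. -/
structure IsWhiteNoise (P : Measure Ω) (e : ℤ → Ω → H) : Prop where
  measurable : ∀ t, Measurable (e t)
  indep : iIndepFun e P
  identDistrib : ∀ t, IdentDistrib (e t) (e 0) P P
  memLp_zero : MemLp (e 0) 2 P
  integral_zero : ∫ ω, e 0 ω ∂P = 0

lemma _root_.ProbabilityTheory.IndepFun.integral_inner_eq_zero {W X : Ω → H} (h : IndepFun W X P)
    (hW : Measurable W) (hX : Measurable X) (hXi : Integrable X P) (hX0 : ∫ ω, X ω ∂P = 0) :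
    ∫ ω, inner ℝ (W ω) (X ω) ∂P = 0 := by
  have hmap := h.map_prod_eq_prod_map_map hW.aemeasurable hX.aemeasurable
  have : IsProbabilityMeasure (P.map W) := Measure.isProbabilityMeasure_map hW.aemeasurable
  have : IsProbabilityMeasure (P.map X) := Measure.isProbabilityMeasure_map hX.aemeasurable
  have hmeas : AEStronglyMeasurable (fun z : H × H => inner ℝ z.1 z.2)
      (P.map fun ω => (W ω, X ω)) := by fun_prop
  have h1 : ∫ ω, inner ℝ (W ω) (X ω) ∂P =
      ∫ z : H × H, inner ℝ z.1 z.2 ∂((P.map W).prod (P.map X)) := by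
    rw [← hmap, integral_map (by fun_prop) hmeas]
  rw [h1]
  by_cases hint : Integrable (fun z : H × H => inner ℝ z.1 z.2) ((P.map W).prod (P.map X))
  · rw [integral_prod _ hint]
    have hXi' : Integrable (fun x : H => x) (P.map X) := by
      rwa [integrable_map_measure (by fun_prop) (by fun_prop)]
    have h2 : ∀ w : H, ∫ x, inner ℝ w x ∂(P.map X) = 0 := by
      intro w
      rw [integral_inner hXi', integral_map (by fun_prop) (by fun_prop), hX0, inner_zero_right]
    simp [h2]
  · exact integral_undef hint

namespace IsWhiteNoise

variable {e : ℤ → Ω → H}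

lemma memLp (he : IsWhiteNoise P e) (t : ℤ) : MemLp (e t) 2 P :=
  (he.identDistrib t).memLp_iff.2 he.memLp_zero

lemma integral_eq_zero (he : IsWhiteNoise P e) (t : ℤ) : ∫ ω, e t ω ∂P = 0 := by
  rw [(he.identDistrib t).integral_eq, he.integral_zero]

/-- A mixed moment in which one innovation occurs only once vanishes. -/
lemma integral_inner_mul_inner_eq_zero (he : IsWhiteNoise P e) {i j k l : ℤ} (hj : i ≠ j)
    (hk : i ≠ k) (hl : i ≠ l) :
    ∫ ω, inner ℝ (e j ω) (e i ω) * inner ℝ (e k ω) (e l ω) ∂P = 0 := by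
  have h0 := he.indep.indepFun_finset {j, k, l} {i} (by simp [hj, hk, hl])
    he.measurable
  have h1 : IndepFun (fun ω => inner ℝ (e k ω) (e l ω) • e j ω) (e i) P :=
    h0.comp (φ := fun y : (({j, k, l} : Finset ℤ) → H) =>
        inner ℝ (y ⟨k, by simp⟩) (y ⟨l, by simp⟩) • y ⟨j, by simp⟩)
      (ψ := fun y : (({i} : Finset ℤ) → H) => y ⟨i, by simp⟩) (by fun_prop) (by fun_prop)
  have hm := he.measurable
  have h2 := h1.integral_inner_eq_zero (by fun_prop) (hm i)
    ((he.memLp i).integrable one_le_two) (he.integral_eq_zero i)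
  rw [← h2]
  refine integral_congr_ae (Eventually.of_forall fun ω => ?_)
  simp only [real_inner_smul_left]
  ring

lemma memLp_inner (he : IsWhiteNoise P e) {s t : ℤ} (hst : s ≠ t) :
    MemLp (fun ω => inner ℝ (e s ω) (e t ω)) 2 P := by
  have hm := he.measurable
  rw [memLp_two_iff_integrable_sq (by fun_prop)]
  have h1 : Integrable (fun ω => ‖e s ω‖ ^ 2 * ‖e t ω‖ ^ 2) P :=
    ((he.indep.indepFun hst).comp (φ := fun x => ‖x‖ ^ 2) (ψ := fun x => ‖x‖ ^ 2)
      (by fun_prop) (by fun_prop)).integrable_mul (he.memLp s).integrable_norm_pow'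
      (he.memLp t).integrable_norm_pow'
  refine h1.mono' (by fun_prop) (Eventually.of_forall fun ω => ?_)
  rw [Real.norm_eq_abs, abs_pow, ← mul_pow]
  gcongr
  exact abs_real_inner_le_norm _ _

/-- The second moment `E⟨e_s, e_t⟩²`, `s ≠ t`: the squared Hilbert-Schmidt norm of the covariance
operator of `e_0`. -/
noncomputable def _root_.WAR.noiseVar (P : Measure Ω) (e : ℤ → Ω → H) : ℝ :=
  ∫ ω, inner ℝ (e 0 ω) (e 1 ω) ^ 2 ∂P

lemma integral_inner_sq (he : IsWhiteNoise P e) {s t : ℤ} (hst : s ≠ t) :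
    ∫ ω, inner ℝ (e s ω) (e t ω) ^ 2 ∂P = noiseVar P e := by
  have h1 : IdentDistrib (fun ω => (e s ω, e t ω)) (fun ω => (e 0 ω, e 1 ω)) P P :=
    IdentDistrib.prodMk (he.identDistrib s) ((he.identDistrib t).trans (he.identDistrib 1).symm)
      (he.indep.indepFun hst) (he.indep.indepFun (by norm_num))
  exact (h1.comp (u := fun z : H × H => inner ℝ z.1 z.2 ^ 2) (by fun_prop)).integral_eq

/-- The lagged products `⟨e_{u-1-m}, e_u⟩`. -/
noncomputable def _root_.WAR.lagProd (e : ℤ → Ω → H) (m : ℕ) (u : ℤ) (ω : Ω) : ℝ :=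
  inner ℝ (e (u - 1 - m) ω) (e u ω)

lemma memLp_lagProd (he : IsWhiteNoise P e) (m : ℕ) (u : ℤ) : MemLp (lagProd e m u) 2 P :=
  he.memLp_inner (by omega)

/-- Lagged products form an orthogonal family in `L²`. -/
lemma integral_lagProd_mul (he : IsWhiteNoise P e) (m m' : ℕ) (u u' : ℤ) :
    ∫ ω, lagProd e m u ω * lagProd e m' u' ω ∂P =
      if m = m' ∧ u = u' then noiseVar P e else 0 := by
  split_ifs with h
  · obtain ⟨rfl, rfl⟩ := h
    simp_rw [← sq]
    exact he.integral_inner_sq (by omega)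
  · rcases lt_trichotomy u u' with hu | rfl | hu
    · simp_rw [mul_comm (lagProd e m u _)]
      exact he.integral_inner_mul_inner_eq_zero (by omega) (by omega) (by omega)
    · have hm : m ≠ m' := fun hm => h ⟨hm, rfl⟩
      simp_rw [lagProd, real_inner_comm (e u _) (e (u - 1 - m) _)]
      exact he.integral_inner_mul_inner_eq_zero (by omega) (by omega) (by omega)
    · exact he.integral_inner_mul_inner_eq_zero (by omega) (by omega) (by omega)

end IsWhiteNoise

/-! ### Orthogonal families in `L²` -/

lemma integral_sum_mul_sum {ι : Type*} [DecidableEq ι] {f : ι → Ω → ℝ} {v : ℝ}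
    (hf : ∀ i, MemLp (f i) 2 P)
    (hff : ∀ i j, ∫ ω, f i ω * f j ω ∂P = if i = j then v else 0) (S T : Finset ι) (a b : ι → ℝ) :
    ∫ ω, (∑ i ∈ S, a i * f i ω) * (∑ j ∈ T, b j * f j ω) ∂P =
      v * ∑ i ∈ S ∩ T, a i * b i := by
  have hint : ∀ i j, Integrable (fun ω => (a i * f i ω) * (b j * f j ω)) P := fun i j =>
    ((hf i).const_mul (a i)).integrable_mul ((hf j).const_mul (b j))
  simp_rw [Finset.sum_mul_sum]
  rw [integral_finsetSum _ fun i _ => integrable_finsetSum _ fun j _ => hint i j]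
  simp_rw [integral_finsetSum T fun j _ => hint _ j]
  have h1 : ∀ i j, ∫ ω, (a i * f i ω) * (b j * f j ω) ∂P =
      if i = j then v * (a i * b i) else 0 := by
    intro i j
    have : ∀ ω, (a i * f i ω) * (b j * f j ω) = (a i * b j) * (f i ω * f j ω) := fun ω => by ring
    simp_rw [this, integral_const_mul, hff]
    split_ifs with h
    · subst h; ring
    · ring
  simp_rw [h1, Finset.sum_ite_eq, ← Finset.sum_filter, Finset.filter_mem_eq_inter, Finset.mul_sum]

lemma integral_abs_le_sqrt {X : Ω → ℝ} (hX : MemLp X 2 P) :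
    ∫ ω, |X ω| ∂P ≤ √(∫ ω, X ω ^ 2 ∂P) := by
  refine Real.le_sqrt_of_sq_le ?_
  have h1 := variance_nonneg |X| P
  rw [variance_eq_sub hX.abs] at h1
  simp only [Pi.pow_apply, Pi.abs_apply, sq_abs] at h1
  linarith

lemma norm_integral_cexp_sub_le {X Y : Ω → ℝ} (hX : Integrable X P) (hY : Integrable Y P) :
    ‖∫ ω, Complex.exp (X ω * Complex.I) ∂P - ∫ ω, Complex.exp (Y ω * Complex.I) ∂P‖ ≤
      ∫ ω, |X ω - Y ω| ∂P := by
  have hi : ∀ {X : Ω → ℝ}, Integrable X P →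
      Integrable (fun ω => Complex.exp (X ω * Complex.I)) P := by
    intro X hX
    refine (integrable_const (1 : ℝ)).mono' ?_ (Eventually.of_forall fun ω => ?_)
    · have := hX.aestronglyMeasurable.aemeasurable
      fun_prop
    · rw [Complex.norm_exp_ofReal_mul_I]
  rw [← integral_sub (hi hX) (hi hY)]
  refine (norm_integral_le_integral_norm _).trans (integral_mono (((hi hX).sub (hi hY)).norm)
    (hX.sub hY).abs fun ω => ?_)
  have h1 : Complex.exp (X ω * Complex.I) - Complex.exp (Y ω * Complex.I) =
      Complex.exp (Y ω * Complex.I) * (Complex.exp (Complex.I * ((X ω - Y ω : ℝ) : ℂ)) - 1) := by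
    rw [mul_sub, ← Complex.exp_add, mul_one]
    congr 2
    push_cast
    ring
  simp only [h1, norm_mul, Complex.norm_exp_ofReal_mul_I, one_mul]
  exact Real.norm_exp_I_mul_ofReal_sub_one_le

/-! ### Central limit theorem for finite combinations of lagged products -/

/-- Blocks of an independent family are independent. -/
lemma iIndepFun_curry {ι κ X : Type*} [MeasurableSpace X] {f : ι × κ → Ω → X}
    (hf : ∀ i, Measurable (f i)) (h : iIndepFun f P) :
    iIndepFun (fun i ω (j : κ) => f (i, j) ω) P := by
  have := h.isProbabilityMeasure
  have : ∀ i, IsProbabilityMeasure (P.map (f i)) := fun i =>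
    Measure.isProbabilityMeasure_map (hf i).aemeasurable
  rw [iIndepFun_iff_map_fun_eq_infinitePi_map (by fun_prop)]
  have h1 : (fun ω i (j : κ) => f (i, j) ω) = MeasurableEquiv.curry ι κ X ∘ fun ω p => f p ω := by
    ext; simp
  rw [h1, ← Measure.map_map (by fun_prop) (by fun_prop),
    (iIndepFun_iff_map_fun_eq_infinitePi_map hf).1 h,
    Measure.infinitePi_map_curry (fun i j => P.map (f (i, j)))]
  congr 1
  ext1 i
  rw [(iIndepFun_iff_map_fun_eq_infinitePi_map (fun j => hf (i, j))).1
    (h.precomp (g := fun j => (i, j)) (fun _ _ h => (Prod.mk.inj h).2))]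

/-- The combination `∑_{l < L} c_l ⟨e_{t-1-l}, e_t⟩`. -/
noncomputable def lagSum (e : ℤ → Ω → H) (c : ℕ → ℝ) (L : ℕ) (t : ℤ) (ω : Ω) : ℝ :=
  ∑ l ∈ Finset.range L, c l * lagProd e l t ω

variable {e : ℤ → Ω → H}

lemma IsWhiteNoise.memLp_lagSum (he : IsWhiteNoise P e) (c : ℕ → ℝ) (L : ℕ) (t : ℤ) :
    MemLp (lagSum e c L t) 2 P :=
  memLp_finsetSum _ fun l _ => (he.memLp_lagProd l t).const_mul (c l)

lemma IsWhiteNoise.integral_lagSum_mul (he : IsWhiteNoise P e) (c : ℕ → ℝ) (L : ℕ) (s t : ℤ) :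
    ∫ ω, lagSum e c L s ω * lagSum e c L t ω ∂P =
      if s = t then noiseVar P e * ∑ l ∈ Finset.range L, c l ^ 2 else 0 := by
  have h := integral_sum_mul_sum (P := P) (f := fun q : ℕ × ℤ => lagProd e q.1 q.2)
    (v := noiseVar P e) (fun q => he.memLp_lagProd q.1 q.2)
    (fun q q' => by rw [he.integral_lagProd_mul]; simp [Prod.ext_iff])
    (Finset.range L ×ˢ {s}) (Finset.range L ×ˢ {t}) (fun q => c q.1) (fun q => c q.1)
  simp only [Finset.sum_product, Finset.sum_singleton] at h
  simp only [lagSum]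
  rw [h]
  split_ifs with hst
  · subst hst
    simp [sq]
  · rw [Finset.sum_eq_zero, mul_zero]
    intro q hq
    simp only [Finset.mem_inter, Finset.mem_product, Finset.mem_singleton] at hq
    exact absurd (hq.1.2.symm.trans hq.2.2) hst

/-- The `b`-th block: the `k` terms with times in `(b q + L, b q + q]`, where `q = L + k`. It
involves the innovations with times in `(b q, b q + q]` only. -/
noncomputable def blockSum (e : ℤ → Ω → H) (c : ℕ → ℝ) (L k b : ℕ) (ω : Ω) : ℝ :=
  ∑ i ∈ Finset.range k, lagSum e c L ((b * (L + k) + L + 1 + i : ℕ) : ℤ) ω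

/-- The function through which a block depends on its innovations. -/
noncomputable def blockFun (c : ℕ → ℝ) (L k : ℕ) (y : Fin (L + k) → H) : ℝ :=
  ∑ i : Fin k, ∑ l : Fin L, c l * inner ℝ (y ⟨L + i - 1 - l, by omega⟩) (y ⟨L + i, by omega⟩)

lemma blockSum_eq_blockFun (c : ℕ → ℝ) (L k b : ℕ) (ω : Ω) :
    blockSum e c L k b ω =
      blockFun c L k fun r : Fin (L + k) => e ((b * (L + k) + 1 + r : ℕ) : ℤ) ω := by
  simp only [blockSum, blockFun, lagSum, lagProd, Finset.sum_range]
  refine Finset.sum_congr rfl fun i _ => Finset.sum_congr rfl fun l _ => ?_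
  have h1 : ((b * (L + k) + L + 1 + i : ℕ) : ℤ) - 1 - (l : ℕ) =
      ((b * (L + k) + 1 + (L + i - 1 - l) : ℕ) : ℤ) := by
    have := l.2
    generalize b * (L + k) = B
    omega
  have h2 : ((b * (L + k) + L + 1 + i : ℕ) : ℤ) = ((b * (L + k) + 1 + (L + i) : ℕ) : ℤ) := by
    push_cast; ring
  rw [h1, h2]

lemma measurable_blockFun (c : ℕ → ℝ) (L k : ℕ) : Measurable (blockFun (H := H) c L k) := by
  unfold blockFun
  fun_prop

lemma IsWhiteNoise.iIndepFun_blockSum (he : IsWhiteNoise P e) (c : ℕ → ℝ) (L k : ℕ) :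
    iIndepFun (fun b => blockSum e c L k b) P := by
  have hinj : Function.Injective fun q : ℕ × Fin (L + k) =>
      ((q.1 * (L + k) + 1 + q.2 : ℕ) : ℤ) := by
    rintro ⟨b, r⟩ ⟨b', r'⟩ h
    have h1 : r.val + (L + k) * b = r'.val + (L + k) * b' := by
      have h0 : b * (L + k) + 1 + r.val = b' * (L + k) + 1 + r'.val := Int.ofNat_inj.1 h
      rw [mul_comm b, mul_comm b'] at h0
      omega
    have h2 := congrArg (· / (L + k)) h1
    have h3 := congrArg (· % (L + k)) h1
    have hpos : 0 < L + k := r.pos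
    simp only [Nat.add_mul_div_left _ _ hpos, Nat.div_eq_of_lt r.2, Nat.div_eq_of_lt r'.2,
      zero_add, Nat.add_mul_mod_self_left, Nat.mod_eq_of_lt r.2, Nat.mod_eq_of_lt r'.2] at h2 h3
    exact Prod.ext h2 (Fin.ext h3)
  have h1 := iIndepFun_curry (fun _ => he.measurable _) (he.indep.precomp hinj)
  have h2 := h1.comp (fun _ => blockFun c L k) (fun _ => measurable_blockFun c L k)
  convert! h2 using 2 with b
  funext ω
  exact blockSum_eq_blockFun c L k b ω

lemma IsWhiteNoise.identDistrib_blockSum (he : IsWhiteNoise P e) (c : ℕ → ℝ) (L k b : ℕ) :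
    IdentDistrib (blockSum e c L k b) (blockSum e c L k 0) P P := by
  have hinj : ∀ b : ℕ, Function.Injective fun r : Fin (L + k) =>
      ((b * (L + k) + 1 + r : ℕ) : ℤ) := by
    intro b r r' h
    ext
    have h0 : b * (L + k) + 1 + r.val = b * (L + k) + 1 + r'.val := Int.ofNat_inj.1 h
    omega
  have h1 := IdentDistrib.pi (X := fun (r : Fin (L + k)) => e ((b * (L + k) + 1 + r : ℕ) : ℤ))
    (Y := fun (r : Fin (L + k)) => e ((0 * (L + k) + 1 + r : ℕ) : ℤ)) (μ := P) (ν := P)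
    (fun r => (he.identDistrib _).trans (he.identDistrib _).symm)
    (he.indep.precomp (hinj b)) (he.indep.precomp (hinj 0))
  have h2 := h1.comp (measurable_blockFun c L k)
  convert! h2 using 1 <;> funext ω <;> exact blockSum_eq_blockFun c L k _ ω

end Noise

section BlockCLT

variable {Ω : Type*} [MeasurableSpace Ω] {P : Measure Ω} [IsProbabilityMeasure P]
  {H : Type*} [NormedAddCommGroup H] [InnerProductSpace ℝ H] [CompleteSpace H]
  [SecondCountableTopology H] [MeasurableSpace H] [BorelSpace H] {e : ℤ → Ω → H}

lemma tendsto_natDiv_div (q : ℕ) (hq : 0 < q) :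
    Tendsto (fun n : ℕ => ((n / q : ℕ) : ℝ) / n) atTop (𝓝 (1 / q)) := by
  have h1 : Tendsto (fun n : ℕ => ((n % q : ℕ) : ℝ) / n) atTop (𝓝 0) := by
    refine squeeze_zero (fun n => by positivity) (fun n => ?_)
      (tendsto_const_div_atTop_nhds_zero_nat (q : ℝ))
    gcongr
    exact (Nat.mod_lt n hq).le
  have h2 := (h1.const_sub 1).div_const (q : ℝ)
  rw [sub_zero] at h2
  refine h2.congr' ?_
  filter_upwards [eventually_gt_atTop 0] with n hn
  have h3 : (n : ℝ) = q * (n / q : ℕ) + (n % q : ℕ) := by exact_mod_cast (Nat.div_add_mod n q).symm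
  have hn0 : (n : ℝ) ≠ 0 := by positivity
  have hq0 : (q : ℝ) ≠ 0 := by positivity
  rw [div_eq_div_iff hq0 hn0, sub_mul, div_mul_cancel₀ _ hn0, one_mul]
  linarith

lemma IsWhiteNoise.integral_lagSum (he : IsWhiteNoise P e) (c : ℕ → ℝ) (L : ℕ) (t : ℤ) :
    ∫ ω, lagSum e c L t ω ∂P = 0 := by
  simp only [lagSum]
  rw [integral_finsetSum _ fun l _ => ((he.memLp_lagProd l t).integrable one_le_two).const_mul _]
  refine Finset.sum_eq_zero fun l _ => ?_
  rw [integral_const_mul]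
  have h := (he.indep.indepFun (i := t - 1 - l) (j := t) (by omega)).integral_inner_eq_zero
    (he.measurable _) (he.measurable _) ((he.memLp t).integrable one_le_two) (he.integral_eq_zero t)
  simp only [lagProd, h, mul_zero]

/-- Variance of the difference of two multiples of sums of lagged products, over nested index
sets. -/
lemma IsWhiteNoise.integral_comb_sq (he : IsWhiteNoise P e) (c : ℕ → ℝ) (L : ℕ) (S T : Finset ℕ)
    (hST : S ⊆ T) (a b : ℝ) :
    ∫ ω, (a * ∑ t ∈ T, lagSum e c L t ω - b * ∑ t ∈ S, lagSum e c L t ω) ^ 2 ∂P =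
      (noiseVar P e * ∑ l ∈ Finset.range L, c l ^ 2) *
        (a ^ 2 * T.card - 2 * (a * b) * S.card + b ^ 2 * S.card) := by
  have h := integral_sum_mul_sum (P := P) (f := fun t : ℕ => lagSum e c L t)
    (v := noiseVar P e * ∑ l ∈ Finset.range L, c l ^ 2) (fun t => he.memLp_lagSum c L t)
    (fun s t => by rw [he.integral_lagSum_mul]; simp)
    T T (fun t => a - if t ∈ S then b else 0) (fun t => a - if t ∈ S then b else 0)
  have h1 : ∀ ω, ∑ t ∈ T, (a - if t ∈ S then b else 0) * lagSum e c L t ω =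
      a * ∑ t ∈ T, lagSum e c L t ω - b * ∑ t ∈ S, lagSum e c L t ω := by
    intro ω
    simp only [sub_mul, Finset.sum_sub_distrib, ← Finset.mul_sum, ite_mul, zero_mul]
    rw [← Finset.sum_filter, Finset.filter_mem_eq_inter, Finset.inter_eq_right.2 hST,
      ← Finset.mul_sum]
  simp only [h1] at h
  simp only [sq] at h ⊢
  rw [h]
  congr 1
  have h2 : ∀ t, (a - if t ∈ S then b else 0) * (a - if t ∈ S then b else 0) =
      a * a + if t ∈ S then b * b - 2 * (a * b) else 0 := by
    intro t; split_ifs <;> ring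
  simp only [h2, Finset.inter_self, Finset.sum_add_distrib, Finset.sum_const, nsmul_eq_mul]
  rw [← Finset.sum_filter, Finset.filter_mem_eq_inter, Finset.inter_eq_right.2 hST]
  rw [Finset.sum_const, nsmul_eq_mul]
  ring

/-- The times covered by the first `m` blocks. -/
def blockTimes (L k m : ℕ) : Finset ℕ :=
  (Finset.range m ×ˢ Finset.range k).image fun q => q.1 * (L + k) + L + 1 + q.2

lemma injOn_blockTimes (L k m : ℕ) : Set.InjOn (fun q : ℕ × ℕ => q.1 * (L + k) + L + 1 + q.2)
    (Finset.range m ×ˢ Finset.range k : Finset (ℕ × ℕ)) := by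
  rintro ⟨b, r⟩ h ⟨b', r'⟩ h' heq
  simp only [Finset.coe_product, Set.mem_prod, Finset.mem_coe, Finset.mem_range] at h h'
  have h1 : r + (L + k) * b = r' + (L + k) * b' := by
    simp only [mul_comm _ (L + k)] at heq
    omega
  have h2 := congrArg (· / (L + k)) h1
  have h3 := congrArg (· % (L + k)) h1
  have hr : r < L + k := by omega
  have hr' : r' < L + k := by omega
  have hpos : 0 < L + k := by omega
  simp only [Nat.add_mul_div_left _ _ hpos, Nat.div_eq_of_lt hr, Nat.div_eq_of_lt hr',
    zero_add, Nat.add_mul_mod_self_left, Nat.mod_eq_of_lt hr, Nat.mod_eq_of_lt hr'] at h2 h3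
  exact Prod.ext h2 h3

lemma card_blockTimes (L k m : ℕ) : (blockTimes L k m).card = m * k := by
  rw [blockTimes, Finset.card_image_of_injOn (injOn_blockTimes L k m)]
  simp

lemma sum_blockSum (c : ℕ → ℝ) (L k m : ℕ) (ω : Ω) :
    ∑ b ∈ Finset.range m, blockSum e c L k b ω =
      ∑ t ∈ blockTimes L k m, lagSum e c L t ω := by
  rw [blockTimes, Finset.sum_image (injOn_blockTimes L k m), Finset.sum_product]
  rfl

lemma blockTimes_subset (L k n : ℕ) : blockTimes L k (n / (L + k)) ⊆ Finset.Icc 1 n := by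
  intro t ht
  simp only [blockTimes, Finset.mem_image, Finset.mem_product, Finset.mem_range] at ht
  obtain ⟨⟨b, i⟩, ⟨hb, hi⟩, rfl⟩ := ht
  simp only at hb hi ⊢
  have h1 : (b + 1) * (L + k) ≤ n :=
    (Nat.mul_le_mul_right _ hb).trans (Nat.div_mul_le_self n (L + k))
  rw [Finset.mem_Icc]
  rw [add_mul, one_mul] at h1
  omega

lemma IsWhiteNoise.memLp_blockSum (he : IsWhiteNoise P e) (c : ℕ → ℝ) (L k b : ℕ) :
    MemLp (blockSum e c L k b) 2 P :=
  memLp_finsetSum _ fun _ _ => he.memLp_lagSum c L _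

lemma IsWhiteNoise.integral_blockSum (he : IsWhiteNoise P e) (c : ℕ → ℝ) (L k b : ℕ) :
    ∫ ω, blockSum e c L k b ω ∂P = 0 := by
  simp only [blockSum]
  rw [integral_finsetSum _ fun l _ => (he.memLp_lagSum c L _).integrable one_le_two]
  exact Finset.sum_eq_zero fun i _ => he.integral_lagSum c L _

lemma IsWhiteNoise.variance_blockSum (he : IsWhiteNoise P e) (c : ℕ → ℝ) (L k : ℕ) :
    Var[blockSum e c L k 0; P] = k * (noiseVar P e * ∑ l ∈ Finset.range L, c l ^ 2) := by
  rw [variance_of_integral_eq_zero (he.memLp_blockSum c L k 0).aemeasurable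
    (he.integral_blockSum c L k 0)]
  have h := he.integral_comb_sq c L (blockTimes L k 1) (blockTimes L k 1) subset_rfl 1 0
  simp only [← sum_blockSum, card_blockTimes, Finset.sum_range_one] at h
  simp only [zero_mul, sub_zero, one_mul] at h
  rw [h]
  ring

/-- The classical central limit theorem for the sums over whole blocks. -/
lemma IsWhiteNoise.tendsto_integral_cexp_blockSum (he : IsWhiteNoise P e) (c : ℕ → ℝ) (L k : ℕ)
    (s : ℝ) :
    Tendsto (fun m : ℕ => ∫ ω, Complex.exp ((s * ((√(m : ℝ))⁻¹ *
        ∑ b ∈ Finset.range m, blockSum e c L k b ω) : ℝ) * Complex.I) ∂P) atTop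
      (𝓝 (Complex.exp ((-(s ^ 2 * (k * (noiseVar P e * ∑ l ∈ Finset.range L, c l ^ 2)) / 2) :
        ℝ)))) := by
  have h := tendstoInDistribution_inv_sqrt_mul_sum_sub (P := P)
    (P' := gaussianReal 0 Var[blockSum e c L k 0; P].toNNReal) (Y := id)
    (X := fun b => blockSum e c L k b) ⟨by fun_prop, Measure.map_id⟩ (he.memLp_blockSum c L k 0)
    (he.iIndepFun_blockSum c L k) (he.identDistrib_blockSum c L k)
  have h1 := ProbabilityMeasure.tendsto_iff_tendsto_charFun.1 h.tendsto s
  simp only [ProbabilityMeasure.coe_mk, Measure.map_id, charFun_gaussianReal] at h1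
  convert! h1 using 1
  · funext m
    rw [charFun_apply_real, integral_map (h.forall_aemeasurable m) (by fun_prop)]
    simp only [he.integral_blockSum, mul_zero, sub_zero]
    push_cast
    simp only [mul_assoc]
  · rw [he.variance_blockSum]
    have hv : 0 ≤ noiseVar P e := integral_nonneg fun ω => sq_nonneg _
    rw [Real.coe_toNNReal _ (mul_nonneg (Nat.cast_nonneg _) (mul_nonneg hv
      (Finset.sum_nonneg fun _ _ => sq_nonneg _)))]
    congr 2
    push_cast
    ring

/-- **Central limit theorem** for a finite combination of lagged products, by long blocks separated
by gaps of length `L`: sums over distinct blocks are independent, and the gaps carry a proportion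
of the variance that vanishes as the block length grows. -/
lemma IsWhiteNoise.tendsto_integral_cexp_lagSum (he : IsWhiteNoise P e) (c : ℕ → ℝ) (L : ℕ) :
    Tendsto (fun n : ℕ => ∫ ω, Complex.exp (((√(n : ℝ))⁻¹ *
        ∑ t ∈ Finset.Icc 1 n, lagSum e c L t ω : ℝ) * Complex.I) ∂P) atTop
      (𝓝 (Complex.exp ((-(noiseVar P e * ∑ l ∈ Finset.range L, c l ^ 2) / 2 : ℝ)))) := by
  set v : ℝ := noiseVar P e * ∑ l ∈ Finset.range L, c l ^ 2 with hv
  have hv0 : 0 ≤ v := mul_nonneg (integral_nonneg fun ω => sq_nonneg _)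
    (Finset.sum_nonneg fun _ _ => sq_nonneg _)
  -- `k + 1` is the length of a block, `q k` its distance to the next one
  set q : ℕ → ℕ := fun k => L + (k + 1) with hq
  have hq0 : ∀ k, (0 : ℝ) < q k := fun k => by simp only [hq]; positivity
  have hqinv : Tendsto (fun k => 1 / (q k : ℝ)) atTop (𝓝 0) := by
    have h1 : Tendsto q atTop atTop := by
      refine tendsto_atTop_mono (fun k => ?_) tendsto_id
      simp only [hq, id]; omega
    exact tendsto_one_div_atTop_nhds_zero_nat.comp h1
  have hratio : Tendsto (fun k => ((k + 1 : ℕ) : ℝ) / q k) atTop (𝓝 1) := by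
    have h1 := (hqinv.const_mul (L : ℝ)).const_sub 1
    rw [mul_zero, sub_zero] at h1
    refine h1.congr fun k => ?_
    rw [eq_div_iff (hq0 k).ne', sub_mul, mul_assoc, one_div_mul_cancel (hq0 k).ne']
    simp only [hq]; push_cast; ring
  refine tendsto_of_approx
    (w := fun k n => ∫ ω, Complex.exp (((√(q k : ℝ))⁻¹ * ((√((n / q k : ℕ) : ℝ))⁻¹ *
        ∑ b ∈ Finset.range (n / q k), blockSum e c L (k + 1) b ω) : ℝ) * Complex.I) ∂P)
    (W := fun k => Complex.exp ((-(((√(q k : ℝ))⁻¹) ^ 2 * (((k + 1 : ℕ) : ℝ) * v) / 2) : ℝ)))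
    (δ := fun k => √(v * (1 - ((k + 1 : ℕ) : ℝ) / q k) + 1 / q k)) ?_ (fun k => ?_) ?_ (fun k => ?_)
  · have h1 := ((hratio.const_sub 1).const_mul v).add hqinv
    rw [sub_self, mul_zero, add_zero] at h1
    have h2 := (Real.continuous_sqrt.tendsto 0).comp h1
    rwa [Real.sqrt_zero] at h2
  · exact (he.tendsto_integral_cexp_blockSum c L (k + 1) (√(q k : ℝ))⁻¹).comp
      (Nat.tendsto_div_const_atTop (Nat.pos_iff_ne_zero.1 (by simp [hq])))
  · refine (Complex.continuous_exp.tendsto _).comp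
      ((Complex.continuous_ofReal.tendsto _).comp ?_)
    have h1 := ((hratio.mul_const v).div_const 2).neg
    rw [one_mul] at h1
    rw [neg_div]
    refine h1.congr fun k => ?_
    rw [inv_pow, Real.sq_sqrt (hq0 k).le]
    ring
  · -- the squared `L²`-distance between the two sums converges to `v L / q k`
    have hlim : Tendsto (fun n : ℕ => v * (1 - 2 * ((((k + 1 : ℕ) : ℝ) / √(q k : ℝ)) *
        √(((n / q k : ℕ) : ℝ) / n)) + ((k + 1 : ℕ) : ℝ) / q k)) atTop
        (𝓝 (v * (1 - ((k + 1 : ℕ) : ℝ) / q k))) := by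
      have h1 := (Real.continuous_sqrt.tendsto _).comp
        (tendsto_natDiv_div (q k) (by simp [hq]))
      have h2 := ((((h1.const_mul (((k + 1 : ℕ) : ℝ) / √(q k : ℝ))).const_mul 2).const_sub
        1).add_const (((k + 1 : ℕ) : ℝ) / q k)).const_mul v
      convert! h2 using 2
      rw [Real.sqrt_div zero_le_one, Real.sqrt_one, div_mul_div_comm, mul_one,
        Real.mul_self_sqrt (hq0 k).le]
      ring
    have hlt : v * (1 - ((k + 1 : ℕ) : ℝ) / q k) <
        v * (1 - ((k + 1 : ℕ) : ℝ) / q k) + 1 / q k := by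
      have := hq0 k
      linarith [one_div_pos.2 this]
    filter_upwards [hlim.eventually (gt_mem_nhds hlt), eventually_ge_atTop (q k)] with n hn hnq
    have hqpos : 0 < q k := by simp [hq]
    have hm : 0 < n / q k := Nat.div_pos hnq hqpos
    have hn0 : (0 : ℝ) < n := by exact_mod_cast hqpos.trans_le hnq
    have hm0 : (0 : ℝ) < (n / q k : ℕ) := by exact_mod_cast hm
    have hX : MemLp (fun ω => (√(n : ℝ))⁻¹ * ∑ t ∈ Finset.Icc 1 n, lagSum e c L t ω) 2 P :=
      (memLp_finsetSum _ fun (t : ℕ) _ => he.memLp_lagSum c L t).const_mul _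
    have hY : MemLp (fun ω => (√(q k : ℝ))⁻¹ * ((√((n / q k : ℕ) : ℝ))⁻¹ *
        ∑ b ∈ Finset.range (n / q k), blockSum e c L (k + 1) b ω)) 2 P :=
      ((memLp_finsetSum _ fun b _ => he.memLp_blockSum c L (k + 1) b).const_mul _).const_mul _
    rw [dist_eq_norm]
    refine (norm_integral_cexp_sub_le (hX.integrable one_le_two)
      (hY.integrable one_le_two)).trans ((integral_abs_le_sqrt (hX.sub hY)).trans
      (Real.sqrt_le_sqrt (le_trans (le_of_eq ?_) hn.le)))
    have h1 := he.integral_comb_sq c L (blockTimes L (k + 1) (n / q k)) (Finset.Icc 1 n)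
      (blockTimes_subset L (k + 1) n) (√(n : ℝ))⁻¹ ((√(q k : ℝ))⁻¹ * (√((n / q k : ℕ) : ℝ))⁻¹)
    rw [card_blockTimes] at h1
    simp only [← sum_blockSum] at h1
    simp only [Pi.sub_apply, ← mul_assoc]
    rw [h1, ← hv]
    congr 1
    rw [Nat.card_Icc, Nat.add_sub_cancel, Real.sqrt_div hm0.le, mul_pow, inv_pow, inv_pow, inv_pow,
      Real.sq_sqrt hn0.le, Real.sq_sqrt hm0.le, Real.sq_sqrt (hq0 k).le]
    have h2 : √((n / q k : ℕ) : ℝ) * √((n / q k : ℕ) : ℝ) = (n / q k : ℕ) :=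
      Real.mul_self_sqrt hm0.le
    have h3 : 0 < √((n / q k : ℕ) : ℝ) := Real.sqrt_pos.2 hm0
    have h4 : 0 < √(n : ℝ) := Real.sqrt_pos.2 hn0
    have h5 : 0 < √(q k : ℝ) := Real.sqrt_pos.2 (hq0 k)
    have h6 := hq0 k
    push_cast
    have h7 : (√(n : ℝ))⁻¹ * ((√(q k : ℝ))⁻¹ * (√((n / q k : ℕ) : ℝ))⁻¹) *
        (((n / q k : ℕ) : ℝ) * ((k : ℝ) + 1)) =
        ((k : ℝ) + 1) / √(q k : ℝ) * (√((n / q k : ℕ) : ℝ) / √(n : ℝ)) := by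
      rw [← h2]
      generalize √((n / q k : ℕ) : ℝ) = s at *
      rw [Real.sqrt_mul_self h3.le]
      field_simp
    rw [mul_assoc 2, h7]
    field_simp

end BlockCLT

/-! ### White noise as a sequence in `L²` -/

section Lift

variable {Ω : Type*} [MeasurableSpace Ω] {P : Measure Ω} [IsProbabilityMeasure P]
  {H : Type*} [NormedAddCommGroup H] [InnerProductSpace ℝ H] [CompleteSpace H]
  [SecondCountableTopology H] [MeasurableSpace H] [BorelSpace H] {e : ℤ → Ω → H}

/-- The pointwise inner product of two elements of `L²(P; H)`, an element of `L¹(P)`. -/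
noncomputable def innerL1 (P : Measure Ω) : Lp H 2 P →L[ℝ] Lp H 2 P →L[ℝ] Lp ℝ 1 P :=
  ContinuousLinearMap.holderL P 2 2 1 (innerSL ℝ : H →L[ℝ] H →L[ℝ] ℝ)

lemma coeFn_innerL1 (x y : Lp H 2 P) :
    innerL1 P x y =ᵐ[P] fun ω => inner ℝ (x ω) (y ω) :=
  ContinuousLinearMap.coeFn_holder (r := 1) (innerSL ℝ : H →L[ℝ] H →L[ℝ] ℝ) x y

lemma innerL1_comm (x y : Lp H 2 P) : innerL1 P x y = innerL1 P y x := by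
  refine Lp.ext ?_
  filter_upwards [coeFn_innerL1 x y, coeFn_innerL1 y x] with ω h1 h2
  rw [h1, h2, real_inner_comm]

lemma coeFn_smul_sum {p : ENNReal} {ι F : Type*} [NormedAddCommGroup F] [NormedSpace ℝ F]
    (U : ι → Lp F p P) (f : ι → Ω → F) (h : ∀ i, U i =ᵐ[P] f i) (a : ℝ) (S : Finset ι) :
    (a • ∑ i ∈ S, U i : Lp F p P) =ᵐ[P] fun ω => a • ∑ i ∈ S, f i ω := by
  have h1 : ∀ᵐ ω ∂P, ∀ i ∈ S, U i ω = f i ω := (Finset.eventually_all S).2 fun i _ => h i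
  filter_upwards [Lp.coeFn_smul a (∑ i ∈ S, U i), Lp.coeFn_finsetSum S U, h1] with ω h2 h3 h4
  rw [h2, Pi.smul_apply, h3, Finset.sum_apply]
  congr 1
  exact Finset.sum_congr rfl h4

lemma norm_innerL1_le (x y : Lp H 2 P) : ‖innerL1 P x y‖ ≤ ‖x‖ * ‖y‖ := by
  refine (ContinuousLinearMap.norm_holder_apply_apply_le
    (innerSL ℝ : H →L[ℝ] H →L[ℝ] ℝ) x y).trans ?_
  rw [mul_assoc]
  exact mul_le_of_le_one_left (by positivity) (norm_innerSL_le ℝ)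

lemma sum_range_add_one {M : Type*} [AddCommMonoid M] (f : ℕ → M) (n : ℕ) :
    ∑ i ∈ Finset.range n, f (i + 1) = ∑ t ∈ Finset.Icc 1 n, f t := by
  induction n with
  | zero => simp
  | succ n ih => rw [Finset.sum_range_succ, ih, Finset.sum_Icc_succ_top (by omega)]

lemma sum_range_ite_le {M : Type*} [AddCommGroup M] {N n : ℕ} (h : N ≤ n) (f : ℕ → M) :
    ∑ l ∈ Finset.range n, (if N ≤ l then f l else 0) =
      ∑ l ∈ Finset.range n, f l - ∑ l ∈ Finset.range N, f l := by
  rw [← Finset.sum_filter, ← Finset.sum_Ico_eq_sub _ h]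
  refine Finset.sum_congr ?_ fun _ _ => rfl
  ext; simp; omega

lemma norm_L1_eq {U : Lp ℝ 1 P} {f : Ω → ℝ} (h : U =ᵐ[P] f) : ‖U‖ = ∫ ω, |f ω| ∂P := by
  rw [L1.norm_eq_integral_norm]
  refine integral_congr_ae ?_
  filter_upwards [h] with ω hω
  rw [hω, Real.norm_eq_abs]

namespace IsWhiteNoise

/-- The noise variables as elements of `L²(P; H)`. -/
noncomputable def toLp (he : IsWhiteNoise P e) (t : ℤ) : Lp H 2 P := (he.memLp t).toLp (e t)

lemma coeFn_toLp (he : IsWhiteNoise P e) (t : ℤ) : he.toLp t =ᵐ[P] e t := (he.memLp t).coeFn_toLp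

lemma coeFn_innerL1_toLp (he : IsWhiteNoise P e) (s t : ℤ) :
    innerL1 P (he.toLp s) (he.toLp t) =ᵐ[P] fun ω => inner ℝ (e s ω) (e t ω) := by
  filter_upwards [coeFn_innerL1 (he.toLp s) (he.toLp t), he.coeFn_toLp s, he.coeFn_toLp t]
    with ω h1 h2 h3
  rw [h1, h2, h3]

lemma inner_toLp (he : IsWhiteNoise P e) (s t : ℤ) :
    inner ℝ (he.toLp s) (he.toLp t) = if s = t then ∫ ω, ‖e 0 ω‖ ^ 2 ∂P else 0 := by
  have h1 : inner ℝ (he.toLp s) (he.toLp t) = ∫ ω, inner ℝ (e s ω) (e t ω) ∂P := by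
    rw [L2.inner_def]
    refine integral_congr_ae ?_
    filter_upwards [he.coeFn_toLp s, he.coeFn_toLp t] with ω h2 h3
    rw [h2, h3]
  rw [h1]
  split_ifs with h
  · subst h
    simp_rw [real_inner_self_eq_norm_sq]
    exact ((he.identDistrib s).comp (u := fun x => ‖x‖ ^ 2) (by fun_prop)).integral_eq
  · exact (he.indep.indepFun h).integral_inner_eq_zero (he.measurable s) (he.measurable t)
      ((he.memLp t).integrable one_le_two) (he.integral_eq_zero t)

lemma norm_sum_toLp_le (he : IsWhiteNoise P e) (n : ℕ) :
    ‖∑ t ∈ Finset.Icc 1 n, he.toLp (t : ℤ)‖ ≤ √(∫ ω, ‖e 0 ω‖ ^ 2 ∂P) * √(n : ℝ) := by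
  have h0 : 0 ≤ ∫ ω, ‖e 0 ω‖ ^ 2 ∂P := integral_nonneg fun ω => sq_nonneg _
  rw [← Real.sqrt_mul h0]
  refine Real.le_sqrt_of_sq_le (le_of_eq ?_)
  rw [← real_inner_self_eq_norm_sq, sum_inner]
  simp_rw [inner_sum, he.inner_toLp, Nat.cast_inj, Finset.sum_ite_eq]
  rw [Finset.sum_congr rfl fun s hs => if_pos hs]
  simp [mul_comm]

/-- Law of large numbers for lagged products of the noise, in `L¹`. -/
lemma tendsto_average_innerL1 (he : IsWhiteNoise P e) (l l' : ℕ) :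
    Tendsto (fun n : ℕ => (n : ℝ)⁻¹ • ∑ t ∈ Finset.Icc 1 n,
        innerL1 P (he.toLp ((t : ℤ) - l)) (he.toLp ((t : ℤ) - l'))) atTop
      (𝓝 (if l = l' then (memLp_const (∫ ω, ‖e 0 ω‖ ^ 2 ∂P)).toLp _ else 0)) := by
  wlog hll : l ≤ l' generalizing l l' with Hw
  · have h1 := Hw l' l (by omega)
    simp_rw [eq_comm (a := l') (b := l)] at h1
    refine h1.congr fun n => ?_
    simp_rw [innerL1_comm (he.toLp (_ - (l' : ℤ)))]
  rcases hll.eq_or_lt with rfl | hlt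
  · rw [if_pos rfl]
    set τ : ℝ := ∫ ω, ‖e 0 ω‖ ^ 2 ∂P with hτ
    have hid : ∀ t, IdentDistrib (fun ω => ‖e t ω‖ ^ 2) (fun ω => ‖e 0 ω‖ ^ 2) P P := fun t =>
      (he.identDistrib t).comp (u := fun x => ‖x‖ ^ 2) (by fun_prop)
    have h1 := strong_law_Lp (μ := P) le_rfl ENNReal.one_ne_top
      (fun i ω => ‖e ((i : ℤ) + 1 - l) ω‖ ^ 2)
      (memLp_one_iff_integrable.2 (he.memLp _).integrable_norm_pow')
      (fun i j hij => (he.indep.indepFun (by omega)).comp (φ := fun x => ‖x‖ ^ 2)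
        (ψ := fun x => ‖x‖ ^ 2) (by fun_prop) (by fun_prop))
      (fun i => (hid _).trans (hid _).symm)
    rw [(hid _).integral_eq, ← hτ] at h1
    rw [tendsto_iff_norm_sub_tendsto_zero]
    have h2 := (ENNReal.tendsto_toReal ENNReal.zero_ne_top).comp h1
    refine h2.congr fun n => ?_
    rw [Lp.norm_def, Function.comp_apply]
    congr 1
    refine eLpNorm_congr_ae ?_
    filter_upwards [Lp.coeFn_sub ((n : ℝ)⁻¹ • ∑ t ∈ Finset.Icc 1 n,
        innerL1 P (he.toLp ((t : ℤ) - l)) (he.toLp ((t : ℤ) - l))) ((memLp_const τ).toLp _),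
      coeFn_smul_sum _ _ (fun t : ℕ => he.coeFn_innerL1_toLp ((t : ℤ) - l) ((t : ℤ) - l))
        (n : ℝ)⁻¹ (Finset.Icc 1 n), (memLp_const (p := 1) (μ := P) τ).coeFn_toLp] with ω h3 h4 h5
    rw [h3, Pi.sub_apply, h4, h5, ← sum_range_add_one]
    simp only [real_inner_self_eq_norm_sq, Nat.cast_add, Nat.cast_one]
  · rw [if_neg hlt.ne]
    have h1 : Tendsto (fun n : ℕ => √(noiseVar P e * (n : ℝ)⁻¹)) atTop (𝓝 0) := by
      have h2 := (Real.continuous_sqrt.tendsto _).comp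
        ((tendsto_inv_atTop_nhds_zero_nat (𝕜 := ℝ)).const_mul (noiseVar P e))
      rwa [mul_zero, Real.sqrt_zero] at h2
    refine squeeze_zero_norm' ?_ h1
    filter_upwards [eventually_gt_atTop 0] with n hn
    have hn0 : (n : ℝ) ≠ 0 := by positivity
    have h3 : ∀ t : ℕ, innerL1 P (he.toLp ((t : ℤ) - l)) (he.toLp ((t : ℤ) - l')) =ᵐ[P]
        lagProd e (l' - l - 1) ((t : ℤ) - l) := by
      intro t
      rw [innerL1_comm]
      have h4 : (t : ℤ) - l' = (t : ℤ) - l - 1 - (l' - l - 1 : ℕ) := by omega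
      rw [h4]
      exact he.coeFn_innerL1_toLp _ _
    rw [norm_L1_eq (coeFn_smul_sum _ _ h3 (n : ℝ)⁻¹ (Finset.Icc 1 n))]
    have hmem : MemLp (fun ω => (n : ℝ)⁻¹ • ∑ t ∈ Finset.Icc 1 n,
        lagProd e (l' - l - 1) ((t : ℤ) - l) ω) 2 P :=
      (memLp_finsetSum _ fun (t : ℕ) _ => he.memLp_lagProd _ _).const_mul _
    refine (integral_abs_le_sqrt hmem).trans (Real.sqrt_le_sqrt (le_of_eq ?_))
    have h5 := integral_sum_mul_sum (P := P)
      (f := fun t : ℕ => lagProd e (l' - l - 1) ((t : ℤ) - l)) (v := noiseVar P e)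
      (fun t => he.memLp_lagProd _ _) (fun s t => by rw [he.integral_lagProd_mul]; simp)
      (Finset.Icc 1 n) (Finset.Icc 1 n) (fun _ => (n : ℝ)⁻¹) (fun _ => (n : ℝ)⁻¹)
    simp only [← Finset.mul_sum] at h5
    simp only [smul_eq_mul, sq]
    rw [h5]
    simp [hn0]

lemma norm_toLp (he : IsWhiteNoise P e) (t : ℤ) :
    ‖he.toLp t‖ = √(∫ ω, ‖e 0 ω‖ ^ 2 ∂P) := by
  rw [norm_eq_sqrt_real_inner, he.inner_toLp, if_pos rfl]

lemma coeFn_innerL1_sum (he : IsWhiteNoise P e) (c : ℕ → ℝ) (N : ℕ) (t : ℤ) :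
    innerL1 P (∑ l ∈ Finset.range N, c l • he.toLp (t - 1 - l)) (he.toLp t) =ᵐ[P]
      lagSum e c N t := by
  have h1 : innerL1 P (∑ l ∈ Finset.range N, c l • he.toLp (t - 1 - l)) (he.toLp t) =
      (1 : ℝ) • ∑ l ∈ Finset.range N, c l • innerL1 P (he.toLp (t - 1 - l)) (he.toLp t) := by
    simp [map_sum]
  rw [h1]
  have h2 := coeFn_smul_sum (P := P)
    (fun l : ℕ => c l • innerL1 P (he.toLp (t - 1 - l)) (he.toLp t))
    (fun l ω => c l * lagProd e l t ω) (fun l => by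
      filter_upwards [Lp.coeFn_smul (c l) (innerL1 P (he.toLp (t - 1 - l)) (he.toLp t)),
        he.coeFn_innerL1_toLp (t - 1 - l) t] with ω h3 h4
      rw [h3, Pi.smul_apply, h4]
      rfl) 1 (Finset.range N)
  filter_upwards [h2] with ω h3
  rw [h3, one_smul, lagSum]

/-- In `L¹`, the normalized sums of `⟨∑_{l < N} c_l e_{t-1-l}, e_t⟩` are bounded by the `ℓ²`-norm
of `c`, uniformly in the sample size. -/
lemma norm_sum_innerL1_le (he : IsWhiteNoise P e) (c : ℕ → ℝ) (N n : ℕ) (hn : 0 < n) :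
    ‖(√(n : ℝ))⁻¹ • ∑ t ∈ Finset.Icc 1 n, innerL1 P
      (∑ l ∈ Finset.range N, c l • he.toLp ((t : ℤ) - 1 - l)) (he.toLp (t : ℤ))‖ ≤
      √(noiseVar P e * ∑ l ∈ Finset.range N, c l ^ 2) := by
  rw [norm_L1_eq (coeFn_smul_sum _ _ (fun t : ℕ => he.coeFn_innerL1_sum c N (t : ℤ)) _ _)]
  have hmem : MemLp (fun ω => (√(n : ℝ))⁻¹ • ∑ t ∈ Finset.Icc 1 n, lagSum e c N (t : ℤ) ω) 2 P :=
    (memLp_finsetSum _ fun (t : ℕ) _ => he.memLp_lagSum c N t).const_mul _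
  refine (integral_abs_le_sqrt hmem).trans (Real.sqrt_le_sqrt (le_of_eq ?_))
  have h := he.integral_comb_sq c N ∅ (Finset.Icc 1 n) (Finset.empty_subset _) (√(n : ℝ))⁻¹ 0
  simp only [zero_mul, sub_zero] at h
  simp only [smul_eq_mul]
  rw [h, inv_pow, Real.sq_sqrt (Nat.cast_nonneg n)]
  have hn0 : (n : ℝ) ≠ 0 := by positivity
  simp [hn0]

/-- **Central limit theorem** for `n^{-1/2} ∑_{t ≤ n} ⟨z_{t-1}, e_t⟩`, where `z` is a causal linear
process with innovations `e`. -/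
lemma tendsto_integral_cexp_innerL1 (he : IsWhiteNoise P e) (c : ℕ → ℝ)
    (hc : Summable fun l => c l ^ 2) (z : ℤ → Lp H 2 P) (hz : IsLinearProcess c he.toLp z) :
    Tendsto (fun n : ℕ => ∫ ω, Complex.exp (((√(n : ℝ))⁻¹ • ∑ t ∈ Finset.Icc 1 n,
        innerL1 P (z ((t : ℤ) - 1)) (he.toLp t) : Lp ℝ 1 P) ω * Complex.I) ∂P) atTop
      (𝓝 (Complex.exp ((-(noiseVar P e * ∑' l, c l ^ 2) / 2 : ℝ)))) := by
  obtain ⟨ρ, hρ, hzρ⟩ := hz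
  have hκ : 0 ≤ noiseVar P e := integral_nonneg fun ω => sq_nonneg _
  set y : ℕ → ℤ → Lp H 2 P := fun N t => ∑ l ∈ Finset.range N, c l • he.toLp (t - l) with hy
  set U : ℕ → Lp ℝ 1 P := fun n => (√(n : ℝ))⁻¹ • ∑ t ∈ Finset.Icc 1 n,
    innerL1 P (z ((t : ℤ) - 1)) (he.toLp t) with hU
  set UN : ℕ → ℕ → Lp ℝ 1 P := fun N n => (√(n : ℝ))⁻¹ • ∑ t ∈ Finset.Icc 1 n,
    innerL1 P (y N ((t : ℤ) - 1)) (he.toLp t) with hUN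
  refine tendsto_of_approx
    (w := fun N n => ∫ ω, Complex.exp (((√(n : ℝ))⁻¹ *
        ∑ t ∈ Finset.Icc 1 n, lagSum e c N t ω : ℝ) * Complex.I) ∂P)
    (W := fun N => Complex.exp ((-(noiseVar P e * ∑ l ∈ Finset.range N, c l ^ 2) / 2 : ℝ)))
    (δ := fun N => √(noiseVar P e * (∑' l, c l ^ 2 - ∑ l ∈ Finset.range N, c l ^ 2))) ?_
    (fun N => he.tendsto_integral_cexp_lagSum c N) ?_ (fun N => ?_)
  · have h1 := (hc.hasSum.tendsto_sum_nat.const_sub (∑' l, c l ^ 2)).const_mul (noiseVar P e)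
    rw [sub_self, mul_zero] at h1
    have h2 := (Real.continuous_sqrt.tendsto _).comp h1
    rwa [Real.sqrt_zero] at h2
  · refine (Complex.continuous_exp.tendsto _).comp ((Complex.continuous_ofReal.tendsto _).comp ?_)
    exact ((hc.hasSum.tendsto_sum_nat.const_mul (noiseVar P e)).neg).div_const 2
  · filter_upwards [eventually_gt_atTop 0] with n hn
    have hae : UN N n =ᵐ[P] fun ω => (√(n : ℝ))⁻¹ * ∑ t ∈ Finset.Icc 1 n, lagSum e c N t ω :=
      coeFn_smul_sum _ _ (fun t : ℕ => he.coeFn_innerL1_sum c N (t : ℤ)) _ _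
    have h1 : dist (∫ ω, Complex.exp (U n ω * Complex.I) ∂P)
        (∫ ω, Complex.exp (((√(n : ℝ))⁻¹ *
          ∑ t ∈ Finset.Icc 1 n, lagSum e c N t ω : ℝ) * Complex.I) ∂P) ≤ ‖U n - UN N n‖ := by
      have h2 : ∫ ω, Complex.exp (((√(n : ℝ))⁻¹ *
          ∑ t ∈ Finset.Icc 1 n, lagSum e c N t ω : ℝ) * Complex.I) ∂P =
          ∫ ω, Complex.exp (UN N n ω * Complex.I) ∂P := by
        refine integral_congr_ae ?_
        filter_upwards [hae] with ω hω
        rw [hω]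
      rw [h2, dist_eq_norm, norm_L1_eq (Lp.coeFn_sub (U n) (UN N n))]
      exact norm_integral_cexp_sub_le (L1.integrable_coeFn _) (L1.integrable_coeFn _)
    refine h1.trans ?_
    -- compare both with a longer truncation `M`, which is then sent to infinity
    have h2 : Tendsto (fun M => ‖U n - UN M n‖ +
        √(noiseVar P e * (∑' l, c l ^ 2 - ∑ l ∈ Finset.range N, c l ^ 2))) atTop
        (𝓝 (0 + √(noiseVar P e * (∑' l, c l ^ 2 - ∑ l ∈ Finset.range N, c l ^ 2)))) := by
      refine Tendsto.add_const _ (squeeze_zero (fun _ => norm_nonneg _) (fun M => ?_)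
        (by simpa using hρ.const_mul ((√(n : ℝ))⁻¹ * n *
          √(∫ ω, ‖e 0 ω‖ ^ 2 ∂P))))
      have h3 : U n - UN M n = (√(n : ℝ))⁻¹ • ∑ t ∈ Finset.Icc 1 n,
          innerL1 P (z ((t : ℤ) - 1) - y M ((t : ℤ) - 1)) (he.toLp t) := by
        simp only [hU, hUN, ← smul_sub, ← Finset.sum_sub_distrib, map_sub, sub_apply]
      rw [h3, norm_smul, norm_inv, Real.norm_of_nonneg (Real.sqrt_nonneg _), mul_assoc, mul_assoc]
      refine mul_le_mul_of_nonneg_left ?_ (by positivity)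
      have h4 : ∀ t ∈ Finset.Icc 1 n, ‖innerL1 P (z ((t : ℤ) - 1) - y M ((t : ℤ) - 1))
          (he.toLp t)‖ ≤ ρ M * √(∫ ω, ‖e 0 ω‖ ^ 2 ∂P) := fun t _ =>
        (norm_innerL1_le _ _).trans (mul_le_mul (hzρ M ((t : ℤ) - 1)) (he.norm_toLp t).le
          (norm_nonneg _) ((norm_nonneg _).trans (hzρ M 0)))
      refine (norm_sum_le_of_le _ h4).trans (le_of_eq ?_)
      rw [Finset.sum_const, Nat.card_Icc, Nat.add_sub_cancel, nsmul_eq_mul, mul_comm (ρ M)]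
    rw [zero_add] at h2
    refine ge_of_tendsto h2 ?_
    filter_upwards [eventually_ge_atTop N] with M hM
    set c' : ℕ → ℝ := fun l => if N ≤ l then c l else 0 with hc'
    have h4 : UN M n - UN N n = (√(n : ℝ))⁻¹ • ∑ t ∈ Finset.Icc 1 n, innerL1 P
        (∑ l ∈ Finset.range M, c' l • he.toLp ((t : ℤ) - 1 - l)) (he.toLp (t : ℤ)) := by
      simp only [hUN, hy, hc', ite_smul, zero_smul, sum_range_ite_le hM, ← smul_sub,
        ← Finset.sum_sub_distrib,
        map_sub, sub_apply]
    have h5 : ∑ l ∈ Finset.range M, c' l ^ 2 ≤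
        ∑' l, c l ^ 2 - ∑ l ∈ Finset.range N, c l ^ 2 := by
      have h6 : ∀ l, c' l ^ 2 = if N ≤ l then c l ^ 2 else 0 := by
        intro l; simp only [hc']; split_ifs <;> simp
      simp only [h6, sum_range_ite_le hM]
      linarith [hc.sum_le_tsum (Finset.range M) fun l _ => sq_nonneg (c l)]
    calc ‖U n - UN N n‖ ≤ ‖U n - UN M n‖ + ‖UN M n - UN N n‖ :=
          norm_sub_le_norm_sub_add_norm_sub _ _ _
      _ ≤ _ := by
        gcongr
        rw [h4]
        exact (he.norm_sum_innerL1_le c' M n hn).trans (Real.sqrt_le_sqrt (by gcongr))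

end IsWhiteNoise

end Lift

/-! ### Convergence in measure -/

section InMeasure

variable {Ω : Type*} [MeasurableSpace Ω] {P : Measure Ω}

/-- Continuous mapping theorem for convergence in measure to a constant. -/
lemma tendstoInMeasure_comp_continuousAt {X Y : Type*} [PseudoMetricSpace X] [PseudoMetricSpace Y]
    {f : ℕ → Ω → X} {c : X} (hf : TendstoInMeasure P f atTop fun _ => c) {φ : X → Y}
    (hφ : ContinuousAt φ c) :
    TendstoInMeasure P (fun n ω => φ (f n ω)) atTop fun _ => φ c := by
  rw [tendstoInMeasure_iff_dist] at hf ⊢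
  intro r hr
  obtain ⟨d, hd, h⟩ := Metric.continuousAt_iff.1 hφ r hr
  refine tendsto_of_tendsto_of_tendsto_of_le_of_le tendsto_const_nhds (hf d hd)
    (fun _ => zero_le) fun n => measure_mono fun ω hω => ?_
  simp only [Set.mem_ofPred_eq] at hω ⊢
  by_contra! hlt
  exact absurd (h hlt) (not_lt.2 hω)

lemma tendstoInMeasure_pi {ι X : Type*} [Fintype ι] [PseudoMetricSpace X] {f : ι → ℕ → Ω → X}
    {g : ι → Ω → X} (h : ∀ i, TendstoInMeasure P (f i) atTop (g i)) :
    TendstoInMeasure P (fun n ω i => f i n ω) atTop fun ω i => g i ω := by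
  simp only [tendstoInMeasure_iff_dist] at h ⊢
  intro r hr
  have h1 : Tendsto (fun n => ∑ i, P {ω | r ≤ dist (f i n ω) (g i ω)}) atTop (𝓝 0) := by
    simpa using tendsto_finsetSum Finset.univ fun i _ => h i r hr
  refine tendsto_of_tendsto_of_tendsto_of_le_of_le tendsto_const_nhds h1
    (fun _ => zero_le) fun n => ?_
  refine le_trans (measure_mono fun ω hω => ?_) (measure_iUnion_fintype_le P _)
  simp only [Set.mem_ofPred_eq, Set.mem_iUnion] at hω ⊢
  by_contra! hlt
  exact absurd ((dist_pi_lt_iff hr).2 hlt) (not_lt.2 hω)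

end InMeasure

/-! ### From residuals to the Yule-Walker estimator -/

section YuleWalker

variable {p : ℕ}

/-- Matrix inversion on plain arrays, which, unlike matrices, carry a metric. -/
noncomputable def invArray (A : Fin p → Fin p → ℝ) : Fin p → Fin p → ℝ :=
  fun i j => ((Matrix.of A)⁻¹ : Matrix (Fin p) (Fin p) ℝ) i j

/-- Cramer's rule. Where the determinant vanishes both sides are zero. -/
lemma invArray_apply (A : Fin p → Fin p → ℝ) (i j : Fin p) :
    invArray A i j = ((Matrix.of A).det)⁻¹ * (Matrix.of A).adjugate i j := by
  have h : ((Matrix.of A)⁻¹ : Matrix (Fin p) (Fin p) ℝ) i j =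
      ((Matrix.of A).det)⁻¹ * (Matrix.of A).adjugate i j := by
    rw [Matrix.inv_def, Matrix.smul_apply, Ring.inverse_eq_inv', smul_eq_mul]
  exact h

lemma continuous_det_of : Continuous fun A : Fin p → Fin p → ℝ => (Matrix.of A).det :=
  Continuous.matrix_det (A := fun A : Fin p → Fin p → ℝ => Matrix.of A) continuous_id

lemma continuous_adjugate_of (i j : Fin p) :
    Continuous fun A : Fin p → Fin p → ℝ => (Matrix.of A).adjugate i j :=
  (Continuous.matrix_adjugate (A := fun A : Fin p → Fin p → ℝ => Matrix.of A)
    continuous_id).matrix_elem i j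

lemma measurable_invArray : Measurable (invArray (p := p)) := by
  refine measurable_pi_iff.2 fun i => measurable_pi_iff.2 fun j => ?_
  simp only [invArray_apply]
  exact continuous_det_of.measurable.inv.mul (continuous_adjugate_of i j).measurable

lemma continuousAt_invArray {A : Fin p → Fin p → ℝ} (hA : (Matrix.of A).det ≠ 0) :
    ContinuousAt invArray A := by
  refine continuousAt_pi.2 fun i => continuousAt_pi.2 fun j => ?_
  simp only [invArray_apply]
  exact (continuous_det_of.continuousAt.inv₀ hA).mul (continuous_adjugate_of i j).continuousAt

variable {Ω : Type*} [MeasurableSpace Ω] {P : Measure Ω} [IsProbabilityMeasure P]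

/-- If the sample autocovariances converge to `τ R` in `L¹` and the Yule-Walker residuals are
asymptotically normal with covariance `κ R`, then the Yule-Walker estimator is asymptotically
normal with covariance `(κ / τ²) R⁻¹`. -/
theorem tendstoInDistribution_yuleWalker (β : EuclideanSpace ℝ (Fin p))
    (R : Matrix (Fin p) (Fin p) ℝ) (hR : R.PosDef) {τ κ : ℝ} (hτ : 0 < τ) (hκ : 0 ≤ κ) (γ : ℕ → ℕ → Lp ℝ 1 P)
    (M : ℕ → Fin p → Lp ℝ 1 P) (η : ℕ → ℕ → Ω → ℝ) (hη : ∀ n h, η n h =ᵐ[P] γ n h)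
    (h1 : ∀ j k : Fin p, Tendsto (fun n => γ n ((j : ℤ) - (k : ℤ)).natAbs) atTop
      (𝓝 (R j k • (memLp_const τ).toLp _)))
    (h2 : ∀ j : Fin p, Tendsto (fun n : ℕ => √(n : ℝ) • (γ n ((j : ℕ) + 1) -
      ∑ k : Fin p, β k • γ n ((j : ℤ) - (k : ℤ)).natAbs) - M n j) atTop (𝓝 0))
    (h3 : ∀ a : Fin p → ℝ, Tendsto (fun n => ∫ ω, Complex.exp
      ((∑ j, a j • M n j : Lp ℝ 1 P) ω * Complex.I) ∂P) atTop
      (𝓝 (Complex.exp ((-(κ * dotProduct a (Matrix.mulVec R a)) / 2 : ℝ))))) :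
    TendstoInDistribution
      (fun (n : ℕ) (ω : Ω) => √(n : ℝ) • ((WithLp.toLp 2 (Matrix.mulVec
        (Matrix.of fun j k : Fin p => η n ((j : ℤ) - (k : ℤ)).natAbs ω)⁻¹
        (fun j : Fin p => η n ((j : ℕ) + 1) ω)) : EuclideanSpace ℝ (Fin p)) - β))
      atTop id (fun _ => P) (multivariateGaussian 0 ((κ / τ ^ 2) • R⁻¹)) := by
  set S : Matrix (Fin p) (Fin p) ℝ := τ • R with hS
  have hRdet : R.det ≠ 0 := hR.det_pos.ne'
  have hSinv : S⁻¹ = τ⁻¹ • R⁻¹ := by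
    refine Matrix.inv_eq_right_inv ?_
    rw [hS, smul_mul_smul_comm, Matrix.mul_nonsing_inv _ (by simpa using hRdet),
      mul_inv_cancel₀ hτ.ne', one_smul]
  have hSdet : S.det ≠ 0 := by
    rw [hS, Matrix.det_smul]
    exact mul_ne_zero (pow_ne_zero _ hτ.ne') hRdet
  have hηm : ∀ n h, AEMeasurable (η n h) P := fun n h =>
    ((Lp.aestronglyMeasurable (γ n h)).congr (hη n h).symm).aemeasurable
  -- residuals, and their limits `M`, as random vectors
  set r : ℕ → Ω → Fin p → ℝ := fun n ω j => √(n : ℝ) * (η n ((j : ℕ) + 1) ω -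
    ∑ k : Fin p, β k * η n ((j : ℤ) - (k : ℤ)).natAbs ω) with hr
  set G : ℕ → Ω → Fin p → Fin p → ℝ := fun n ω j k => η n ((j : ℤ) - (k : ℤ)).natAbs ω with hG
  have hrm : ∀ n, AEMeasurable (r n) P := fun n => aemeasurable_pi_lambda _ fun j =>
    ((hηm _ _).sub (Finset.aemeasurable_fun_sum _ fun k _ => (hηm _ _).const_mul _)).const_mul _
  have hGm : ∀ n, AEMeasurable (G n) P := fun n => aemeasurable_pi_lambda _ fun j =>
    aemeasurable_pi_lambda _ fun k => hηm _ _
  have hMm : ∀ n, AEMeasurable (fun ω j => M n j ω) P := fun n => aemeasurable_pi_lambda _ fun j =>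
    (Lp.aestronglyMeasurable _).aemeasurable
  have hcont : Continuous fun z : Fin p → ℝ =>
      (WithLp.toLp 2 (Matrix.mulVec S⁻¹ z) : EuclideanSpace ℝ (Fin p)) :=
    (PiLp.continuous_toLp 2 _).comp (continuous_const.matrix_mulVec continuous_id)
  -- normality of the normalized limits
  have hW : TendstoInDistribution (fun n ω => (WithLp.toLp 2 (Matrix.mulVec S⁻¹
      (fun j => M n j ω)) : EuclideanSpace ℝ (Fin p))) atTop id (fun _ => P)
      (multivariateGaussian 0 ((κ / τ ^ 2) • R⁻¹)) := by
    have hWm : ∀ n, AEMeasurable (fun ω => (WithLp.toLp 2 (Matrix.mulVec S⁻¹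
      (fun j => M n j ω)) : EuclideanSpace ℝ (Fin p))) P := fun n =>
        hcont.measurable.comp_aemeasurable (hMm n)
    refine ⟨hWm, by fun_prop, ?_⟩
    refine ProbabilityMeasure.tendsto_iff_tendsto_charFun.2 fun a => ?_
    have hpsd : ((κ / τ ^ 2) • R⁻¹).PosSemidef :=
      hR.inv.posSemidef.smul (by positivity)
    simp only [ProbabilityMeasure.coe_mk, Measure.map_id]
    rw [charFun_multivariateGaussian hpsd]
    have h4 := h3 (Matrix.mulVec S⁻¹ a)
    have hsymm : R⁻¹.transpose = R⁻¹ := by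
      have := hR.inv.isHermitian.eq
      rwa [Matrix.conjTranspose_eq_transpose_of_trivial] at this
    convert! h4 using 1
    · funext n
      rw [charFun_apply, integral_map (hWm n) (by fun_prop)]
      refine integral_congr_ae ?_
      have h5 : ∀ᵐ ω ∂P, ∀ j, (Matrix.mulVec S⁻¹ a j • M n j : Lp ℝ 1 P) ω =
          Matrix.mulVec S⁻¹ a j * M n j ω := ae_all_iff.2 fun j => Lp.coeFn_smul _ _
      filter_upwards [Lp.coeFn_finsetSum Finset.univ
        (fun j => (Matrix.mulVec S⁻¹ a j • M n j : Lp ℝ 1 P)), h5] with ω h6 h7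
      rw [h6, Finset.sum_apply]
      simp only [h7]
      congr 3
      have h8 : (inner ℝ (WithLp.toLp 2 (Matrix.mulVec S⁻¹ (fun j => M n j ω)) :
          EuclideanSpace ℝ (Fin p)) a : ℝ) =
          dotProduct (a : Fin p → ℝ) (Matrix.mulVec S⁻¹ (fun j => M n j ω)) := by
        rw [PiLp.inner_apply]
        simp [dotProduct]
      rw [h8, Matrix.dotProduct_mulVec, ← Matrix.mulVec_transpose]
      have h9 : S⁻¹.transpose = S⁻¹ := by rw [hSinv, Matrix.transpose_smul, hsymm]
      rw [h9]
      rfl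
    · have h6 : dotProduct (Matrix.mulVec S⁻¹ a) (Matrix.mulVec R (Matrix.mulVec S⁻¹ a)) =
          (τ ^ 2)⁻¹ * dotProduct (a : Fin p → ℝ) (Matrix.mulVec R⁻¹ a) := by
        rw [hSinv, Matrix.smul_mulVec, Matrix.mulVec_smul, Matrix.mulVec_mulVec,
          Matrix.mul_nonsing_inv _ (by simpa using hRdet), Matrix.one_mulVec, smul_dotProduct,
          dotProduct_smul, dotProduct_comm, smul_eq_mul, smul_eq_mul]
        ring
      rw [h6, Matrix.smul_mulVec, dotProduct_smul, inner_zero_right, smul_eq_mul]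
      congr 2
      push_cast
      ring
  -- the residuals have the same limit
  have hD : TendstoInMeasure P (fun n ω j => r n ω j - M n j ω) atTop fun _ => (0 : Fin p → ℝ) := by
    refine tendstoInMeasure_pi (f := fun j n ω => r n ω j - M n j ω) (g := fun _ _ => 0)
      fun j => ?_
    have h4 := tendstoInMeasure_of_tendsto_Lp (h2 j)
    refine h4.congr (fun n => ?_) (Lp.coeFn_zero _ _ _)
    have h5 : ∀ᵐ ω ∂P, ∀ k : Fin p, (β k • γ n ((j : ℤ) - (k : ℤ)).natAbs : Lp ℝ 1 P) ω =
          β k * η n ((j : ℤ) - (k : ℤ)).natAbs ω := ae_all_iff.2 fun k => by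
      filter_upwards [Lp.coeFn_smul (β k) (γ n ((j : ℤ) - (k : ℤ)).natAbs), hη n _] with ω h6 h7
      rw [h6, h7]; rfl
    filter_upwards [h5, Lp.coeFn_finsetSum Finset.univ
        (fun k : Fin p => (β k • γ n ((j : ℤ) - (k : ℤ)).natAbs : Lp ℝ 1 P)),
      Lp.coeFn_sub (√(n : ℝ) • (γ n ((j : ℕ) + 1) -
        ∑ k : Fin p, β k • γ n ((j : ℤ) - (k : ℤ)).natAbs)) (M n j),
      Lp.coeFn_smul (√(n : ℝ)) (γ n ((j : ℕ) + 1) -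
        ∑ k : Fin p, β k • γ n ((j : ℤ) - (k : ℤ)).natAbs),
      Lp.coeFn_sub (γ n ((j : ℕ) + 1)) (∑ k : Fin p, β k • γ n ((j : ℤ) - (k : ℤ)).natAbs),
      hη n ((j : ℕ) + 1)] with ω a1 a2 a3 a4 a5 a6
    rw [a3, Pi.sub_apply, a4, Pi.smul_apply, a5, Pi.sub_apply, a2, Finset.sum_apply, ← a6]
    simp only [a1, hr, smul_eq_mul]
  have hW' : TendstoInDistribution (fun n ω => (WithLp.toLp 2 (Matrix.mulVec S⁻¹ (r n ω)) :
      EuclideanSpace ℝ (Fin p))) atTop id (fun _ => P)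
      (multivariateGaussian 0 ((κ / τ ^ 2) • R⁻¹)) := by
    refine tendstoInDistribution_of_tendstoInMeasure_sub _ _ hW ?_
      fun n => hcont.measurable.comp_aemeasurable (hrm n)
    have h4 := tendstoInMeasure_comp_continuousAt hD hcont.continuousAt
    rw [Matrix.mulVec_zero, WithLp.toLp_zero] at h4
    refine h4.congr_left fun n => Eventually.of_forall fun ω => ?_
    simp only [Pi.sub_apply]
    rw [← WithLp.toLp_sub, ← Matrix.mulVec_sub]
    rfl
  -- Slutsky's theorem, for the random matrix
  have hGlim : TendstoInMeasure P G atTop fun _ => (S : Fin p → Fin p → ℝ) := by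
    refine tendstoInMeasure_pi (f := fun j n ω => G n ω j) (g := fun j _ => S j) fun j =>
      tendstoInMeasure_pi (f := fun k n ω => G n ω j k) (g := fun k _ => S j k) fun k => ?_
    have h4 := tendstoInMeasure_of_tendsto_Lp (h1 j k)
    refine h4.congr (fun n => (hη n _).symm) ?_
    filter_upwards [Lp.coeFn_smul (R j k) ((memLp_const (p := 1) (μ := P) τ).toLp _),
      (memLp_const (p := 1) (μ := P) τ).coeFn_toLp] with ω a1 a2
    rw [a1, Pi.smul_apply, a2, hS, Matrix.smul_apply, smul_eq_mul, smul_eq_mul, mul_comm]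
  have hAlim := tendstoInMeasure_comp_continuousAt hGlim (continuousAt_invArray hSdet)
  have hslutsky := hW'.continuous_comp_prodMk_of_tendstoInMeasure_const
    (g := fun z : EuclideanSpace ℝ (Fin p) × (Fin p → Fin p → ℝ) =>
      (WithLp.toLp 2 (Matrix.mulVec (Matrix.of z.2) (Matrix.mulVec S z.1.ofLp)) :
        EuclideanSpace ℝ (Fin p)))
    (by
      refine (PiLp.continuous_toLp 2 _).comp (Continuous.matrix_mulVec (A := fun z :
        EuclideanSpace ℝ (Fin p) × (Fin p → Fin p → ℝ) => Matrix.of z.2) continuous_snd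
        (continuous_const.matrix_mulVec ((PiLp.continuous_ofLp 2 _).comp continuous_fst)))) hAlim
    (fun n => measurable_invArray.comp_aemeasurable (hGm n))
  have hlimid : (fun ω : EuclideanSpace ℝ (Fin p) => (WithLp.toLp 2 (Matrix.mulVec
      (Matrix.of (invArray (S : Fin p → Fin p → ℝ))) (Matrix.mulVec S (id ω).ofLp)) :
        EuclideanSpace ℝ (Fin p))) = id := by
    funext z
    have : Matrix.of (invArray (S : Fin p → Fin p → ℝ)) = S⁻¹ := rfl
    rw [this, Matrix.mulVec_mulVec, Matrix.nonsing_inv_mul _ (by simpa using hSdet),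
      Matrix.one_mulVec]
  simp only at hslutsky
  rw [hlimid] at hslutsky
  refine tendstoInDistribution_of_tendstoInMeasure_sub _ _ hslutsky ?_ fun n => ?_
  · -- the two sides agree where the sample autocovariance matrix is invertible
    have hdet := tendstoInMeasure_comp_continuousAt hGlim
      (continuous_det_of (p := p)).continuousAt
    rw [tendstoInMeasure_iff_norm] at hdet ⊢
    intro d hd
    refine tendsto_of_tendsto_of_tendsto_of_le_of_le tendsto_const_nhds
      (hdet |S.det| (abs_pos.2 hSdet)) (fun _ => zero_le) fun n => measure_mono fun ω hω => ?_
    simp only [Set.mem_ofPred_eq, Pi.sub_apply, Pi.zero_apply, sub_zero] at hω ⊢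
    by_contra! hlt
    have hGdet : (Matrix.of (G n ω)).det ≠ 0 := by
      intro h0
      rw [h0, zero_sub, norm_neg] at hlt
      exact lt_irrefl _ hlt
    refine absurd hω (not_le.2 ?_)
    convert! hd
    rw [norm_eq_zero, sub_eq_zero]
    have h4 : Matrix.of (invArray (G n ω)) = (Matrix.of (G n ω))⁻¹ := rfl
    have h5 : r n ω = √(n : ℝ) • ((fun j : Fin p => η n ((j : ℕ) + 1) ω) -
        Matrix.mulVec (Matrix.of (G n ω)) β.ofLp) := by
      funext j
      simp [hr, hG, Matrix.mulVec, dotProduct, mul_comm]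
    rw [h4, Matrix.mulVec_mulVec _ S, Matrix.mul_nonsing_inv _ (by simpa using hSdet),
      Matrix.one_mulVec, h5, Matrix.mulVec_smul, Matrix.mulVec_sub, Matrix.mulVec_mulVec,
      Matrix.nonsing_inv_mul _ (by simpa using hGdet), Matrix.one_mulVec, WithLp.toLp_smul,
      WithLp.toLp_sub]
  · have h4 : AEMeasurable (fun ω => (invArray (G n ω), fun j : Fin p => η n ((j : ℕ) + 1) ω)) P :=
      (measurable_invArray.comp_aemeasurable (hGm n)).prodMk
        (aemeasurable_pi_lambda _ fun j => hηm _ _)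
    have h5 : Continuous fun z : (Fin p → Fin p → ℝ) × (Fin p → ℝ) =>
        (WithLp.toLp 2 (Matrix.mulVec (Matrix.of z.1) z.2) : EuclideanSpace ℝ (Fin p)) :=
      (PiLp.continuous_toLp 2 _).comp (Continuous.matrix_mulVec
        (A := fun z : (Fin p → Fin p → ℝ) × (Fin p → ℝ) => Matrix.of z.1) continuous_fst
        continuous_snd)
    have h6 : AEMeasurable (fun ω => (WithLp.toLp 2 (Matrix.mulVec
        (Matrix.of fun j k : Fin p => η n ((j : ℤ) - (k : ℤ)).natAbs ω)⁻¹
        (fun j : Fin p => η n ((j : ℕ) + 1) ω)) : EuclideanSpace ℝ (Fin p))) P :=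
      h5.measurable.comp_aemeasurable h4
    exact (h6.sub_const β).const_smul (√(n : ℝ))

end YuleWalker

/-! ### The Yule-Walker estimator of an autoregression in a Hilbert space -/

section HilbertAutoregression

variable {Ω : Type*} [MeasurableSpace Ω] {P : Measure Ω} [IsProbabilityMeasure P]
  {H : Type*} [NormedAddCommGroup H] [InnerProductSpace ℝ H] [CompleteSpace H]
  [SecondCountableTopology H] [MeasurableSpace H] [BorelSpace H] {p : ℕ}

/-- The sample autocovariance, formed in `L²`, is the pointwise sample autocovariance. -/
lemma coeFn_sampleCov_innerL1 {V : ℤ → Ω → H} (hV : ∀ t, MemLp (V t) 2 P) (n h : ℕ) :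
    (sampleCov (innerL1 P) (fun t => (hV t).toLp (V t)) n h : Lp ℝ 1 P) =ᵐ[P] fun ω =>
      (n : ℝ)⁻¹ * ∑ t ∈ Finset.Icc 1 (n - h),
        inner ℝ (V t ω - (n : ℝ)⁻¹ • ∑ s ∈ Finset.Icc 1 n, V s ω)
          (V ((t : ℤ) + (h : ℤ)) ω - (n : ℝ)⁻¹ • ∑ s ∈ Finset.Icc 1 n, V s ω) := by
  set x : ℤ → Lp H 2 P := fun t => (hV t).toLp (V t) with hx
  have h1 : ∀ᵐ ω ∂P, ∀ t, x t ω = V t ω := ae_all_iff.2 fun t => (hV t).coeFn_toLp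
  have h2 : ((n : ℝ)⁻¹ • ∑ s ∈ Finset.Icc 1 n, x s : Lp H 2 P) =ᵐ[P]
      fun ω => (n : ℝ)⁻¹ • ∑ s ∈ Finset.Icc 1 n, V s ω :=
    coeFn_smul_sum _ _ (fun s : ℕ => (hV s).coeFn_toLp) _ _
  refine coeFn_smul_sum _ _ (fun t : ℕ => ?_) _ _
  filter_upwards [h1, h2, coeFn_innerL1 (x t - (n : ℝ)⁻¹ • ∑ s ∈ Finset.Icc 1 n, x s)
      (x ((t : ℤ) + (h : ℤ)) - (n : ℝ)⁻¹ • ∑ s ∈ Finset.Icc 1 n, x s),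
    Lp.coeFn_sub (x t) ((n : ℝ)⁻¹ • ∑ s ∈ Finset.Icc 1 n, x s : Lp H 2 P),
    Lp.coeFn_sub (x ((t : ℤ) + (h : ℤ))) ((n : ℝ)⁻¹ • ∑ s ∈ Finset.Icc 1 n, x s : Lp H 2 P)]
    with ω h1 h2 h3 h4 h5
  rw [h3, h4, h5, Pi.sub_apply, Pi.sub_apply, h1, h1, h2]

/-- Asymptotic normality of the Yule-Walker estimator of a real autoregression driven by Hilbert
space valued white noise. -/
theorem tendstoInDistribution_yuleWalker_hilbert (β : EuclideanSpace ℝ (Fin p))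
    (hβ : NoRootInUnitDisk β) {e V : ℤ → Ω → H} (he : IsWhiteNoise P e)
    (hτ : 0 < ∫ ω, ‖e 0 ω‖ ^ 2 ∂P) (hV : ∀ t, MemLp (V t) 2 P) {K : ℝ}
    (hK : ∀ t, eLpNorm (V t) 2 P ≤ ENNReal.ofReal K)
    (heq : ∀ t, ∀ᵐ ω ∂P, V t ω = ∑ j : Fin p, β j • V (t - ((j : ℤ) + 1)) ω + e t ω)
    (η : ℕ → ℕ → Ω → ℝ)
    (hη : ∀ n h, ∀ᵐ ω ∂P, η n h ω = (n : ℝ)⁻¹ * ∑ t ∈ Finset.Icc 1 (n - h),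
        inner ℝ (V t ω - (n : ℝ)⁻¹ • ∑ s ∈ Finset.Icc 1 n, V s ω)
          (V ((t : ℤ) + (h : ℤ)) ω - (n : ℝ)⁻¹ • ∑ s ∈ Finset.Icc 1 n, V s ω)) :
    TendstoInDistribution
      (fun (n : ℕ) (ω : Ω) => √(n : ℝ) • ((WithLp.toLp 2 (Matrix.mulVec
        (Matrix.of fun j k : Fin p => η n ((j : ℤ) - (k : ℤ)).natAbs ω)⁻¹
        (fun j : Fin p => η n ((j : ℕ) + 1) ω)) : EuclideanSpace ℝ (Fin p)) - β))
      atTop id (fun _ => P) (multivariateGaussian 0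
        ((noiseVar P e / (∫ ω, ‖e 0 ω‖ ^ 2 ∂P) ^ 2) • (psiMatrix β)⁻¹)) := by
  set x : ℤ → Lp H 2 P := fun t => (hV t).toLp (V t) with hx
  have hK' : ∀ t, ‖x t‖ ≤ max K 0 := fun t => by
    rw [Lp.norm_toLp]
    refine (ENNReal.toReal_mono ENNReal.ofReal_ne_top (hK t)).trans ?_
    rw [ENNReal.toReal_ofReal']
  have hxeq : ∀ t, x t = ∑ j : Fin p, β j • x (t - ((j : ℤ) + 1)) + he.toLp t := by
    intro t
    refine Lp.ext ?_
    have h1 : ∀ᵐ ω ∂P, ∀ s, x s ω = V s ω := ae_all_iff.2 fun s => (hV s).coeFn_toLp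
    have h2 := coeFn_smul_sum (P := P) (fun j : Fin p => β j • x (t - ((j : ℤ) + 1)))
      (fun j ω => β j • V (t - ((j : ℤ) + 1)) ω) (fun j => by
        filter_upwards [h1, Lp.coeFn_smul (β j) (x (t - ((j : ℤ) + 1)))] with ω h3 h4
        rw [h4, Pi.smul_apply, h3]) 1 Finset.univ
    rw [one_smul] at h2
    filter_upwards [h1, h2, heq t, he.coeFn_toLp t,
      Lp.coeFn_add (∑ j : Fin p, β j • x (t - ((j : ℤ) + 1))) (he.toLp t)] with ω a1 a2 a3 a4 a5
    rw [a1, a5, Pi.add_apply, a2, a4, a3, one_smul]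
  obtain ⟨C, -, hC⟩ := exists_norm_sum_le β hβ x he.toLp hxeq hK' he.norm_sum_toLp_le
  have hlin := isLinearProcess_psi β hβ x he.toLp hxeq _ hK'
  have hη' : ∀ n h, η n h =ᵐ[P] (sampleCov (innerL1 P) x n h : Lp ℝ 1 P) := fun n h =>
    EventuallyEq.trans (hη n h) (coeFn_sampleCov_innerL1 hV n h).symm
  have hcov := tendsto_sampleCov β hβ (innerL1 (H := H) P) innerL1_comm hlin hK' hC _
    he.tendsto_average_innerL1
  refine tendstoInDistribution_yuleWalker β (psiMatrix β) (posDef_psiMatrix β hβ) hτ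
    (integral_nonneg fun _ => sq_nonneg _) (fun n h => sampleCov (innerL1 P) x n h)
    (fun n j => (√(n : ℝ))⁻¹ • ∑ t ∈ Finset.Icc 1 n,
      innerL1 P (x ((t : ℤ) - 1 - (j : ℕ))) (he.toLp t)) η hη' hcov
    (fun j => ?_) fun a => ?_
  · obtain ⟨M, hM⟩ :=
      exists_norm_residual_sub_le β (innerL1 (H := H) P) innerL1_comm x he.toLp hxeq hK' hC j
    have h1 : Tendsto (fun n : ℕ => (√(n : ℝ))⁻¹ * M) atTop (𝓝 (0 * M)) :=
      ((Real.tendsto_sqrt_atTop.comp tendsto_natCast_atTop_atTop).inv_tendsto_atTop).mul_const M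
    rw [zero_mul] at h1
    refine squeeze_zero_norm' ?_ h1
    filter_upwards [eventually_gt_atTop 0] with n hn
    have hn0 : 0 < √(n : ℝ) := Real.sqrt_pos.2 (by exact_mod_cast hn)
    have h2 : √(n : ℝ) = (√(n : ℝ))⁻¹ * n := by
      rw [eq_inv_mul_iff_mul_eq₀ hn0.ne', Real.mul_self_sqrt (Nat.cast_nonneg n)]
    nth_rw 1 [h2]
    rw [mul_smul, ← smul_sub, norm_smul, Real.norm_of_nonneg (inv_nonneg.2 hn0.le)]
    exact mul_le_mul_of_nonneg_left (hM n) (inv_nonneg.2 hn0.le)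
  · -- by linearity, the combination with weights `a` is driven by one filtered process
    have h1 := summable_abs_filterCoeff β hβ a
    have h2 : Summable fun l => filterCoeff β a l ^ 2 := by
      simpa only [sq] using summable_mul_of_summable_abs h1 h1
    have h3 := he.tendsto_integral_cexp_innerL1 _ h2 _ (hlin.filter a)
    rw [dotProduct_psiMatrix_mulVec β hβ]
    refine h3.congr fun n => ?_
    have h4 : (√(n : ℝ))⁻¹ • ∑ t ∈ Finset.Icc 1 n,
        innerL1 P (∑ j : Fin p, a j • x ((t : ℤ) - 1 - (j : ℕ))) (he.toLp t) =
        ∑ j : Fin p, a j • (√(n : ℝ))⁻¹ • ∑ t ∈ Finset.Icc 1 n,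
          innerL1 P (x ((t : ℤ) - 1 - (j : ℕ))) (he.toLp t) := by
      simp_rw [smul_comm (a _) (√(n : ℝ))⁻¹, ← Finset.smul_sum]
      congr 1
      simp_rw [Finset.smul_sum]
      rw [Finset.sum_comm]
      refine Finset.sum_congr rfl fun t _ => ?_
      rw [map_sum, sum_apply]
      refine Finset.sum_congr rfl fun j _ => ?_
      rw [map_smul, smul_apply]
    rw [h4]

end HilbertAutoregression

/-! ### Distributions on an interval and increasing transport maps -/

section Interval

variable {μ : Measure ℝ} [IsProbabilityMeasure μ]

/-- The endpoints of the support carry no mass. -/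
lemma ae_mem_interior_support (hac : μ ≪ volume) (hs : μ.support.OrdConnected) :
    ∀ᵐ u ∂μ, u ∈ interior μ.support := by
  have h1 : ∀ᵐ u ∂μ, u ∉ frontier μ.support :=
    hac.ae_le (measure_eq_zero_iff_ae_notMem.1 (hs.convex.addHaar_frontier volume))
  filter_upwards [Measure.support_mem_ae, h1] with u h2 h3
  by_contra h4
  exact h3 ⟨subset_closure h2, h4⟩

lemma ordConnected_interior_support (hs : μ.support.OrdConnected) :
    (interior μ.support).OrdConnected := hs.convex.interior.ordConnected

lemma continuous_cdf (hac : μ ≪ volume) : Continuous (cdf μ) := by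
  refine continuous_iff_continuousAt.2 fun x => ?_
  rw [(monotone_cdf μ).continuousAt_iff_leftLim_eq_rightLim, StieltjesFunction.rightLim_eq]
  have h1 : μ {x} = 0 := hac (measure_singleton x)
  rw [← measure_cdf μ, StieltjesFunction.measure_singleton, ENNReal.ofReal_eq_zero] at h1
  exact le_antisymm ((monotone_cdf μ).leftLim_le le_rfl) (by linarith)

lemma cdf_strictMonoOn : StrictMonoOn (cdf μ) (interior μ.support) := by
  intro x _ y hy hxy
  have h1 : 0 < μ (Set.Ioc x y) := by
    obtain ⟨z, hz, hzs⟩ : (Set.Ioo x y ∩ interior μ.support).Nonempty := by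
      have h2 : y ∈ closure (Set.Ioo x y) := by
        rw [closure_Ioo hxy.ne]; exact Set.right_mem_Icc.2 hxy.le
      exact mem_closure_iff.1 h2 _ isOpen_interior hy |>.mono fun z hz => ⟨hz.2, hz.1⟩
    exact (Measure.mem_support_iff_forall z).1 (interior_subset hzs) _
      (mem_of_superset (isOpen_Ioo.mem_nhds hz) Set.Ioo_subset_Ioc_self)
  rw [← measure_cdf μ, StieltjesFunction.measure_Ioc, ENNReal.ofReal_pos] at h1
  linarith

lemma cdf_mem_Ioo {y : ℝ} (hy : y ∈ interior μ.support) : cdf μ y ∈ Set.Ioo (0 : ℝ) 1 := by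
  obtain ⟨l, hl, u, hu, hsub⟩ : ∃ l < y, ∃ u > y, Set.Ioo l u ⊆ interior μ.support := by
    obtain ⟨l, u, h, hsub⟩ := mem_nhds_iff_exists_Ioo_subset.1 (isOpen_interior.mem_nhds hy)
    exact ⟨l, h.1, u, h.2, hsub⟩
  have h1 : (l + y) / 2 ∈ interior μ.support := hsub ⟨by linarith, by linarith⟩
  have h2 : (u + y) / 2 ∈ interior μ.support := hsub ⟨by linarith, by linarith⟩
  exact ⟨(cdf_nonneg μ _).trans_lt (cdf_strictMonoOn h1 hy (by linarith)),
    (cdf_strictMonoOn hy h2 (by linarith)).trans_le (cdf_le_one μ _)⟩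

/-- On the interior of the support, `F` is onto `(0, 1)`. -/
lemma exists_cdf_eq (hac : μ ≪ volume) (hs : μ.support.OrdConnected) {s : ℝ}
    (h0 : 0 < s) (h1 : s < 1) : ∃ y ∈ interior μ.support, cdf μ y = s := by
  obtain ⟨y, rfl⟩ := mem_range_of_exists_le_of_exists_ge (continuous_cdf hac)
    ((tendsto_cdf_atBot μ).eventually_le_const h0).exists
    ((tendsto_cdf_atTop μ).eventually_const_le h1).exists
  refine ⟨y, ?_, rfl⟩
  by_contra hy
  have hI := ae_mem_interior_support hac hs
  have hoc := ordConnected_interior_support hs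
  by_cases hlt : ∃ z ∈ interior μ.support, z ≤ y
  · -- the interval lies below `y`, which then carries all the mass
    obtain ⟨z, hz, hzy⟩ := hlt
    have h2 : μ (Set.Iic y)ᶜ = 0 := by
      rw [measure_eq_zero_iff_ae_notMem]
      filter_upwards [hI] with u hu hu'
      exact hy (hoc.out hz hu ⟨hzy, le_of_lt (by simpa using hu')⟩)
    have h3 : μ (Set.Iic y) = 1 := (prob_compl_eq_zero_iff measurableSet_Iic).1 h2
    rw [cdf_eq_real, measureReal_def, h3] at h1
    simp at h1
  · push Not at hlt
    have h2 : μ (Set.Iic y) = 0 := by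
      rw [measure_eq_zero_iff_ae_notMem]
      filter_upwards [hI] with u hu hu'
      exact absurd hu' (not_le.2 (hlt u hu))
    rw [cdf_eq_real, measureReal_def, h2] at h0
    simp at h0

lemma cdf_map {T : ℝ → ℝ} (hT : AEMeasurable T μ) (x : ℝ) :
    cdf (μ.map T) x = μ.real {u | T u ≤ x} := by
  have := Measure.isProbabilityMeasure_map hT
  rw [cdf_eq_real, measureReal_def, Measure.map_apply_of_aemeasurable hT measurableSet_Iic]
  rfl

/-- The quantile function of the image of `μ` under an increasing map `T` is `T ∘ F⁻¹`. -/
lemma quantile_map_cdf (hac : μ ≪ volume) (hs : μ.support.OrdConnected) {T : ℝ → ℝ}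
    (hTm : AEMeasurable T μ) (hT : StrictMonoOn T (interior μ.support))
    (hTc : ContinuousOn T (interior μ.support)) {y : ℝ} (hy : y ∈ interior μ.support) :
    quantile (μ.map T) (cdf μ y) = T y := by
  have hI := ae_mem_interior_support hac hs
  have hcdf : ∀ z ∈ interior μ.support, cdf (μ.map T) (T z) = cdf μ z := by
    intro z hz
    rw [cdf_map hTm, cdf_eq_real]
    refine measureReal_congr ?_
    filter_upwards [hI] with u hu
    exact propext (hT.le_iff_le hu hz)
  refine IsLeast.csInf_eq ⟨(hcdf y hy).ge, fun x hx => ?_⟩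
  by_contra! hlt
  have h1 : ∀ᶠ z in 𝓝 y, x < T z ∧ z ∈ interior μ.support :=
    ((hTc.continuousAt (isOpen_interior.mem_nhds hy)).eventually_const_lt hlt).and
      (isOpen_interior.mem_nhds hy)
  obtain ⟨z, hzy, hz⟩ : ∃ z < y, x < T z ∧ z ∈ interior μ.support := by
    obtain ⟨l, hl, h2⟩ := exists_Ioc_subset_of_mem_nhds h1 (exists_lt y)
    exact ⟨(l + y) / 2, by linarith, h2 ⟨by linarith, by linarith⟩⟩
  have h2 : cdf (μ.map T) x ≤ cdf μ z := (hcdf z hz.2) ▸ monotone_cdf _ hz.1.le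
  exact absurd (hx.trans h2) (not_le.2 (cdf_strictMonoOn hz.2 hy hzy))

/-- The generalized inverse of the quantile function `T ∘ F⁻¹` is the cdf of the image of `μ`
under `T`. -/
lemma sSup_quantile_le_eq_cdf_map (hac : μ ≪ volume) (hs : μ.support.OrdConnected) {T q : ℝ → ℝ}
    (hTm : AEMeasurable T μ) (hT : StrictMonoOn T (interior μ.support))
    (hq : ∀ y ∈ interior μ.support, q (cdf μ y) = T y) (x : ℝ) :
    sSup {s : ℝ | 0 < s ∧ s < 1 ∧ q s ≤ x} = cdf (μ.map T) x := by
  have hI := ae_mem_interior_support hac hs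
  set A : Set ℝ := {u | u ∈ interior μ.support ∧ T u ≤ x} with hA
  have hμA : cdf (μ.map T) x = μ.real A := by
    rw [cdf_map hTm]
    refine measureReal_congr ?_
    filter_upwards [hI] with u hu
    exact propext ⟨fun h => ⟨hu, h⟩, fun h => h.2⟩
  have hset : {s : ℝ | 0 < s ∧ s < 1 ∧ q s ≤ x} = cdf μ '' A := by
    ext s
    constructor
    · rintro ⟨h0, h1, h2⟩
      obtain ⟨y, hy, rfl⟩ := exists_cdf_eq hac hs h0 h1
      exact ⟨y, ⟨hy, hq y hy ▸ h2⟩, rfl⟩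
    · rintro ⟨y, ⟨hy, hyx⟩, rfl⟩
      exact ⟨(cdf_mem_Ioo hy).1, (cdf_mem_Ioo hy).2, (hq y hy).trans_le hyx⟩
  -- `A` is an initial segment of the interval, and `μ(A)` is the supremum of `F` over it
  rw [hμA, hset]
  rcases A.eq_empty_or_nonempty with hem | hne
  · simp [hem]
  refine csSup_eq_of_forall_le_of_forall_lt_exists_gt (hne.image _) ?_ fun w hw => ?_
  · rintro _ ⟨y, hy, rfl⟩
    rw [cdf_eq_real]
    refine ENNReal.toReal_mono (measure_ne_top _ _) (measure_mono_ae ?_)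
    filter_upwards [hI] with u hu hu'
    exact ⟨hu, (hT.monotoneOn hu hy.1 hu').trans hy.2⟩
  · rcases lt_or_ge w 0 with hw0 | hw0
    · obtain ⟨y, hy⟩ := hne
      exact ⟨_, ⟨y, hy, rfl⟩, hw0.trans (cdf_mem_Ioo hy.1).1⟩
    · obtain ⟨s, hws, hsA⟩ := exists_between hw
      obtain ⟨y, hy, rfl⟩ := exists_cdf_eq hac hs (hw0.trans_lt hws)
        (hsA.trans_le measureReal_le_one)
      refine ⟨_, ⟨y, ⟨hy, ?_⟩, rfl⟩, hws⟩
      by_contra! hyx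
      refine absurd hsA (not_lt.2 ?_)
      rw [cdf_eq_real]
      refine measureReal_mono fun u hu => ?_
      exact (hT.lt_iff_lt hu.1 hy).1 (hu.2.trans_lt hyx) |>.le

/-- The image of an absolutely continuous distribution on an interval under a map with positive
derivative is absolutely continuous. -/
lemma map_absolutelyContinuous (hac : μ ≪ volume) (hs : μ.support.OrdConnected) {T : ℝ → ℝ}
    (hTm : AEMeasurable T μ) (hT : StrictMonoOn T (interior μ.support))
    (hTd : ∀ u ∈ interior μ.support, DifferentiableAt ℝ T u ∧ 0 < deriv T u) :
    μ.map T ≪ volume := by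
  have hI := ae_mem_interior_support hac hs
  refine Measure.AbsolutelyContinuous.mk fun N hN hN0 => ?_
  rw [Measure.map_apply_of_aemeasurable hTm hN]
  have hTc : ContinuousOn T (interior μ.support) := fun u hu =>
    (hTd u hu).1.continuousAt.continuousWithinAt
  have hS : MeasurableSet (interior μ.support ∩ T ⁻¹' N) := by
    have h := MeasurableSet.subtype_image isOpen_interior.measurableSet
      ((continuousOn_iff_continuous_domRestrict.1 hTc).measurable hN)
    convert! h using 1
    ext u
    simp [and_comm]
  -- by the change of variables formula `T'` integrates to `0` over the preimage of a null set
  have h1 : ∫⁻ u in interior μ.support ∩ T ⁻¹' N, ENNReal.ofReal (deriv T u) = 0 := by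
    rw [lintegral_deriv_eq_volume_image_of_monotoneOn hS (fun u hu =>
      (hTd u hu.1).1.hasDerivAt.hasDerivWithinAt) (hT.monotoneOn.mono Set.inter_subset_left)]
    exact measure_mono_null (by rintro _ ⟨u, hu, rfl⟩; exact hu.2) hN0
  have h2 : volume (interior μ.support ∩ T ⁻¹' N) = 0 := by
    rw [lintegral_eq_zero_iff (measurable_deriv T).ennreal_ofReal] at h1
    by_contra h3
    have h4 := (ae_restrict_iff' hS).1 h1
    refine h3 (measure_eq_zero_iff_ae_notMem.2 ?_)
    filter_upwards [h4] with u hu hmem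
    have := hu hmem
    simp only [Pi.zero_apply, ENNReal.ofReal_eq_zero] at this
    exact absurd (hTd u hmem.1).2 (not_lt.2 this)
  refine measure_mono_null_ae ?_ (hac h2)
  filter_upwards [hI] with u hu hu'
  exact ⟨hu, hu'⟩

end Interval

/-! ### The estimated autocovariances are sample autocovariances in the tangent space -/

section Estimators

variable {μ : Measure ℝ} [IsProbabilityMeasure μ]

lemma strictMonoOn_add_id (hs : μ.support.OrdConnected) {g : ℝ → ℝ}
    (hg : ∀ u ∈ interior μ.support, DifferentiableAt ℝ g u ∧ -1 < deriv g u) :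
    StrictMonoOn (fun u => g u + u) (interior μ.support) := by
  refine strictMonoOn_of_deriv_pos (ordConnected_interior_support hs).convex
    (fun u hu => ((hg u hu).1.continuousAt.add continuousAt_id).continuousWithinAt) fun u hu => ?_
  have hu' := interior_subset hu
  have h : HasDerivAt (fun u => g u + u) (deriv g u + 1) u :=
    (hg u hu').1.hasDerivAt.add (hasDerivAt_id u)
  rw [h.deriv]
  linarith [(hg u hu').2]

/-- If the observed distributions are the images of `μ` under `V_t + id`, where `V_t` has a version
with derivative greater than `-1`, then the integrated lag-`h` autocovariance estimator is the
sample autocovariance of `V_1, …, V_n` in `L²(μ)`. -/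
lemma etaInt_quantile_expMap (hac : μ ≪ volume) (hs : μ.support.OrdConnected)
    (V : ℤ → Lp ℝ 2 μ)
    (hV : ∀ t, ∃ g : ℝ → ℝ, g =ᵐ[μ] V t ∧
      ∀ u ∈ interior μ.support, DifferentiableAt ℝ g u ∧ -1 < deriv g u) (n h : ℕ) :
    etaInt (fun t => quantile (expMap μ (V t))) n h =
      (n : ℝ)⁻¹ * ∑ t ∈ Finset.Icc 1 (n - h),
        inner ℝ (V t - (n : ℝ)⁻¹ • ∑ s ∈ Finset.Icc 1 n, V s)
          (V ((t : ℤ) + (h : ℤ)) - (n : ℝ)⁻¹ • ∑ s ∈ Finset.Icc 1 n, V s) := by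
  rcases n.eq_zero_or_pos with rfl | hn
  · -- both sides have the factor `0⁻¹ = 0`
    simp [etaInt, etaEst]
  have hn0 : (n : ℝ) ≠ 0 := by positivity
  have hn1 : (0 : ℝ) < (n : ℝ)⁻¹ := by positivity
  choose g hgV hg using hV
  have hI := ae_mem_interior_support hac hs
  set Q : ℤ → ℝ → ℝ := fun t => quantile (expMap μ (V t)) with hQ
  set T : ℤ → ℝ → ℝ := fun t u => g t u + u with hT
  have hgm : ∀ t, AEMeasurable (g t) μ := fun t =>
    (Lp.aestronglyMeasurable (V t)).aemeasurable.congr (hgV t).symm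
  have hTm : ∀ t, AEMeasurable (T t) μ := fun t => (hgm t).add aemeasurable_id
  have hTmono : ∀ t, StrictMonoOn (T t) (interior μ.support) := fun t =>
    strictMonoOn_add_id hs (hg t)
  have hTc : ∀ t, ContinuousOn (T t) (interior μ.support) := fun t u hu =>
    ((hg t u hu).1.continuousAt.add continuousAt_id).continuousWithinAt
  have hQT : ∀ t, ∀ y ∈ interior μ.support, Q t (cdf μ y) = T t y := by
    intro t y hy
    have h1 : expMap μ (V t) = μ.map (T t) := by
      refine Measure.map_congr ?_
      filter_upwards [hgV t] with u hu
      simp only [hT, hu]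
    simp only [hQ]
    rw [h1, quantile_map_cdf hac hs (hTm t) (hTmono t) (hTc t) hy]
  -- the transport map to the estimated mean
  set G : ℝ → ℝ := fun u => (n : ℝ)⁻¹ * ∑ t ∈ Finset.Icc 1 n, g t u with hG
  set M : ℝ → ℝ := fun u => G u + u with hM
  have hGd : ∀ u ∈ interior μ.support, DifferentiableAt ℝ G u ∧ -1 < deriv G u := by
    intro u hu
    have h1 : HasDerivAt G ((n : ℝ)⁻¹ * ∑ t ∈ Finset.Icc 1 n, deriv (g t) u) u :=
      (HasDerivAt.fun_sum fun (t : ℕ) _ => (hg t u hu).1.hasDerivAt).const_mul _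
    refine ⟨h1.differentiableAt, ?_⟩
    rw [h1.deriv, ← div_eq_inv_mul, lt_div_iff₀ (by positivity)]
    have h2 : ∑ t ∈ Finset.Icc 1 n, (-1 : ℝ) < ∑ t ∈ Finset.Icc 1 n, deriv (g t) u :=
      Finset.sum_lt_sum_of_nonempty (Finset.nonempty_Icc.2 hn) fun t _ => (hg t u hu).2
    simpa using h2
  have hGm : AEMeasurable G μ := (Finset.aemeasurable_fun_sum _ fun (t : ℕ) _ => hgm t).const_mul _
  have hMm : AEMeasurable M μ := hGm.add aemeasurable_id
  have hMmono : StrictMonoOn M (interior μ.support) := strictMonoOn_add_id hs hGd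
  have hMd : ∀ u ∈ interior μ.support, DifferentiableAt ℝ M u ∧ 0 < deriv M u := by
    intro u hu
    have h1 : HasDerivAt M (deriv G u + 1) u := (hGd u hu).1.hasDerivAt.add (hasDerivAt_id u)
    exact ⟨h1.differentiableAt, by rw [h1.deriv]; linarith [(hGd u hu).2]⟩
  have hprob : IsProbabilityMeasure (μ.map M) := Measure.isProbabilityMeasure_map hMm
  have hMQ : ∀ y ∈ interior μ.support, meanQuantile Q n (cdf μ y) = M y := by
    intro y hy
    simp only [meanQuantile, hQT _ y hy, hT, hM, hG, Finset.sum_add_distrib, mul_add]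
    simp [hn0]
  have hcdf : meanCdf Q n = cdf (μ.map M) := funext fun x =>
    sSup_quantile_le_eq_cdf_map hac hs hMm hMmono hMQ x
  have hcdfM : ∀ y ∈ interior μ.support, cdf (μ.map M) (M y) = cdf μ y := by
    intro z hz
    rw [cdf_map hMm, cdf_eq_real]
    refine measureReal_congr ?_
    filter_upwards [hI] with u hu
    exact propext (hMmono.le_iff_le hu hz)
  have htr : ∀ t, ∀ y ∈ interior μ.support, transportEst Q n t (M y) = T t y := by
    intro t y hy
    rw [transportEst, hcdf, hcdfM y hy, hQT t y hy]
  -- the estimated density is that of the image of `μ`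
  have hdens : ∀ᵐ u : ℝ, meanDensity Q n u = ((μ.map M).rnDeriv volume u).toReal := by
    have h1 := StieltjesFunction.ae_hasDerivAt (cdf (μ.map M))
    rw [measure_cdf] at h1
    filter_upwards [h1] with u hu
    rw [meanDensity, hcdf, hu.deriv]
  -- on the image of the interval the estimated maps are monotone, hence measurable
  have hJoc : (M '' interior μ.support).OrdConnected := by
    refine IsPreconnected.ordConnected ?_
    exact (ordConnected_interior_support hs).isPreconnected.image M fun u hu =>
      (hMd u hu).1.continuousAt.continuousWithinAt
  have hJ : (μ.map M).restrict (M '' interior μ.support) = μ.map M := by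
    refine Measure.restrict_eq_self_of_ae_mem ?_
    refine (ae_map_iff hMm hJoc.measurableSet).2 ?_
    filter_upwards [hI] with u hu
    exact ⟨u, hu, rfl⟩
  have htrm : ∀ t, AEMeasurable (transportEst Q n t) (μ.map M) := by
    intro t
    rw [← hJ]
    refine aemeasurable_restrict_of_monotoneOn hJoc.measurableSet ?_
    rintro _ ⟨y, hy, rfl⟩ _ ⟨z, hz, rfl⟩ hyz
    rw [htr t y hy, htr t z hz]
    exact (hTmono t).monotoneOn hy hz ((hMmono.le_iff_le hy hz).1 hyz)
  have hetam : AEStronglyMeasurable (etaEst Q n h) (μ.map M) := by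
    refine AEMeasurable.aestronglyMeasurable ?_
    refine (Finset.aemeasurable_fun_sum _ fun (t : ℕ) _ => ?_).const_mul _
    exact ((htrm _).sub aemeasurable_id).mul ((htrm _).sub aemeasurable_id)
  have h1 : etaInt Q n h = ∫ u, etaEst Q n h (M u) ∂μ := by
    rw [← integral_map hMm hetam,
      ← integral_toReal_rnDeriv_mul (map_absolutelyContinuous hac hs hMm hMmono hMd), etaInt]
    refine integral_congr_ae ?_
    filter_upwards [hdens] with u hu
    rw [hu, mul_comm]
  -- back to `L²(μ)`: the identity cancels in `T t - M = g t - G`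
  set W : Lp ℝ 2 μ := (n : ℝ)⁻¹ • ∑ s ∈ Finset.Icc 1 n, V s with hW
  have hWae : W =ᵐ[μ] G := coeFn_smul_sum (fun s : ℕ => V s) (fun s : ℕ => g s)
    (fun s => (hgV s).symm) _ _
  have hVW : ∀ t, (V t - W : Lp ℝ 2 μ) =ᵐ[μ] fun u => g t u - G u := fun t => by
    filter_upwards [Lp.coeFn_sub (V t) W, hWae, hgV t] with u a1 a2 a3
    rw [a1, Pi.sub_apply, a2, a3]
  have hinner : ∀ s t, inner ℝ (V s - W) (V t - W) =
      ∫ u, (g s u - G u) * (g t u - G u) ∂μ := fun s t => by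
    rw [L2.inner_def]
    refine integral_congr_ae ?_
    filter_upwards [hVW s, hVW t] with u a1 a2
    rw [a1, a2, RCLike.inner_apply, conj_trivial, mul_comm]
  have hint : ∀ s t, Integrable (fun u => (g s u - G u) * (g t u - G u)) μ := fun s t => by
    refine (L2.integrable_inner (𝕜 := ℝ) (V s - W) (V t - W)).congr ?_
    filter_upwards [hVW s, hVW t] with u a1 a2
    rw [a1, a2, RCLike.inner_apply, conj_trivial, mul_comm]
  simp_rw [hinner]
  rw [h1, ← integral_finsetSum _ fun t _ => hint _ _, ← integral_const_mul]
  refine integral_congr_ae ?_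
  filter_upwards [hI] with u hu
  simp only [etaEst, htr _ u hu]
  simp only [hT, hM, add_sub_add_right_eq_sub]

end Estimators

/-! ### Square integrable processes as random elements of `L²(μ)` -/

section RandomFunctions

variable {Ω : Type*} [MeasurableSpace Ω] {P : Measure Ω} [IsProbabilityMeasure P]
  {μ : Measure ℝ} [IsProbabilityMeasure μ] {X : Ω → ℝ → ℝ}

lemma covKernel_eq_integral_mul {u v : ℝ} (hu : ∫ ω, X ω u ∂P = 0) (hv : ∫ ω, X ω v ∂P = 0) :
    covKernel P X u v = ∫ ω, X ω u * X ω v ∂P := by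
  simp [covKernel, covariance, hu, hv]

lemma coeFn_toL2 {g : ℝ → ℝ} (hg : MemLp g 2 μ) : toL2 μ g =ᵐ[μ] g := by
  rw [toL2, dif_pos hg]
  exact hg.coeFn_toLp

/-- A jointly measurable, centred process with integrable variance function is square integrable
with respect to the product measure. -/
lemma memLp_uncurry (hXm : Measurable (Function.uncurry X))
    (h2 : ∀ᵐ u ∂μ, MemLp (fun ω => X ω u) 2 P) (h0 : ∀ᵐ u ∂μ, ∫ ω, X ω u ∂P = 0)
    (hC : Integrable (fun u => covKernel P X u u) μ) :
    MemLp (Function.uncurry X) 2 (P.prod μ) := by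
  rw [memLp_two_iff_integrable_sq hXm.aestronglyMeasurable,
    integrable_prod_iff' (hXm.pow_const 2).aestronglyMeasurable]
  refine ⟨h2.mono fun u hu => hu.integrable_sq, hC.congr ?_⟩
  filter_upwards [h0] with u hu
  rw [covKernel_eq_integral_mul hu hu]
  refine integral_congr_ae (Eventually.of_forall fun ω => ?_)
  simp [Function.uncurry, sq]

lemma ae_memLp_of_memLp_uncurry (hX : MemLp (Function.uncurry X) 2 (P.prod μ))
    (hXm : Measurable (Function.uncurry X)) : ∀ᵐ ω ∂P, MemLp (X ω) 2 μ := by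
  filter_upwards [hX.integrable_sq.prod_right_ae] with ω hω
  exact (memLp_two_iff_integrable_sq (hXm.of_uncurry_left).aestronglyMeasurable).2 hω

lemma inner_toL2 {f g : ℝ → ℝ} (hf : MemLp f 2 μ) (hg : MemLp g 2 μ) :
    inner ℝ (toL2 μ f) (toL2 μ g) = ∫ u, f u * g u ∂μ := by
  rw [L2.inner_def]
  refine integral_congr_ae ?_
  filter_upwards [coeFn_toL2 hf, coeFn_toL2 hg] with u a1 a2
  rw [a1, a2, RCLike.inner_apply, conj_trivial, mul_comm]

lemma integral_norm_sq_toL2 (hX : MemLp (Function.uncurry X) 2 (P.prod μ))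
    (hXm : Measurable (Function.uncurry X)) (h0 : ∀ᵐ u ∂μ, ∫ ω, X ω u ∂P = 0) :
    Integrable (fun ω => ‖toL2 μ (X ω)‖ ^ 2) P ∧
      ∫ ω, ‖toL2 μ (X ω)‖ ^ 2 ∂P = ∫ u, covKernel P X u u ∂μ := by
  have hsq : Integrable (fun q : Ω × ℝ => X q.1 q.2 * X q.1 q.2) (P.prod μ) := by
    have h := hX.integrable_sq
    simp only [sq] at h
    exact h
  have h1 : (fun ω => ‖toL2 μ (X ω)‖ ^ 2) =ᵐ[P] fun ω => ∫ u, X ω u * X ω u ∂μ := by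
    filter_upwards [ae_memLp_of_memLp_uncurry hX hXm] with ω hω
    rw [← real_inner_self_eq_norm_sq, inner_toL2 hω hω]
  refine ⟨hsq.integral_prod_left.congr h1.symm, ?_⟩
  rw [integral_congr_ae h1, integral_integral_swap hsq]
  refine integral_congr_ae ?_
  filter_upwards [h0] with u hu
  rw [covKernel_eq_integral_mul hu hu]

lemma integral_toL2_eq_zero (hX : MemLp (Function.uncurry X) 2 (P.prod μ))
    (hXm : Measurable (Function.uncurry X)) (h0 : ∀ᵐ u ∂μ, ∫ ω, X ω u ∂P = 0)
    (hint : Integrable (fun ω => toL2 μ (X ω)) P) : ∫ ω, toL2 μ (X ω) ∂P = 0 := by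
  refine ext_inner_left ℝ fun f => ?_
  rw [← integral_inner hint, inner_zero_right]
  have hf : MemLp (fun q : Ω × ℝ => f q.2) 2 (P.prod μ) :=
    (Lp.memLp f).comp_measurePreserving measurePreserving_snd
  have hfX : Integrable (fun q : Ω × ℝ => f q.2 * X q.1 q.2) (P.prod μ) := hf.integrable_mul hX
  have h1 : (fun ω => inner ℝ f (toL2 μ (X ω))) =ᵐ[P] fun ω => ∫ u, f u * X ω u ∂μ := by
    filter_upwards [ae_memLp_of_memLp_uncurry hX hXm] with ω hω
    rw [L2.inner_def]
    refine integral_congr_ae ?_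
    filter_upwards [coeFn_toL2 hω] with u a1
    rw [a1, RCLike.inner_apply, conj_trivial, mul_comm]
  rw [integral_congr_ae h1, integral_integral_swap hfX]
  refine integral_eq_zero_of_ae ?_
  filter_upwards [h0] with u hu
  rw [integral_const_mul, hu, mul_zero, Pi.zero_apply]

/-- The product `X_ω(u) X_ω(v) X_ω'(u) X_ω'(v)` is integrable: it is dominated by
`(X_ω(u) X_ω'(v))² + (X_ω(v) X_ω'(u))²`. -/
lemma integrable_mul_four (hX : MemLp (Function.uncurry X) 2 (P.prod μ))
    (hXm : Measurable (Function.uncurry X)) :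
    Integrable (fun q : (Ω × Ω) × (ℝ × ℝ) => (X q.1.1 q.2.1 * X q.1.1 q.2.2) *
      (X q.1.2 q.2.1 * X q.1.2 q.2.2)) ((P.prod P).prod (μ.prod μ)) := by
  have hm : ∀ {a : (Ω × Ω) × (ℝ × ℝ) → Ω} {b : (Ω × Ω) × (ℝ × ℝ) → ℝ}, Measurable a →
      Measurable b → Measurable fun q => X (a q) (b q) := fun ha hb => hXm.comp (ha.prodMk hb)
  have m11 := hm (a := fun q => q.1.1) (b := fun q => q.2.1) (by fun_prop) (by fun_prop)
  have m12 := hm (a := fun q => q.1.1) (b := fun q => q.2.2) (by fun_prop) (by fun_prop)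
  have m21 := hm (a := fun q => q.1.2) (b := fun q => q.2.1) (by fun_prop) (by fun_prop)
  have m22 := hm (a := fun q => q.1.2) (b := fun q => q.2.2) (by fun_prop) (by fun_prop)
  have hsq : Integrable (fun q : Ω × ℝ => X q.1 q.2 ^ 2) (P.prod μ) := hX.integrable_sq
  have hae : ∀ᵐ w ∂(μ.prod μ), Integrable (fun ω => X ω w.1 ^ 2) P ∧
      Integrable (fun ω => X ω w.2 ^ 2) P :=
    (Measure.quasiMeasurePreserving_fst.ae hsq.prod_left_ae).and
      (Measure.quasiMeasurePreserving_snd.ae hsq.prod_left_ae)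
  have hA := hsq.integral_prod_right
  have h1 : Integrable (fun q : (Ω × Ω) × (ℝ × ℝ) => X q.1.1 q.2.1 ^ 2 * X q.1.2 q.2.2 ^ 2)
      ((P.prod P).prod (μ.prod μ)) := by
    have hs : AEStronglyMeasurable (fun q : (Ω × Ω) × (ℝ × ℝ) =>
        X q.1.1 q.2.1 ^ 2 * X q.1.2 q.2.2 ^ 2) ((P.prod P).prod (μ.prod μ)) :=
      ((m11.pow_const 2).mul (m22.pow_const 2)).aestronglyMeasurable
    refine (integrable_prod_iff' hs).2
      ⟨hae.mono fun w hw => hw.1.mul_prod hw.2, (hA.mul_prod hA).congr ?_⟩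
    refine Eventually.of_forall fun w => ?_
    simp only [norm_mul, norm_pow, Real.norm_eq_abs, sq_abs]
    exact (integral_prod_mul (μ := P) (ν := P) (fun ω => X ω w.1 ^ 2) (fun ω => X ω w.2 ^ 2)).symm
  have h2 : Integrable (fun q : (Ω × Ω) × (ℝ × ℝ) => X q.1.1 q.2.2 ^ 2 * X q.1.2 q.2.1 ^ 2)
      ((P.prod P).prod (μ.prod μ)) := by
    have hs : AEStronglyMeasurable (fun q : (Ω × Ω) × (ℝ × ℝ) =>
        X q.1.1 q.2.2 ^ 2 * X q.1.2 q.2.1 ^ 2) ((P.prod P).prod (μ.prod μ)) :=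
      ((m12.pow_const 2).mul (m21.pow_const 2)).aestronglyMeasurable
    refine (integrable_prod_iff' hs).2
      ⟨hae.mono fun w hw => hw.2.mul_prod hw.1, (hA.mul_prod hA).congr ?_⟩
    refine Eventually.of_forall fun w => ?_
    simp only [norm_mul, norm_pow, Real.norm_eq_abs, sq_abs]
    rw [mul_comm]
    exact (integral_prod_mul (μ := P) (ν := P) (fun ω => X ω w.2 ^ 2) (fun ω => X ω w.1 ^ 2)).symm
  refine (h1.add h2).mono' ((m11.mul m12).mul (m21.mul m22)).aestronglyMeasurable
    (Eventually.of_forall fun q => ?_)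
  rw [Real.norm_eq_abs, abs_le, Pi.add_apply]
  constructor <;>
  nlinarith [sq_nonneg (X q.1.1 q.2.1 * X q.1.2 q.2.2 - X q.1.1 q.2.2 * X q.1.2 q.2.1),
    sq_nonneg (X q.1.1 q.2.1 * X q.1.2 q.2.2 + X q.1.1 q.2.2 * X q.1.2 q.2.1)]

lemma ae_covKernel_sq_eq (h0 : ∀ᵐ u ∂μ, ∫ ω, X ω u ∂P = 0) :
    ∀ᵐ w ∂(μ.prod μ), covKernel P X w.1 w.2 ^ 2 =
      ∫ z : Ω × Ω, (X z.1 w.1 * X z.1 w.2) * (X z.2 w.1 * X z.2 w.2) ∂(P.prod P) := by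
  filter_upwards [Measure.quasiMeasurePreserving_fst.ae h0,
    Measure.quasiMeasurePreserving_snd.ae h0] with w h1 h2
  rw [covKernel_eq_integral_mul h1 h2, sq]
  exact (integral_prod_mul (fun ω => X ω w.1 * X ω w.2) (fun ω => X ω w.1 * X ω w.2)).symm

lemma integrable_covKernel_sq (hX : MemLp (Function.uncurry X) 2 (P.prod μ))
    (hXm : Measurable (Function.uncurry X)) (h0 : ∀ᵐ u ∂μ, ∫ ω, X ω u ∂P = 0) :
    Integrable (fun w : ℝ × ℝ => covKernel P X w.1 w.2 ^ 2) (μ.prod μ) :=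
  (integrable_mul_four hX hXm).integral_prod_right.congr
    ((ae_covKernel_sq_eq h0).mono fun _ h => h.symm)

/-- The expected squared inner product of two independent copies of `X` is the squared
Hilbert-Schmidt norm of the covariance kernel. -/
lemma integral_inner_toL2_sq (hX : MemLp (Function.uncurry X) 2 (P.prod μ))
    (hXm : Measurable (Function.uncurry X)) (h0 : ∀ᵐ u ∂μ, ∫ ω, X ω u ∂P = 0) :
    ∫ z : Ω × Ω, inner ℝ (toL2 μ (X z.1)) (toL2 μ (X z.2)) ^ 2 ∂(P.prod P) =
      ∫ w : ℝ × ℝ, covKernel P X w.1 w.2 ^ 2 ∂(μ.prod μ) := by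
  have hmem := ae_memLp_of_memLp_uncurry hX hXm
  rw [integral_congr_ae (ae_covKernel_sq_eq h0),
    ← integral_integral_swap (integrable_mul_four hX hXm)]
  refine integral_congr_ae ?_
  filter_upwards [Measure.quasiMeasurePreserving_fst.ae hmem,
    Measure.quasiMeasurePreserving_snd.ae hmem] with z h1 h2
  rw [inner_toL2 h1 h2, sq, ← integral_prod_mul]
  refine integral_congr_ae (Eventually.of_forall fun w => ?_)
  ring

end RandomFunctions

/-! ### The innovations as white noise -/

section Innovations

variable {Ω : Type*} [MeasurableSpace Ω] {P : Measure Ω} [IsProbabilityMeasure P]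

lemma secondCountableTopology_L2 (μ : Measure ℝ) [IsProbabilityMeasure μ] :
    SecondCountableTopology (Lp ℝ 2 μ) := by
  have : Fact ((2 : ENNReal) ≠ ⊤) := ⟨by simp⟩
  infer_instance

/-- The pair `(e_0, e_1)` may be replaced by `e_0` evaluated at two independent points of `Ω`. -/
lemma integral_inner_sq_eq_noiseVar {H : Type*} [NormedAddCommGroup H] [InnerProductSpace ℝ H]
    [CompleteSpace H] [SecondCountableTopology H] [MeasurableSpace H] [BorelSpace H]
    {e : ℤ → Ω → H} (he : IsWhiteNoise P e) :
    noiseVar P e = ∫ z : Ω × Ω, inner ℝ (e 0 z.1) (e 0 z.2) ^ 2 ∂(P.prod P) := by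
  have h1 := (he.indep.indepFun (zero_ne_one (α := ℤ))).map_prod_eq_prod_map_map
    (he.measurable 0).aemeasurable (he.measurable 1).aemeasurable
  rw [(he.identDistrib 1).map_eq,
    Measure.map_prod_map P P (he.measurable 0) (he.measurable 0)] at h1
  have h2 : Measurable fun z : H × H => (inner ℝ z.1 z.2 : ℝ) ^ 2 := by fun_prop
  have h3 := integral_map (μ := P) ((he.measurable 0).prodMk (he.measurable 1)).aemeasurable
    h2.aestronglyMeasurable
  have h4 := integral_map (μ := P.prod P)
    ((he.measurable 0).prodMap (he.measurable 0)).aemeasurable h2.aestronglyMeasurable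
  rw [← h1] at h4
  exact h3.symm.trans h4

variable {μ : Measure ℝ} [IsProbabilityMeasure μ] {ε : ℤ → Ω → ℝ → ℝ}

lemma IsInnovation.memLp_uncurry (hε : IsInnovation μ P ε) (t : ℤ) :
    MemLp (Function.uncurry (ε t)) 2 (P.prod μ) :=
  WAR.memLp_uncurry (hε.measurable t) (hε.memLp_two t) (hε.mean_zero t) (hε.integrable_covKernel t)

/-- The innovations have a version which is white noise in `L²(μ)`. -/
lemma IsInnovation.exists_isWhiteNoise [MeasurableSpace (Lp ℝ 2 μ)] [BorelSpace (Lp ℝ 2 μ)]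
    [SecondCountableTopology (Lp ℝ 2 μ)] (hε : IsInnovation μ P ε) :
    ∃ e : ℤ → Ω → Lp ℝ 2 μ, IsWhiteNoise P e ∧ (∀ t, e t =ᵐ[P] fun ω => toL2 μ (ε t ω)) ∧
      ∫ ω, ‖e 0 ω‖ ^ 2 ∂P = ∫ u, covKernel P (ε 0) u u ∂μ ∧
      noiseVar P e = ∫ w : ℝ × ℝ, covKernel P (ε 0) w.1 w.2 ^ 2 ∂(μ.prod μ) := by
  have hb : ‹MeasurableSpace (Lp ℝ 2 μ)› = borel (Lp ℝ 2 μ) := BorelSpace.measurable_eq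
  have hid := hε.identDistrib
  have hind := hε.indep
  rw [← hb] at hid hind
  have ham : ∀ t, AEMeasurable (fun ω => toL2 μ (ε t ω)) P := fun t => (hid t).aemeasurable_fst
  have hee : ∀ t, (ham t).mk _ =ᵐ[P] fun ω => toL2 μ (ε t ω) := fun t => (ham t).ae_eq_mk.symm
  obtain ⟨hi, hn⟩ := integral_norm_sq_toL2 (hε.memLp_uncurry 0) (hε.measurable 0) (hε.mean_zero 0)
  have h2 : MemLp (fun ω => toL2 μ (ε 0 ω)) 2 P :=
    (memLp_two_iff_integrable_sq_norm (ham 0).aestronglyMeasurable).2 hi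
  have hw : IsWhiteNoise P (fun t => (ham t).mk _) :=
    { measurable := fun t => (ham t).measurable_mk
      indep := hind.congr fun t => (hee t).symm
      identDistrib := fun t =>
        ((IdentDistrib.of_ae_eq (ham t) (hee t).symm).symm.trans (hid t)).trans
          (IdentDistrib.of_ae_eq (ham 0) (hee 0).symm)
      memLp_zero := h2.ae_eq (hee 0).symm
      integral_zero := by
        rw [integral_congr_ae (hee 0)]
        exact integral_toL2_eq_zero (hε.memLp_uncurry 0) (hε.measurable 0) (hε.mean_zero 0)
          (h2.integrable one_le_two) }
  refine ⟨_, hw, hee, ?_, ?_⟩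
  · rw [← hn]
    refine integral_congr_ae ?_
    filter_upwards [hee 0] with ω hω
    rw [hω]
  · rw [integral_inner_sq_eq_noiseVar hw,
      ← integral_inner_toL2_sq (hε.memLp_uncurry 0) (hε.measurable 0) (hε.mean_zero 0)]
    refine integral_congr_ae ?_
    filter_upwards [Measure.quasiMeasurePreserving_fst.ae (hee 0),
      Measure.quasiMeasurePreserving_snd.ae (hee 0)] with z h3 h4
    rw [h3, h4]

end Innovations

/-! ### Second moments of a stationary sequence -/

section Stationary

variable {Ω : Type*} [MeasurableSpace Ω] {P : Measure Ω} [IsProbabilityMeasure P]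
  {H : Type*} [NormedAddCommGroup H] [InnerProductSpace ℝ H] [CompleteSpace H]
  [SecondCountableTopology H]

/-- Balls of radius `1 / 2` around the members of an orthonormal family are disjoint. -/
lemma countable_of_orthonormal {ι : Type*} {v : ι → H} (hv : Orthonormal ℝ v) : Countable ι := by
  have h1 : (Set.univ : Set ι).PairwiseDisjoint fun i => Metric.ball (v i) (1 / 2) := by
    intro i _ j _ hij
    refine Metric.ball_disjoint_ball ?_
    have h2 : ‖v i - v j‖ ^ 2 = 2 := by
      rw [norm_sub_sq_real, hv.1 i, hv.1 j, hv.2 hij]; norm_num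
    rw [dist_eq_norm]
    nlinarith [norm_nonneg (v i - v j)]
  exact Set.countable_univ_iff.1 (h1.countable_of_isOpen (fun _ _ => Metric.isOpen_ball)
    fun i _ => ⟨v i, Metric.mem_ball_self (by norm_num)⟩)

/-- The second moment is determined by the covariance operator (it is its trace). -/
lemma lintegral_norm_sq_eq_of_inner_sq {Y Z : Ω → H} (hY : MemLp Y 2 P) (hZ : MemLp Z 2 P)
    (h : ∀ x, ∫ ω, inner ℝ (Y ω) x ^ 2 ∂P = ∫ ω, inner ℝ (Z ω) x ^ 2 ∂P) :
    ∫⁻ ω, ENNReal.ofReal (‖Y ω‖ ^ 2) ∂P = ∫⁻ ω, ENNReal.ofReal (‖Z ω‖ ^ 2) ∂P := by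
  obtain ⟨w, b, -⟩ := exists_hilbertBasis ℝ H
  have hc : Countable w := countable_of_orthonormal b.orthonormal
  have key : ∀ {W : Ω → H}, MemLp W 2 P → ∫⁻ ω, ENNReal.ofReal (‖W ω‖ ^ 2) ∂P =
      ∑' i, ENNReal.ofReal (∫ ω, inner ℝ (W ω) (b i) ^ 2 ∂P) := by
    intro W hW
    have hin : ∀ i, MemLp (fun ω => inner ℝ (W ω) (b i)) 2 P := fun i => hW.inner_const (b i)
    have h1 : ∀ ω, ENNReal.ofReal (‖W ω‖ ^ 2) =
        ∑' i, ENNReal.ofReal (inner ℝ (W ω) (b i) ^ 2) := by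
      intro ω
      have h2 := b.hasSum_inner_mul_inner (W ω) (W ω)
      simp_rw [real_inner_comm (W ω) (b _), ← sq] at h2
      rw [← real_inner_self_eq_norm_sq, ← h2.tsum_eq,
        ENNReal.ofReal_tsum_of_nonneg (fun _ => sq_nonneg _) h2.summable]
    simp_rw [h1]
    rw [lintegral_tsum fun i =>
      ((hin i).integrable_sq.aestronglyMeasurable.aemeasurable).ennreal_ofReal]
    refine tsum_congr fun i => ?_
    rw [ofReal_integral_eq_lintegral_ofReal (hin i).integrable_sq
      (Eventually.of_forall fun _ => sq_nonneg _)]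
  rw [key hY, key hZ]
  simp_rw [h]

/-- The trace of the lag-zero autocovariance operator does not depend on time, so a stationary
sequence is bounded in `L²`. -/
lemma IsStationary.exists_eLpNorm_le {V : ℤ → Ω → H} (hV : IsStationary P V) :
    ∃ K : ℝ, ∀ t, eLpNorm (V t) 2 P ≤ ENNReal.ofReal K := by
  set m : H := ∫ ω, V 0 ω ∂P with hm
  have hY : ∀ t, MemLp (fun ω => V t ω - m) 2 P := fun t => (hV.memLp_two t).sub (memLp_const m)
  have hint : ∀ t x, Integrable (fun ω => inner ℝ (V t ω - m) x • (V t ω - m)) P := fun t x =>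
    memLp_one_iff_integrable.1 ((hY t).smul ((hY t).inner_const x))
  have h1 : ∀ t x, ∫ ω, inner ℝ (V t ω - m) x ^ 2 ∂P = ∫ ω, inner ℝ (V 0 ω - m) x ^ 2 ∂P := by
    have h2 : ∀ t x, ∫ ω, inner ℝ (V t ω - m) x ^ 2 ∂P =
        inner ℝ x (∫ ω, inner ℝ (V t ω - m) x • (V t ω - m) ∂P) := by
      intro t x
      rw [← integral_inner (hint t x)]
      refine integral_congr_ae (Eventually.of_forall fun ω => ?_)
      simp only [inner_smul_right, real_inner_comm, sq]
    intro t x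
    have h3 := hV.autocov_eq t 0 x
    rw [add_zero] at h3
    rw [h2, h2, h3]
  have h2 : ∀ t, eLpNorm (fun ω => V t ω - m) 2 P = eLpNorm (fun ω => V 0 ω - m) 2 P := by
    intro t
    have h3 := lintegral_norm_sq_eq_of_inner_sq (hY t) (hY 0) (h1 t)
    simp only [ENNReal.ofReal_pow (norm_nonneg _), ofReal_norm] at h3
    simp only [eLpNorm_eq_lintegral_rpow_enorm_toReal two_ne_zero ENNReal.ofNat_ne_top,
      ENNReal.toReal_ofNat, ENNReal.rpow_ofNat]
    rw [h3]
  refine ⟨(eLpNorm (fun ω => V 0 ω - m) 2 P + eLpNorm (fun _ : Ω => m) 2 P).toReal, fun t => ?_⟩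
  rw [ENNReal.ofReal_toReal (ENNReal.add_ne_top.2 ⟨(hY 0).eLpNorm_ne_top,
    (memLp_const m).eLpNorm_ne_top⟩), ← h2 t]
  refine le_trans (le_of_eq ?_) (eLpNorm_add_le (hY t).aestronglyMeasurable
    aestronglyMeasurable_const one_le_two)
  congr 1
  funext ω
  simp

end Stationary

end WAR

theorem theorem4 {Ω : Type*} [MeasurableSpace Ω] (P : Measure Ω) [IsProbabilityMeasure P]
    (μ : Measure ℝ) (hμ : WAR.IsDensity μ) (hsupp : μ.support.OrdConnected)
    (p : ℕ) (β : EuclideanSpace ℝ (Fin p)) (hβ : WAR.NoRootInUnitDisk β)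
    (ε : ℤ → Ω → ℝ → ℝ) (hε : WAR.IsInnovation μ P ε)
    (hε_ne : 0 < ∫ u, WAR.covKernel P (ε 0) u u ∂μ)
    (V : ℤ → Ω → Lp ℝ 2 μ) (hV : WAR.IsStationarySolution μ P β ε V)
    (hV' : WAR.HasDerivGtNegOne μ P V) (hε4 : WAR.HasFourthMoment μ P ε) :
    Summable (fun i => |WAR.psi β i|) ∧
    Integrable (fun z : ℝ × ℝ => WAR.covKernel P (ε 0) z.1 z.2 ^ 2) (μ.prod μ) ∧
    (WAR.psiMatrix β).PosDef ∧
    TendstoInDistribution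
      (fun (n : ℕ) (ω : Ω) => √(n : ℝ) • (WAR.betaEst (WAR.quantileSeries μ V ω) n p - β))
      atTop id (fun _ => P) (multivariateGaussian 0 (WAR.asympCov μ P ε β)) := by
  have : IsProbabilityMeasure μ := hμ.1.1
  refine ⟨WAR.summable_abs_psi β hβ, WAR.integrable_covKernel_sq (hε.memLp_uncurry 0)
    (hε.measurable 0) (hε.mean_zero 0), WAR.posDef_psiMatrix β hβ, ?_⟩
  have := WAR.secondCountableTopology_L2 μ
  -- the innovations are iid for the Borel σ-algebra
  let : MeasurableSpace (Lp ℝ 2 μ) := borel _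
  have : BorelSpace (Lp ℝ 2 μ) := ⟨rfl⟩
  obtain ⟨e, he, hee, hτ, hκ⟩ := hε.exists_isWhiteNoise
  obtain ⟨K, hK⟩ := hV.stationary.exists_eLpNorm_le
  have h := WAR.tendstoInDistribution_yuleWalker_hilbert β hβ he (hτ ▸ hε_ne)
    hV.stationary.memLp_two hK (fun t => by
      filter_upwards [hV.equation t, hee t] with ω h1 h2
      rw [h1, h2])
    (fun n h ω => WAR.etaInt (WAR.quantileSeries μ V ω) n h) fun n h => by
      filter_upwards [ae_all_iff.2 hV'] with ω hω
      exact WAR.etaInt_quantile_expMap hμ.2 hsupp (fun t => V t ω) hω n h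
  rw [hτ, hκ] at h
  exact h
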